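/- **Definitions.** For a discrete random variable $(X,Y)$ with $X\in\{0,1\}$ let $\mathrm{PredAdv}(X\mid Y):=2\max_f\Pr[f(Y)=X]-1$, the maximum being over all functions $f$ into $\{0,1\}$. A collection of systems $\mathbf F=(\mathbf F_\emptyset,\mathbf F_{\{\hat A\}},\mathbf F_{\{\hat B\}})$, which outputs $(X_0,X_1)\in\{0,1\}^2$ to player A and $(C,Y)\in\{0,1\}^2$ to player B, and in addition an auxiliary output to the passively corrupted player $\hat A$ or $\hat B$, implements $\mathrm{WOT}(p,q,\varepsilon)$ in the semi-honest model if, with $E:=X_C\oplus Y$, we have $\Pr[E=1]\le\varepsilon$ (in $\mathbf F_\emptyset$), $\mathrm{PredAdv}(X_{1-C}\mid V,E)\le q$ (in $\mathbf F_{\{\hat B\}}$) and $\mathrm{PredAdv}(C\mid U,E)\le p$ (in $\mathbf F_{\{\hat A\}}$), where $V$ (resp. $U$) is everything the corrupted player B (resp. A) sees, i.e. his regular and his auxiliary output. A two-party protocol using $n$ independent instances of WOT and a noiseless channel is itself such a collection; the view of a passively corrupted player consists of everything he gets from the instances, his random bits, all messages and his output. A family of protocols indexed by $k\ge 1$ is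 *efficient* if uniform programs compute $1^{n(k)}$ ($n(k)$ the number of instances used), the numbers of random bits and messages, all messages and all outputs, each in time polynomial in $k+n(k)$. A function $f:\mathbb N_{\ge1}\to[0,\infty)$ is computable in time $\mathrm{poly}(k)$ if a program, given $1^k,1^m$, computes in time $\mathrm{poly}(k+m)$ a dyadic rational $a/2^m$, $a\in\mathbb N$, with $|f(k)-a/2^m|\le 2^{-m}$. **Theorem.** There is a universal constant $c>0$ such that the following holds. Let $q,\varepsilon:\mathbb N_{\ge1}\to[0,\infty)$ be functions computable in time $\mathrm{poly}(k)$ such that $\sqrt{q(k)}+2\varepsilon(k)<1$ for all $k\ge 1$, and let $$\lambda:=\lambda(k):=\max\left(1,\frac1{\log_2\left((1-2\varepsilon(k))^2/q(k)\right)}\right)\qquad(\lambda(k):=1\text{ if }q(k)=0).$$ 1. There is an efficient family of protocols which for every $k\ge1$ implements $\mathrm{WOT}(0,2^{-k},2^{-k})$ in the semi-honest model from any $n(k)$ independent instances of $\mathrm{WOT}(0,q(k),\varepsilon(k))$, where $$n(k)\le c\cdot\frac{k^{2.6}\,\lambda(k)}{(1-2\varepsilon(k))^{12\lambda(k)}}.$$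 2. Symmetrically, there is an efficient family of protocols which for every $k\ge1$ implements $\mathrm{WOT}(2^{-k},0,2^{-k})$ in the semi-honest model from any $n(k)$ independent instances of $\mathrm{WOT}(q(k),0,\varepsilon(k))$, with the same bound on $n(k)$. -/

import Mathlib

/-! ## Programs with a step count

Structured programs over finitely many stacks of bits (a multi-tape Turing machine, one tape per
stack, with its finite control written as a program). Every elementary operation costs one step. -/

abbrev Bits := List Bool

inductive Cmd : Type
  | skip : Cmd
  | push (r : ℕ) (b : Bool) : Cmd
  | pop (r : ℕ) : Cmd
  | seq (c d : Cmd) : Cmd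
  /-- Branch on the top of stack `r`: empty, `false`, or `true`. -/
  | branch (r : ℕ) (onEmpty onFalse onTrue : Cmd) : Cmd
  /-- Repeat `c` as long as stack `r` is not empty. -/
  | loop (r : ℕ) (c : Cmd) : Cmd

abbrev Store := ℕ → Bits

/-- `Runs c s t s'`: started in store `s`, the program `c` halts in store `s'` after exactly
`t` steps. -/
inductive Runs : Cmd → Store → ℕ → Store → Prop
  | skip (s : Store) : Runs Cmd.skip s 1 s
  | push (s : Store) (r : ℕ) (b : Bool) :
      Runs (Cmd.push r b) s 1 (Function.update s r (b :: s r))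
  | pop (s : Store) (r : ℕ) : Runs (Cmd.pop r) s 1 (Function.update s r (s r).tail)
  | seq {c d : Cmd} {s s' s'' : Store} {t t' : ℕ} :
      Runs c s t s' → Runs d s' t' s'' → Runs (Cmd.seq c d) s (t + t') s''
  | branchEmpty {r : ℕ} {c₀ c₁ c₂ : Cmd} {s s' : Store} {t : ℕ} :
      s r = [] → Runs c₀ s t s' → Runs (Cmd.branch r c₀ c₁ c₂) s (t + 1) s'
  | branchFalse {r : ℕ} {c₀ c₁ c₂ : Cmd} {s s' : Store} {t : ℕ} :
      (s r).head? = some false → Runs c₁ s t s' → Runs (Cmd.branch r c₀ c₁ c₂) s (t + 1) s'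
  | branchTrue {r : ℕ} {c₀ c₁ c₂ : Cmd} {s s' : Store} {t : ℕ} :
      (s r).head? = some true → Runs c₂ s t s' → Runs (Cmd.branch r c₀ c₁ c₂) s (t + 1) s'
  | loopDone {r : ℕ} {c : Cmd} {s : Store} : s r = [] → Runs (Cmd.loop r c) s 1 s
  | loopStep {r : ℕ} {c : Cmd} {s s' s'' : Store} {t t' : ℕ} :
      s r ≠ [] → Runs c s t s' → Runs (Cmd.loop r c) s' t' s'' →
        Runs (Cmd.loop r c) s (t + t' + 1) s''

/-- On the inputs `ins` (the `i`-th input on stack `i`, all other stacks empty) the program halts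
after at most `bound` steps with `out` on stack `0`. -/
def Cmd.OutputsWithin (c : Cmd) (ins : List Bits) (bound : ℕ) (out : Bits) : Prop :=
  ∃ t ≤ bound, ∃ s' : Store, Runs c (fun r => ins.getD r []) t s' ∧ s' 0 = out

def unary (k : ℕ) : Bits := List.replicate k true

/-- A function `f` of the parameter `k ≥ 1` with nonnegative real values is computable in time
polynomial in `k`: on input `1ᵏ, 1ᵐ` a program computes in time polynomial in `k + m` the
numerator `a k m` (in binary) of a dyadic rational `a k m / 2ᵐ` at distance at most `2⁻ᵐ`
from `f k`. -/
def PolyTimeComputable (f : ℕ → ℝ) : Prop :=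
  ∃ (c : Cmd) (poly : Polynomial ℕ) (a : ℕ → ℕ → ℕ), ∀ k ≥ 1, ∀ m : ℕ,
    c.OutputsWithin [unary k, unary m] (poly.eval (k + m)) (Nat.bits (a k m)) ∧
    |f k - (a k m : ℝ) / 2 ^ m| ≤ 1 / 2 ^ m

/-! ## Prediction advantage and weak oblivious transfer -/

noncomputable section

/-- The probability of the event `S`. -/
def prob {Ω : Type} (μ : PMF Ω) (S : Set Ω) : ℝ := (μ.toOuterMeasure S).toReal

/-- The maximal bit-prediction advantage `2 · max_f Pr[f(Y) = X] - 1` of `X` from `Y`, for the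
joint distribution `μ` of `(X, Y)`. -/
def predAdv {Y : Type} (μ : PMF (Bool × Y)) : ℝ :=
  2 * (⨆ f : Y → Bool, prob μ {w | f w.2 = w.1}) - 1

/-- `((x₀, x₁), (c, y))`: the output `(x₀, x₁)` of the sender A and `(c, y)` of the receiver B. -/
abbrev Outcome := (Bool × Bool) × (Bool × Bool)

/-- `select (x₀, x₁) c = x_c`. -/
def select (x : Bool × Bool) (c : Bool) : Bool := if c then x.2 else x.1

/-- `E = x_c ⊕ y`. -/
def errorBit (o : Outcome) : Bool := xor (select o.1 o.2.1) o.2.2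

/-- A collection of input-free systems in the semi-honest model: the system `F_∅` for honest
players, and the systems `F_{A}` and `F_{B}` which give in addition an auxiliary output in `U`,
respectively `V`, to the passively corrupted player A, respectively B. -/
structure SemiHonestSystem (U V : Type) where
  honest : PMF Outcome
  corruptA : PMF (Outcome × U)
  corruptB : PMF (Outcome × V)

/-- `F` implements `WOT(p, q, ε)` in the semi-honest model. The information of a corrupted player
consists of his regular output and of his auxiliary output. -/
def SemiHonestSystem.IsWOT {U V : Type} (F : SemiHonestSystem U V) (p q ε : ℝ) : Prop :=
  -- correctness
  prob F.honest {o | errorBit o = true} ≤ ε ∧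
  -- security for A: `predAdv (X_{1-C} | V, E) ≤ q`
  predAdv (F.corruptB.map fun w => (select w.1.1 (!w.1.2.1), ((w.1.2, w.2), errorBit w.1))) ≤ q ∧
  -- security for B: `predAdv (C | U, E) ≤ p`
  predAdv (F.corruptA.map fun w => (w.1.2.1, ((w.1.1, w.2), errorBit w.1))) ≤ p

/-! ## Two-party protocols over a noiseless channel -/

/-- A two-party protocol with `n` instances of a system with outcomes in `Outcome` and a noiseless
channel, in which each player has `ρ` random bits. The players send bit strings in turn, starting
with B (a message may be empty). A message depends on the outputs that the player got from the `n`
instances, on his random bits and on the messages exchanged so far; after `rounds` messages each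
player determines his output from the same data. -/
structure Protocol (n ρ : ℕ) where
  rounds : ℕ
  msgA : (Fin n → Bool × Bool) → (Fin ρ → Bool) → List Bits → Bits
  msgB : (Fin n → Bool × Bool) → (Fin ρ → Bool) → List Bits → Bits
  outA : (Fin n → Bool × Bool) → (Fin ρ → Bool) → List Bits → Bool × Bool
  outB : (Fin n → Bool × Bool) → (Fin ρ → Bool) → List Bits → Bool × Bool

namespace Protocol

variable {n ρ : ℕ}

/-- The first `t` messages, if A gets `xs` and B gets `ys` from the instances and the players have
the random bits `ra` and `rb`. -/
def transcript (P : Protocol n ρ) (xs ys : Fin n → Bool × Bool) (ra rb : Fin ρ → Bool) :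
    ℕ → List Bits
  | 0 => []
  | t + 1 =>
      P.transcript xs ys ra rb t ++
        [if Even t then P.msgB ys rb (P.transcript xs ys ra rb t)
          else P.msgA xs ra (P.transcript xs ys ra rb t)]

def fullTranscript (P : Protocol n ρ) (xs ys : Fin n → Bool × Bool) (ra rb : Fin ρ → Bool) :
    List Bits :=
  P.transcript xs ys ra rb P.rounds

def outcome (P : Protocol n ρ) (xs ys : Fin n → Bool × Bool) (ra rb : Fin ρ → Bool) : Outcome :=
  (P.outA xs ra (P.fullTranscript xs ys ra rb), P.outB ys rb (P.fullTranscript xs ys ra rb))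

end Protocol

/-- The joint distribution of independent random variables with distributions `μ 0, …, μ (n-1)`. -/
def indep {α : Type} : (n : ℕ) → (Fin n → PMF α) → PMF (Fin n → α)
  | 0, _ => PMF.pure Fin.elim0
  | n + 1, μ => (μ 0).bind fun a => (indep n fun i => μ i.succ).map fun w => Fin.cons a w

def coins (ρ : ℕ) : PMF (Fin ρ → Bool) := PMF.uniformOfFintype (Fin ρ → Bool)

/-- The view of a passively corrupted player, except for his output in the protocol: what he gets
from the instances (regular outputs and auxiliary outputs), his random bits and all messages. -/
abbrev View (n ρ : ℕ) (W : Type) :=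
  (Fin n → (Bool × Bool) × W) × (Fin ρ → Bool) × List Bits

/-- The system which results from running the protocol with the `n` independent systems `F i`. -/
def Protocol.run {n ρ : ℕ} (P : Protocol n ρ) {U V : Type} (F : Fin n → SemiHonestSystem U V) :
    SemiHonestSystem (View n ρ U) (View n ρ V) where
  honest :=
    (indep n fun i => (F i).honest).bind fun w =>
    (coins ρ).bind fun ra => (coins ρ).bind fun rb => PMF.pure
      (P.outcome (fun i => (w i).1) (fun i => (w i).2) ra rb)
  corruptA :=
    (indep n fun i => (F i).corruptA).bind fun w =>
    (coins ρ).bind fun ra => (coins ρ).bind fun rb => PMF.pure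
      (P.outcome (fun i => (w i).1.1) (fun i => (w i).1.2) ra rb,
        (fun i => ((w i).1.1, (w i).2)), ra,
          P.fullTranscript (fun i => (w i).1.1) (fun i => (w i).1.2) ra rb)
  corruptB :=
    (indep n fun i => (F i).corruptB).bind fun w =>
    (coins ρ).bind fun ra => (coins ρ).bind fun rb => PMF.pure
      (P.outcome (fun i => (w i).1.1) (fun i => (w i).1.2) ra rb,
        (fun i => ((w i).1.2, (w i).2)), rb,
          P.fullTranscript (fun i => (w i).1.1) (fun i => (w i).1.2) ra rb)

end

/-! ## Efficient implementations -/

def encodePairs {n : ℕ} (w : Fin n → Bool × Bool) : Bits :=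
  (List.ofFn w).flatMap fun a => [a.1, a.2]

/-- Each bit `b` of a message is written as `1b`, the end of a message as `0`. -/
def encodeMessages (l : List Bits) : Bits :=
  l.flatMap fun m => (m.flatMap fun b => [true, b]) ++ [false]

/-- The input of a player's program: `1ᵏ`, the outputs of the instances to this player, his random
bits, and the messages exchanged so far. -/
def playerInput (k : ℕ) {n ρ : ℕ} (w : Fin n → Bool × Bool) (r : Fin ρ → Bool) (l : List Bits) :
    List Bits :=
  [unary k, encodePairs w, List.ofFn r, encodeMessages l]

/-- The family of protocols `P k`, `k ≥ 1`, is efficient: fixed programs determine the number of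
instances, of random bits and of messages, every message and every output, each within a number of
steps that is polynomial in `k` and in the number `n k` of instances. -/
def IsEfficient (n ρ : ℕ → ℕ) (P : (k : ℕ) → Protocol (n k) (ρ k)) : Prop :=
  ∃ (poly : Polynomial ℕ) (cn cρ ct mA mB oA oB : Cmd), ∀ k ≥ 1,
    cn.OutputsWithin [unary k] (poly.eval (k + n k)) (unary (n k)) ∧
    cρ.OutputsWithin [unary k] (poly.eval (k + n k)) (unary (ρ k)) ∧
    ct.OutputsWithin [unary k] (poly.eval (k + n k)) (unary (P k).rounds) ∧
    ∀ (xs ys : Fin (n k) → Bool × Bool) (ra rb : Fin (ρ k) → Bool),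
      (∀ t < (P k).rounds,
        (Even t → mB.OutputsWithin
          (playerInput k ys rb ((P k).transcript xs ys ra rb t)) (poly.eval (k + n k))
          ((P k).msgB ys rb ((P k).transcript xs ys ra rb t))) ∧
        (¬ Even t → mA.OutputsWithin
          (playerInput k xs ra ((P k).transcript xs ys ra rb t)) (poly.eval (k + n k))
          ((P k).msgA xs ra ((P k).transcript xs ys ra rb t)))) ∧
      oA.OutputsWithin
        (playerInput k xs ra ((P k).fullTranscript xs ys ra rb)) (poly.eval (k + n k))
        [((P k).outcome xs ys ra rb).1.1, ((P k).outcome xs ys ra rb).1.2] ∧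
      oB.OutputsWithin
        (playerInput k ys rb ((P k).fullTranscript xs ys ra rb)) (poly.eval (k + n k))
        [((P k).outcome xs ys ra rb).2.1, ((P k).outcome xs ys ra rb).2.2]

/-- `WOT(p'(k), q'(k), ε'(k))` can efficiently be implemented using at most `N k` instances of
`WOT(p(k), q(k), ε(k))`, secure in the semi-honest model. The protocol is fixed before the
instances of WOT are; these are independent, but need not be the same system. -/
def EfficientlyImplementable (p q ε p' q' ε' N : ℕ → ℝ) : Prop :=
  ∃ (n ρ : ℕ → ℕ) (P : (k : ℕ) → Protocol (n k) (ρ k)),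
    IsEfficient n ρ P ∧
    ∀ k ≥ 1, (n k : ℝ) ≤ N k ∧
      ∀ (U V : Type) (F : Fin (n k) → SemiHonestSystem U V),
        (∀ i, (F i).IsWOT (p k) (q k) (ε k)) →
          ((P k).run F).IsWOT (p' k) (q' k) (ε' k)

/-- `λ = max (1, 1 / log₂ ((1 - 2ε)² / q))`; it equals `1` if `q = 0`. -/
noncomputable def lam (q ε : ℝ) : ℝ := max 1 (1 / Real.logb 2 ((1 - 2 * ε) ^ 2 / q))

/-! Let the sender hold (h, v) = (x₀ ⊕ x₁, x₀) and the receiver (c, y). An instance with error bit e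
satisfies v ⊕ y = h c ⊕ e, which is symmetric in the players. Since X_{1-C} = (X₀ ⊕ X₁) ⊕ Y ⊕ E and
a corrupted B knows Y and E, security for A means that h is hard to predict
(`predAdv_other_le_iff`). Part 2 is therefore part 1 with B in the role of the sender.

The receiver announces the differences of his choice bits, and the sender absorbs them into v, so
that all instances share one choice bit c. Flipping all choice bits changes nothing the sender sees,
so perfect security of the receiver survives (`sender_secure`). Two operations follow. The exclusive
or of r instances turns the receiver's advantage q into q ^ r and the bias α = 1 - 2ε of the error
into α ^ r. In a majority over s instances the sender reveals the differences of his pairs to the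
first pair; the receiver gets s estimates of one bit, so the error drops by a Chernoff bound
(`maj_error_sq_le`). The revealed differences do not change if all s secrets are flipped, so a
hybrid argument bounds the advantage by s q (`ev_odd_le`).

The hypothesis says q < α². One level with l = ⌊6λ⌋ makes (α² / q) ^ l at least 35, and a majority
over N = ⌈5.1 / α ^ (2l)⌉ then brings both error and advantage below fixed constants
(`exists_parameters`). Each further level, with blocks of 2 and of 3, squares both 3q and 12ε at the
price of a factor 6. About log₂ k such levels suffice, and 6 < 2 ^ 2.6 gives the exponent of k.

Independence is delicate in the security proof against the receiver, because all nodes share c. A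
node is therefore described by its secret s and by an `Info` containing the bit k for which the
sender's pair is (s, k ⊕ c s). This description does not involve the common c, so laws of nodes
combine independently (`seqL_combines`), and the whole transcript can be recovered from the root's
`Info` and c (`exists_infos`, `exists_sendMsg`, `receiver_secure`).

For efficiency, q and ε are available only through dyadic approximations. A search finds the least t
for which fixed-point arithmetic, rounded to the safe side, certifies some l and N = t / l. The
slack in the constants makes it succeed by t = l N (`goodPair_of_parameters`), and the players
recover t from n by the same search, as t ≤ n. Programs are obtained from the class `PT` of
polynomial time functions, which is closed under composition, pairing, bounded iteration and folds.
-/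

/-! ## Reasoning about programs -/

/-- The program `c` leads from the store `s` to the store `s'` in at most `T` steps. -/
def RunsIn (c : Cmd) (s : Store) (T : ℕ) (s' : Store) : Prop := ∃ t ≤ T, Runs c s t s'

namespace RunsIn

theorem mono {c : Cmd} {s s' : Store} {T T' : ℕ} (h : RunsIn c s T s') (hT : T ≤ T') :
    RunsIn c s T' s' :=
  let ⟨t, ht, hr⟩ := h
  ⟨t, ht.trans hT, hr⟩

theorem seq {c d : Cmd} {s s' s'' : Store} {T T' : ℕ} (h : RunsIn c s T s')
    (h' : RunsIn d s' T' s'') : RunsIn (Cmd.seq c d) s (T + T') s'' :=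
  let ⟨t, ht, hr⟩ := h
  let ⟨t', ht', hr'⟩ := h'
  ⟨t + t', add_le_add ht ht', hr.seq hr'⟩

theorem skip (s : Store) : RunsIn Cmd.skip s 1 s := ⟨1, le_rfl, .skip s⟩

theorem push {s s' : Store} {r : ℕ} {b : Bool} (h : Function.update s r (b :: s r) = s') :
    RunsIn (Cmd.push r b) s 1 s' := h ▸ ⟨1, le_rfl, .push s r b⟩

theorem pop {s s' : Store} {r : ℕ} (h : Function.update s r (s r).tail = s') :
    RunsIn (Cmd.pop r) s 1 s' := h ▸ ⟨1, le_rfl, .pop s r⟩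

theorem branchEmpty {r : ℕ} {c₀ c₁ c₂ : Cmd} {s s' : Store} {T : ℕ} (h : s r = [])
    (hc : RunsIn c₀ s T s') : RunsIn (Cmd.branch r c₀ c₁ c₂) s (T + 1) s' :=
  let ⟨t, ht, hr⟩ := hc
  ⟨t + 1, by omega, .branchEmpty h hr⟩

theorem branchCons {r : ℕ} {c₀ c₁ c₂ : Cmd} {s s' : Store} {T : ℕ} {b : Bool} {l : Bits}
    (h : s r = b :: l) (hc : RunsIn (if b then c₂ else c₁) s T s') :
    RunsIn (Cmd.branch r c₀ c₁ c₂) s (T + 1) s' := by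
  obtain ⟨t, ht, hr⟩ := hc
  cases b
  · exact ⟨t + 1, by omega, .branchFalse (by simp [h]) (by simpa using hr)⟩
  · exact ⟨t + 1, by omega, .branchTrue (by simp [h]) (by simpa using hr)⟩

theorem loopDone {r : ℕ} {c : Cmd} {s : Store} (h : s r = []) : RunsIn (Cmd.loop r c) s 1 s :=
  ⟨1, le_rfl, .loopDone h⟩

theorem loopStep {r : ℕ} {c : Cmd} {s s' s'' : Store} {T T' : ℕ} (h : s r ≠ [])
    (hc : RunsIn c s T s') (hl : RunsIn (Cmd.loop r c) s' T' s'') :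
    RunsIn (Cmd.loop r c) s (T + T' + 1) s'' :=
  let ⟨t, ht, hr⟩ := hc
  let ⟨t', ht', hr'⟩ := hl
  ⟨t + t' + 1, by omega, .loopStep h hr hr'⟩

/-- A loop which takes one bit off stack `r` in each round. -/
theorem loopBits {r : ℕ} {c : Cmd} {T : ℕ} (st : Bits → Bits → Store)
    (hst : ∀ l d, st l d r = l)
    (hc : ∀ b l d, RunsIn c (st (b :: l) d) T (st l (b :: d))) (l d : Bits) :
    RunsIn (Cmd.loop r c) (st l d) (l.length * (T + 1) + 1) (st [] (l.reverse ++ d)) := by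
  induction l generalizing d with
  | nil => exact (loopDone (hst _ _)).mono (by simp)
  | cons b l ih =>
    refine (loopStep (by simp [hst]) (hc b l d) (ih (b :: d))).mono ?_ |> fun h => by
      simpa using h
    rw [add_one_mul l.length]
    omega

end RunsIn

/-- Each step pushes at most one bit. This turns time bounds into size bounds. -/
theorem Runs.length_le {c : Cmd} {s s' : Store} {t : ℕ} (h : Runs c s t s') (r : ℕ) :
    (s' r).length ≤ (s r).length + t := by
  induction h with
  | skip s => omega
  | push s i b => by_cases h : r = i <;> simp [h]
  | pop s i =>
    by_cases h : r = i
    · subst h; simp; omega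
    · simp [h]
  | seq _ _ h1 h2 => omega
  | branchEmpty _ _ h => omega
  | branchFalse _ _ h => omega
  | branchTrue _ _ h => omega
  | loopDone _ => omega
  | loopStep _ _ _ h1 h2 => omega

/-- The program with each stack `r` replaced by the stack `φ r`. -/
def Cmd.rename (φ : ℕ → ℕ) : Cmd → Cmd
  | skip => skip
  | push r b => push (φ r) b
  | pop r => pop (φ r)
  | seq c d => seq (c.rename φ) (d.rename φ)
  | branch r c₀ c₁ c₂ => branch (φ r) (c₀.rename φ) (c₁.rename φ) (c₂.rename φ)
  | loop r c => loop (φ r) (c.rename φ)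

/-- The range of an injective renaming carries a faithful copy of the store. This allows a program
to run as a subroutine next to other data. -/
theorem Runs.rename {φ : ℕ → ℕ} (hφ : Function.Injective φ) {c : Cmd} {s s' : Store} {t : ℕ}
    (h : Runs c s t s') : ∀ σ : Store, (∀ r, σ (φ r) = s r) →
      ∃ σ' : Store, Runs (c.rename φ) σ t σ' ∧ (∀ r, σ' (φ r) = s' r) ∧
        ∀ r, r ∉ Set.range φ → σ' r = σ r := by
  induction h with
  | skip s => exact fun σ hσ => ⟨σ, .skip _, hσ, fun _ _ => rfl⟩
  | push s i b =>
    refine fun σ hσ => ⟨_, .push _ _ _, fun r => ?_, fun r hr => ?_⟩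
    · by_cases h : r = i
      · subst h; simp [hσ]
      · simp [h, hφ.eq_iff, hσ]
    · rw [Function.update_of_ne]; rintro rfl; exact hr ⟨_, rfl⟩
  | pop s i =>
    refine fun σ hσ => ⟨_, .pop _ _, fun r => ?_, fun r hr => ?_⟩
    · by_cases h : r = i
      · subst h; simp [hσ]
      · simp [h, hφ.eq_iff, hσ]
    · rw [Function.update_of_ne]; rintro rfl; exact hr ⟨_, rfl⟩
  | seq _ _ h1 h2 =>
    intro σ hσ
    obtain ⟨σ₁, r1, e1, f1⟩ := h1 σ hσ
    obtain ⟨σ₂, r2, e2, f2⟩ := h2 σ₁ e1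
    exact ⟨σ₂, r1.seq r2, e2, fun r hr => (f2 r hr).trans (f1 r hr)⟩
  | branchEmpty hr _ h =>
    intro σ hσ
    obtain ⟨σ₁, r1, e1, f1⟩ := h σ hσ
    exact ⟨σ₁, .branchEmpty (by rw [hσ, hr]) r1, e1, f1⟩
  | branchFalse hr _ h =>
    intro σ hσ
    obtain ⟨σ₁, r1, e1, f1⟩ := h σ hσ
    exact ⟨σ₁, .branchFalse (by rw [hσ, hr]) r1, e1, f1⟩
  | branchTrue hr _ h =>
    intro σ hσ
    obtain ⟨σ₁, r1, e1, f1⟩ := h σ hσ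
    exact ⟨σ₁, .branchTrue (by rw [hσ, hr]) r1, e1, f1⟩
  | loopDone hr => exact fun σ hσ => ⟨σ, .loopDone (by rw [hσ, hr]), hσ, fun _ _ => rfl⟩
  | loopStep hr _ _ h1 h2 =>
    intro σ hσ
    obtain ⟨σ₁, r1, e1, f1⟩ := h1 σ hσ
    obtain ⟨σ₂, r2, e2, f2⟩ := h2 σ₁ e1
    exact ⟨σ₂, .loopStep (by rwa [hσ]) r1 r2, e2, fun r hr => (f2 r hr).trans (f1 r hr)⟩

/-- The stacks from `c.width` on do not occur in `c`. -/
def Cmd.width : Cmd → ℕ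
  | skip => 0
  | push r _ => r + 1
  | pop r => r + 1
  | seq c d => max c.width d.width
  | branch r c₀ c₁ c₂ => max (r + 1) (max c₀.width (max c₁.width c₂.width))
  | loop r c => max (r + 1) c.width

theorem Runs.eq_of_width_le {c : Cmd} {s s' : Store} {t : ℕ} (h : Runs c s t s') (r : ℕ)
    (hr : c.width ≤ r) : s' r = s r := by
  induction h with
  | skip s => rfl
  | push s i b => simp only [Cmd.width] at hr; rw [Function.update_of_ne (by omega)]
  | pop s i => simp only [Cmd.width] at hr; rw [Function.update_of_ne (by omega)]
  | seq _ _ h1 h2 => simp only [Cmd.width] at hr; rw [h2 (by omega), h1 (by omega)]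
  | branchEmpty _ _ h => simp only [Cmd.width] at hr; exact h (by omega)
  | branchFalse _ _ h => simp only [Cmd.width] at hr; exact h (by omega)
  | branchTrue _ _ h => simp only [Cmd.width] at hr; exact h (by omega)
  | loopDone _ => rfl
  | loopStep _ _ _ h1 h2 =>
    simp only [Cmd.width] at hr h2; rw [h2 (by omega), h1 (by omega)]

/-- Empty stack `r`. -/
def Cmd.clear (r : ℕ) : Cmd := loop r (pop r)

theorem RunsIn.clear (s : Store) (r : ℕ) :
    RunsIn (Cmd.clear r) s (2 * (s r).length + 1) (Function.update s r []) := by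
  have h := RunsIn.loopBits (r := r) (c := Cmd.pop r) (T := 1)
    (fun l _ => Function.update s r l) (by simp)
    (fun b l d => RunsIn.pop (by simp)) (s r) []
  simp only [Function.update_eq_self] at h
  exact h.mono (by omega)

/-- Empty the stacks `1, …, n`. -/
def Cmd.clearTo : ℕ → Cmd
  | 0 => skip
  | n + 1 => seq (clearTo n) (clear (n + 1))

theorem RunsIn.clearTo (s : Store) (B n : ℕ) (hB : ∀ r, (s r).length ≤ B) :
    RunsIn (Cmd.clearTo n) s (n * (2 * B + 1) + 1)
      (fun r => if 1 ≤ r ∧ r ≤ n then [] else s r) := by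
  induction n with
  | zero =>
    have e : (fun r => if 1 ≤ r ∧ r ≤ 0 then [] else s r) = s := by
      funext r; exact if_neg (by omega)
    rw [e]
    exact (RunsIn.skip s).mono (by simp)
  | succ n ih =>
    have h := ih.seq (RunsIn.clear _ (n + 1))
    have e : Function.update (fun r => if 1 ≤ r ∧ r ≤ n then [] else s r) (n + 1) [] =
        fun r => if 1 ≤ r ∧ r ≤ n + 1 then [] else s r := by
      funext r
      by_cases h : r = n + 1
      · subst h; simp
      · rw [Function.update_of_ne h]
        congr 1
        simp; omega
    rw [e] at h
    refine h.mono ?_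
    have : ¬ (1 ≤ n + 1 ∧ n + 1 ≤ n) := by omega
    simp only [this, if_false]
    have := hB (n + 1)
    ring_nf
    ring_nf at this
    omega

/-! ### Stores with finitely many stacks in use -/

/-- The store with the entries of `l` on the first stacks. -/
def regs (l : List Bits) : Store := fun r => l.getD r []

theorem regs_apply (l : List Bits) (r : ℕ) : regs l r = l.getD r [] := rfl

theorem update_regs (l : List Bits) (r : ℕ) (x : Bits) (h : r < l.length) :
    Function.update (regs l) r x = regs (l.set r x) := by
  funext i
  by_cases hi : i = r
  · subst hi; simp [regs, h]
  · simp [regs, hi, Ne.symm hi]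

theorem regs_pad (x : Bits) : regs [x] = regs [x, [], [], []] := by
  funext i
  match i with
  | 0 => rfl
  | 1 => rfl
  | 2 => rfl
  | 3 => rfl
  | i + 4 => rfl

/-- The program `c`, working on every fourth stack, from stack `i` on. -/
def Cmd.zone (i : ℕ) (c : Cmd) : Cmd := c.rename fun r => 4 * r + i

/-- The stacks congruent to i modulo 4 form a private store: only stack i of it is in use, so the
renamed program finds the clean start it expects. -/
theorem RunsIn.zone {c : Cmd} {l : List Bits} {T i : ℕ} {y : Bits} (hl : l.length = 4)
    (hi : i < 4) (h : RunsIn c (regs [l.getD i []]) T (regs [y])) :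
    RunsIn (c.zone i) (regs l) T (regs (l.set i y)) := by
  obtain ⟨t, ht, hr⟩ := h
  have hinj : Function.Injective fun r => 4 * r + i := fun a b h => by simpa using h
  obtain ⟨σ', r1, e1, f1⟩ := hr.rename hinj (regs l) (fun r => by
    cases r with
    | zero => simp [regs]
    | succ r =>
      simp only [regs]
      rw [List.getD_eq_default _ _ (by omega), List.getD_eq_default _ _ (by simp)])
  refine ⟨t, ht, ?_⟩
  have : σ' = regs (l.set i y) := by
    rw [← update_regs _ _ _ (by omega)]
    funext r
    by_cases hr : r ∈ Set.range fun r => 4 * r + i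
    · obtain ⟨j, rfl⟩ := hr
      rw [e1 j]
      cases j with
      | zero => simp [regs]
      | succ j =>
        rw [Function.update_of_ne (by simp)]
        simp only [regs]
        rw [List.getD_eq_default _ _ (by simp), List.getD_eq_default _ _ (by omega)]
    · rw [f1 r hr, Function.update_of_ne]
      rintro rfl
      exact hr ⟨0, by simp⟩
  exact this ▸ r1

namespace RunsIn

theorem pushRegs (l l' : List Bits) (r : ℕ) (b : Bool) (hr : r < l.length)
    (h : l.set r (b :: l.getD r []) = l') : RunsIn (Cmd.push r b) (regs l) 1 (regs l') :=
  push (by rw [update_regs _ _ _ hr, ← h, regs_apply])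

theorem popRegs (l l' : List Bits) (r : ℕ) (hr : r < l.length)
    (h : l.set r (l.getD r []).tail = l') : RunsIn (Cmd.pop r) (regs l) 1 (regs l') :=
  pop (by rw [update_regs _ _ _ hr, ← h, regs_apply])

theorem clearRegs (l l' : List Bits) (r : ℕ) (hr : r < l.length) (h : l.set r [] = l') :
    RunsIn (Cmd.clear r) (regs l) (2 * (l.getD r []).length + 1) (regs l') := by
  have := clear (regs l) r
  rwa [update_regs _ _ _ hr, h] at this

end RunsIn

/-- Take the bits off stack `r`, running `c b` for each bit `b`. -/
def Cmd.eat (r : ℕ) (c : Bool → Cmd) : Cmd :=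
  loop r (branch r skip (seq (pop r) (c false)) (seq (pop r) (c true)))

/-- In `st l d` the bits `l` are still to be read and `d` are those already read, the latest first;
hence the reversal at the end. -/
theorem RunsIn.eat {r : ℕ} {c : Bool → Cmd} {T : ℕ} (st : Bits → Bits → List Bits)
    (hlen : ∀ l d, r < (st l d).length) (hst : ∀ l d, (st l d).getD r [] = l)
    (hc : ∀ b l d, RunsIn (c b) (regs ((st (b :: l) d).set r l)) T (regs (st l (b :: d))))
    (l d : Bits) :
    RunsIn (Cmd.eat r c) (regs (st l d)) (l.length * (T + 3) + 1)
      (regs (st [] (l.reverse ++ d))) := by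
  refine (RunsIn.loopBits (T := T + 2) (fun l d => regs (st l d)) hst (fun b l d => ?_) l d)
  refine (RunsIn.branchCons (T := 1 + T) (b := b) (l := l) (hst _ _) ?_).mono (by omega)
  have h1 : RunsIn (Cmd.pop r) (regs (st (b :: l) d)) 1 (regs ((st (b :: l) d).set r l)) :=
    .popRegs _ _ _ (hlen _ _) (by rw [hst]; rfl)
  cases b
  · simpa using h1.seq (hc false l d)
  · simpa using h1.seq (hc true l d)

/-- Push the bits of `l`, the head of `l` last. -/
def Cmd.pushList (r : ℕ) : Bits → Cmd
  | [] => skip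
  | b :: l => seq (pushList r l) (push r b)

theorem RunsIn.pushList (l : List Bits) (r : ℕ) (x : Bits) (hr : r < l.length) :
    RunsIn (Cmd.pushList r x) (regs l) (x.length + 1) (regs (l.set r (x ++ l.getD r []))) := by
  induction x with
  | nil =>
    have e : l.set r ([] ++ l.getD r []) = l := by
      apply List.ext_getElem <;> simp +contextual [hr]
    rw [e]
    exact RunsIn.skip _
  | cons b x ih =>
    refine (ih.seq (.pushRegs _ _ r b (by simpa using hr) ?_)).mono (by simp)
    simp [hr]

/-! ## Functions computable in polynomial time -/

/-- An encoding by bit strings. -/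
class Enc (α : Type) where
  enc : α → Bits

/-- Self-delimiting form of the bits of `x`. -/
def dbl (x : Bits) : Bits := x.flatMap fun b => [true, b]

@[simp] theorem dbl_nil : dbl [] = [] := rfl

@[simp] theorem dbl_cons (b : Bool) (x : Bits) : dbl (b :: x) = true :: b :: dbl x := rfl

@[simp] theorem length_dbl (x : Bits) : (dbl x).length = 2 * x.length := by
  induction x with
  | nil => rfl
  | cons b x ih => simp [ih]; ring

/-- A string of bits which is encoded by itself. -/
structure Raw where
  bits : Bits

instance : Enc Bool := ⟨fun b => [b]⟩
instance : Enc ℕ := ⟨unary⟩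
instance : Enc Raw := ⟨Raw.bits⟩
instance {α β : Type} [Enc α] [Enc β] : Enc (α × β) :=
  ⟨fun p => dbl (Enc.enc p.1) ++ false :: Enc.enc p.2⟩
instance {α : Type} [Enc α] : Enc (List α) :=
  ⟨fun l => l.flatMap fun a => dbl (Enc.enc a) ++ [false]⟩

/-- The length of the encoding. -/
def sz {α : Type} [Enc α] (a : α) : ℕ := (Enc.enc a).length

/-! ### Sizes of encodings -/

section Size

variable {α β : Type} [Enc α] [Enc β]

theorem enc_pair (a : α) (b : β) :
    Enc.enc (a, b) = dbl (Enc.enc a) ++ false :: Enc.enc b := rfl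

@[simp] theorem sz_bool (b : Bool) : sz b = 1 := rfl

@[simp] theorem sz_nat (n : ℕ) : sz n = n := List.length_replicate ..

theorem sz_raw (x : Raw) : sz x = x.bits.length := rfl

@[simp] theorem sz_pair (a : α) (b : β) : sz (a, b) = 2 * sz a + 1 + sz b := by
  simp [sz, enc_pair]; ring

theorem sz_pair' (p : α × β) : sz p = 2 * sz p.1 + 1 + sz p.2 := sz_pair p.1 p.2

theorem enc_nil : Enc.enc ([] : List α) = [] := rfl

/-- Thanks to this coincidence `cons` needs no program, and head and tail are the projections of a
pair. -/
theorem enc_cons (a : α) (l : List α) : Enc.enc (a :: l) = Enc.enc (a, l) := by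
  simp [Enc.enc]

@[simp] theorem sz_nil : sz ([] : List α) = 0 := rfl

@[simp] theorem sz_cons (a : α) (l : List α) : sz (a :: l) = 2 * sz a + 1 + sz l := by
  rw [← sz_pair]; simp [sz, enc_cons]

@[simp] theorem sz_append (l l' : List α) : sz (l ++ l') = sz l + sz l' := by
  induction l with
  | nil => simp
  | cons a l ih => simp [ih]; ring

@[simp] theorem sz_reverse (l : List α) : sz l.reverse = sz l := by
  induction l with
  | nil => rfl
  | cons a l ih => simp [ih]; ring

theorem length_le_sz (l : List α) : l.length ≤ sz l := by
  induction l with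
  | nil => simp
  | cons a l ih => simp; omega

theorem sz_le_of_mem {l : List α} {a : α} (h : a ∈ l) : sz a ≤ sz l := by
  induction l with
  | nil => simp at h
  | cons b l ih =>
    rcases List.mem_cons.1 h with rfl | h
    · simp; omega
    · have := ih h; simp; omega

theorem sz_le_of_sublist {l l' : List α} (h : l.Sublist l') : sz l ≤ sz l' := by
  induction h with
  | slnil => simp
  | cons a _ ih => simp; omega
  | cons_cons a _ ih => simp; omega

end Size

/-- Bounded by a polynomial in the length of the encoding. -/
def PolyB {γ : Type} [Enc γ] (b : γ → ℕ) : Prop :=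
  ∃ P : Polynomial ℕ, ∀ x, b x ≤ P.eval (sz x)

theorem Polynomial.eval_mono_nat (P : Polynomial ℕ) {a b : ℕ} (h : a ≤ b) :
    P.eval a ≤ P.eval b := by
  rw [Polynomial.eval_eq_sum, Polynomial.eval_eq_sum]
  exact Finset.sum_le_sum fun i _ => Nat.mul_le_mul_left _ (Nat.pow_le_pow_left h i)

namespace PolyB

variable {γ δ : Type} [Enc γ] [Enc δ]

theorem mono {b b' : γ → ℕ} (h : PolyB b') (hb : ∀ x, b x ≤ b' x) : PolyB b :=
  let ⟨P, hP⟩ := h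
  ⟨P, fun x => (hb x).trans (hP x)⟩

theorem const (c : ℕ) : PolyB fun _ : γ => c := ⟨Polynomial.C c, fun x => by simp⟩

theorem size : PolyB fun x : γ => sz x := ⟨Polynomial.X, fun x => by simp⟩

theorem add {b b' : γ → ℕ} (h : PolyB b) (h' : PolyB b') : PolyB fun x => b x + b' x :=
  let ⟨P, hP⟩ := h
  let ⟨P', hP'⟩ := h'
  ⟨P + P', fun x => by simpa using add_le_add (hP x) (hP' x)⟩

theorem mul {b b' : γ → ℕ} (h : PolyB b) (h' : PolyB b') : PolyB fun x => b x * b' x :=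
  let ⟨P, hP⟩ := h
  let ⟨P', hP'⟩ := h'
  ⟨P * P', fun x => by simpa using Nat.mul_le_mul (hP x) (hP' x)⟩

theorem pow {b : γ → ℕ} (h : PolyB b) (n : ℕ) : PolyB fun x => b x ^ n :=
  let ⟨P, hP⟩ := h
  ⟨P ^ n, fun x => by simpa using Nat.pow_le_pow_left (hP x) n⟩

theorem comp {b : δ → ℕ} (h : PolyB b) {f : γ → δ} (hf : PolyB fun x => sz (f x)) :
    PolyB fun x => b (f x) :=
  let ⟨P, hP⟩ := h
  let ⟨Q, hQ⟩ := hf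
  ⟨P.comp Q, fun x => by
    rw [Polynomial.eval_comp]
    exact (hP _).trans (P.eval_mono_nat (hQ x))⟩

end PolyB

/-- `f` is computable in polynomial time, by a program which cleans up after itself. -/
def PT {α β : Type} [Enc α] [Enc β] (f : α → β) : Prop :=
  ∃ (c : Cmd) (T : α → ℕ), PolyB T ∧
    ∀ a, RunsIn c (regs [Enc.enc a]) (T a) (regs [Enc.enc (f a)])

/-! ### Copying, packing and unpacking stacks -/

namespace RunsIn

theorem dup' (x w : Bits) :
    RunsIn (.seq (.eat 0 (.push 3)) (.eat 3 fun b => .seq (.push 0 b) (.push 1 b)))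
      (regs [x, [], w, []]) (9 * x.length + 2) (regs [x, x, w, []]) := by
  have h1 := RunsIn.eat (r := 0) (c := Cmd.push 3) (T := 1) (fun l d => [l, [], w, d])
    (by simp) (by simp) (fun b l d => .pushRegs _ _ _ _ (by simp) (by simp)) x []
  have h2 := RunsIn.eat (r := 3) (c := fun b => .seq (.push 0 b) (.push 1 b)) (T := 2)
    (fun l d => [d, d, w, l])
    (by simp) (by simp) (fun b l d =>
      (RunsIn.pushRegs _ [b :: d, d, w, l] _ _ (by simp) (by simp)).seq
        (.pushRegs _ _ _ _ (by simp) (by simp))) x.reverse []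
  simp only [List.append_nil, List.reverse_reverse, List.length_reverse] at h1 h2
  exact (h1.seq h2).mono (by omega)

theorem dup (x : Bits) :
    RunsIn (.seq (.eat 0 (.push 3)) (.eat 3 fun b => .seq (.push 0 b) (.push 1 b)))
      (regs [x]) (9 * x.length + 2) (regs [x, x, [], []]) := by
  rw [regs_pad]; exact dup' x []

end RunsIn

/-- Move the contents of stack `i` in self-delimiting form onto stack `j`. -/
def Cmd.pack (i j t : ℕ) : Cmd :=
  .seq (.push j false) (.seq (.eat i (.push t)) (.eat t fun b => .seq (.push j b) (.push j true)))

namespace RunsIn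

theorem pack10 (z y : Bits) :
    RunsIn (.pack 1 0 3) (regs [z, y, [], []]) (9 * y.length + 3)
      (regs [dbl y ++ false :: z, [], [], []]) := by
  have h0 : RunsIn (.push 0 false) (regs [z, y, [], []]) 1 (regs [false :: z, y, [], []]) :=
    .pushRegs _ _ _ _ (by simp) (by simp)
  have h1 := RunsIn.eat (r := 1) (c := Cmd.push 3) (T := 1) (fun l d => [false :: z, l, [], d])
    (by simp) (by simp) (fun b l d => .pushRegs _ _ _ _ (by simp) (by simp)) y []
  have h2 := RunsIn.eat (r := 3) (c := fun b => .seq (.push 0 b) (.push 0 true)) (T := 2)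
    (fun l d => [dbl d ++ false :: z, [], [], l])
    (by simp) (by simp) (fun b l d =>
      (RunsIn.pushRegs _ [b :: (dbl d ++ false :: z), [], [], l] _ _ (by simp) (by simp)).seq
        (.pushRegs _ _ _ _ (by simp) (by simp))) y.reverse []
  simp only [List.append_nil, List.reverse_reverse, List.length_reverse] at h1 h2
  exact (h0.seq (h1.seq h2)).mono (by omega)

end RunsIn

/-- Split off the first, self-delimiting part of stack `0` and put it, reversed, on stack `1`. -/
def Cmd.unpack : Cmd :=
  .seq (.push 2 true) (.loop 2 (.branch 0 (.pop 2) (.seq (.pop 0) (.pop 2))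
    (.seq (.pop 0) (.branch 0 .skip (.seq (.pop 0) (.push 1 false))
      (.seq (.pop 0) (.push 1 true))))))

namespace RunsIn

theorem unpack (y z : Bits) :
    RunsIn .unpack (regs [dbl y ++ false :: z]) (6 * y.length + 6)
      (regs [z, y.reverse, [], []]) := by
  rw [regs_pad]
  refine (RunsIn.seq (T' := 6 * y.length + 5) (s' := regs [dbl y ++ false :: z, [], [true], []])
    (.pushRegs _ _ _ _ (by simp) (by simp)) ?_).mono (by omega)
  suffices ∀ d : Bits, RunsIn _ (regs [dbl y ++ false :: z, d, [true], []]) (6 * y.length + 5)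
      (regs [z, y.reverse ++ d, [], []]) by simpa using this []
  induction y with
  | nil =>
    intro d
    refine (RunsIn.loopStep (T := 3) (T' := 1) (s' := regs [z, d, [], []]) (by simp [regs])
      (.branchCons (b := false) (l := z) (by simp [regs])
        (.seq (T := 1) (T' := 1) (s' := regs [z, d, [true], []]) (.popRegs _ _ _ (by simp) (by simp))
          (.popRegs _ _ _ (by simp) (by simp))))
      (.loopDone (by simp [regs]))).mono (by simp)
  | cons b y ih =>
    intro d
    have h := ih (b :: d)
    have e : (b :: y).reverse ++ d = y.reverse ++ b :: d := by simp
    rw [e]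
    refine (RunsIn.loopStep (T := 5) (s' := regs [dbl y ++ false :: z, b :: d, [true], []])
      (by simp [regs])
      (.branchCons (b := true) (l := b :: (dbl y ++ false :: z)) (T := 4) (by simp [regs])
        (.seq (T := 1) (T' := 3) (s' := regs [b :: (dbl y ++ false :: z), d, [true], []])
          (.popRegs _ _ _ (by simp) (by simp))
          (.branchCons (T := 2) (b := b) (l := dbl y ++ false :: z) (by simp [regs]) ?_)))
      h).mono (by simp; omega)
    cases b
    · exact .seq (T := 1) (T' := 1) (s' := regs [dbl y ++ false :: z, d, [true], []])
        (.popRegs _ _ _ (by simp) (by simp)) (.pushRegs _ _ _ _ (by simp) (by simp))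
    · exact .seq (T := 1) (T' := 1) (s' := regs [dbl y ++ false :: z, d, [true], []])
        (.popRegs _ _ _ (by simp) (by simp)) (.pushRegs _ _ _ _ (by simp) (by simp))

end RunsIn

/-- Replace the pair on stack `0` by its first component. -/
def Cmd.first : Cmd := .seq .unpack (.seq (.clear 0) (.eat 1 (.push 0)))

/-- Replace the pair on stack `0` by its second component. -/
def Cmd.second : Cmd := .seq .unpack (.clear 1)

namespace RunsIn

theorem first (y z : Bits) :
    RunsIn .first (regs [dbl y ++ false :: z]) (10 * y.length + 2 * z.length + 8) (regs [y]) := by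
  have h1 := RunsIn.eat (r := 1) (c := Cmd.push 0) (T := 1) (fun l d => [d, l, [], []])
    (by simp) (by simp) (fun b l d => .pushRegs _ _ _ _ (by simp) (by simp)) y.reverse []
  simp only [List.append_nil, List.reverse_reverse, List.length_reverse] at h1
  rw [regs_pad y]
  refine (((unpack y z).seq ((clearRegs _ [[], y.reverse, [], []] _ (by simp) (by simp)).seq h1)).mono ?_)
  simp; omega

theorem second (y z : Bits) :
    RunsIn .second (regs [dbl y ++ false :: z]) (8 * y.length + 7) (regs [z]) := by
  rw [regs_pad z]
  refine (((unpack y z).seq (clearRegs _ _ _ (by simp) (by simp))).mono ?_)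
  simp; omega

end RunsIn

/-! ### Closure properties of polynomial time functions, and basic functions -/

namespace PT

variable {α β γ δ κ σ : Type} [Enc α] [Enc β] [Enc γ] [Enc δ] [Enc κ] [Enc σ]

/-- The output cannot be longer than the input plus the running time. Composition needs this to
bound the time of the outer program. -/
theorem size {f : α → β} (hf : PT f) : PolyB fun a => sz (f a) := by
  obtain ⟨c, T, hT, h⟩ := hf
  refine (PolyB.size.add hT).mono fun a => ?_
  obtain ⟨t, ht, hr⟩ := h a
  have := hr.length_le 0
  simp only [regs, List.getD_cons_zero] at this
  simp only [sz]; omega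

theorem of_enc_eq {f : α → β} (h : ∀ a, Enc.enc (f a) = Enc.enc a) : PT f :=
  ⟨.skip, fun _ => 1, .const 1, fun a => by rw [h]; exact .skip _⟩

protected theorem id : PT fun a : α => a := of_enc_eq fun _ => rfl

theorem comp {g : β → γ} {f : α → β} (hg : PT g) (hf : PT f) : PT fun a => g (f a) := by
  have hs := hf.size
  obtain ⟨c, T, hT, h⟩ := hf
  obtain ⟨d, T', hT', h'⟩ := hg
  exact ⟨.seq c d, fun a => T a + T' (f a), hT.add (hT'.comp hs), fun a => (h a).seq (h' (f a))⟩

theorem const (b : β) : PT fun _ : α => b := by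
  refine ⟨.seq (.clear 0) (.pushList 0 (Enc.enc b)), fun a => 2 * sz a + 1 + (sz b + 1),
    (((PolyB.const 2).mul .size).add (.const _)).add (.const _), fun a => ?_⟩
  have h := (RunsIn.clearRegs [Enc.enc a] [[]] 0 (by simp) (by simp)).seq
    (RunsIn.pushList [[]] 0 (Enc.enc b) (by simp))
  simpa [sz] using h

/-- The input is copied, the two programs run in zones 1 and 0, and the first result is packed in
front of the second. -/
theorem pair {f : α → β} {g : α → γ} (hf : PT f) (hg : PT g) : PT fun a => (f a, g a) := by
  have hs := hf.size
  obtain ⟨c, T, hT, h⟩ := hf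
  obtain ⟨d, T', hT', h'⟩ := hg
  refine ⟨.seq (.seq (.eat 0 (.push 3)) (.eat 3 fun b => .seq (.push 0 b) (.push 1 b)))
      (.seq (c.zone 1) (.seq (d.zone 0) (.pack 1 0 3))),
    fun a => 9 * sz a + 2 + (T a + (T' a + (9 * sz (f a) + 3))),
    ((((PolyB.const 9).mul .size).add (.const _)).add (hT.add (hT'.add
      (((PolyB.const 9).mul hs).add (.const _))))), fun a => ?_⟩
  rw [regs_pad (Enc.enc (f a, g a)), enc_pair]
  refine (RunsIn.dup _).seq (.seq (s' := regs [Enc.enc a, Enc.enc (f a), [], []]) ?_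
    (.seq (s' := regs [Enc.enc (g a), Enc.enc (f a), [], []]) ?_ (RunsIn.pack10 _ _)))
  · exact .zone (i := 1) (by simp) (by simp) (h a)
  · exact .zone (i := 0) (by simp) (by simp) (h' a)

protected theorem fst : PT (Prod.fst : α × β → α) := by
  refine ⟨.first, fun p => 10 * sz p + 2 * sz p + 8,
    ((((PolyB.const 10).mul .size).add ((PolyB.const 2).mul .size)).add (.const _)), fun p => ?_⟩
  refine (RunsIn.first (Enc.enc p.1) (Enc.enc p.2)).mono ?_
  have := sz_pair' p
  simp only [sz] at this ⊢
  omega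

protected theorem snd : PT (Prod.snd : α × β → β) := by
  refine ⟨.second, fun p => 8 * sz p + 7,
    (((PolyB.const 8).mul .size).add (.const _)), fun p => ?_⟩
  refine (RunsIn.second (Enc.enc p.1) (Enc.enc p.2)).mono ?_
  have := sz_pair' p
  simp only [sz] at this ⊢
  omega

theorem fst' {f : γ → α × β} (hf : PT f) : PT fun x => (f x).1 := PT.fst.comp hf

theorem snd' {f : γ → α × β} (hf : PT f) : PT fun x => (f x).2 := PT.snd.comp hf

theorem cond {b : α → Bool} {f g : α → β} (hb : PT b) (hf : PT f) (hg : PT g) :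
    PT fun a => if b a = true then f a else g a := by
  obtain ⟨c, T, hT, h⟩ := hf
  obtain ⟨d, T', hT', h'⟩ := hg
  obtain ⟨e, T'', hT'', h''⟩ := hb
  refine ⟨.seq (.seq (.eat 0 (.push 3)) (.eat 3 fun b => .seq (.push 0 b) (.push 1 b)))
      (.seq (e.zone 1) (.branch 1 .skip (.seq (.pop 1) d) (.seq (.pop 1) c))),
    fun a => 9 * sz a + 2 + (T'' a + (1 + (T a + T' a) + 1)),
    ((((PolyB.const 9).mul .size).add (.const _)).add (hT''.add (((PolyB.const 1).add
      (hT.add hT')).add (.const 1)))), fun a => ?_⟩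
  refine (RunsIn.dup _).seq (.seq (s' := regs [Enc.enc a, [b a], [], []]) ?_
    (.branchCons (b := b a) (l := []) (by simp [regs]) ?_))
  · exact .zone (i := 1) (by simp) (by simp) (h'' a)
  · have hp : RunsIn (.pop 1) (regs [Enc.enc a, [b a], [], []]) 1 (regs [Enc.enc a]) := by
      rw [regs_pad]
      exact .popRegs _ _ _ (by simp) (by simp)
    cases hba : b a
    · simpa [hba] using (hp.seq (h' a)).mono (by omega)
    · simpa [hba] using (hp.seq (h a)).mono (by omega)

theorem ite {p : α → Prop} [DecidablePred p] {f g : α → β} (hp : PT fun a => decide (p a))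
    (hf : PT f) (hg : PT g) : PT fun a => if p a then f a else g a := by
  simpa using cond hp hf hg

/-- Iteration, with a number of rounds which is the length of an encoding. -/
theorem iterate {step : σ → σ} {cnt : γ → κ} {init : γ → σ} {b : γ → ℕ} (hstep : PT step)
    (hcnt : PT cnt) (hinit : PT init) (hb : PolyB b)
    (hsz : ∀ x, ∀ i ≤ sz (cnt x), sz (step^[i] (init x)) ≤ b x) :
    PT fun x => step^[sz (cnt x)] (init x) := by
  have hpair := hcnt.pair hinit
  have hs := hcnt.size
  obtain ⟨c, T, hT, h⟩ := hstep
  obtain ⟨P, hP⟩ := hT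
  obtain ⟨d, T', hT', h'⟩ := hpair
  refine ⟨.seq d (.seq .unpack (.loop 1 (.seq (.pop 1) (c.zone 0)))),
    fun x => T' x + ((6 * sz (cnt x) + 6) + (sz (cnt x) * (1 + P.eval (b x) + 1) + 1)),
    hT'.add ((((PolyB.const 6).mul hs).add (.const _)).add
      ((hs.mul (((PolyB.const 1).add ?_).add (.const 1))).add (.const 1))), fun x => ?_⟩
  · obtain ⟨Q, hQ⟩ := hb
    exact ⟨P.comp Q, fun x => by
      rw [Polynomial.eval_comp]; exact P.eval_mono_nat (hQ x)⟩
  refine (h' x).seq (.seq (RunsIn.unpack _ _) ?_)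
  -- The encoding of the counter lies, reversed, on stack 1. Only its length matters: one bit is
  -- removed per round.
  suffices ∀ (l : Bits) (i : ℕ), i + l.length = sz (cnt x) →
      RunsIn (.loop 1 (.seq (.pop 1) (c.zone 0))) (regs [Enc.enc (step^[i] (init x)), l, [], []])
        (l.length * (1 + P.eval (b x) + 1) + 1)
        (regs [Enc.enc (step^[sz (cnt x)] (init x))]) by
    simpa [sz] using this (Enc.enc (cnt x)).reverse 0 (by simp [sz])
  intro l
  induction l with
  | nil =>
    intro i hi
    have : i = sz (cnt x) := by simpa using hi
    subst this
    rw [regs_pad]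
    exact (RunsIn.loopDone (by simp [regs])).mono (by simp)
  | cons a l ih =>
    intro i hi
    simp only [List.length_cons] at hi
    have h1 := ih (i + 1) (by omega)
    rw [Function.iterate_succ_apply'] at h1
    refine (RunsIn.loopStep (T := 1 + P.eval (b x))
      (s' := regs [Enc.enc (step (step^[i] (init x))), l, [], []]) (by simp [regs])
      (.seq (s' := regs [Enc.enc (step^[i] (init x)), l, [], []])
        (.popRegs _ _ _ (by simp) (by simp))
        (.zone (i := 0) (by simp) (by simp) ((h _).mono ?_))) h1).mono ?_
    · exact (hP _).trans (P.eval_mono_nat (hsz x i (by omega)))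
    · rw [List.length_cons, add_one_mul l.length]; omega

/-- Iteration in a context, a number of times given by a natural number. -/
theorem natIterate {step : γ → σ → σ} {n : γ → ℕ} {init : γ → σ} {b : γ → ℕ}
    (hstep : PT fun p : γ × σ => step p.1 p.2) (hn : PT n) (hinit : PT init) (hb : PolyB b)
    (hsz : ∀ x, ∀ i ≤ n x, sz ((step x)^[i] (init x)) ≤ b x) :
    PT fun x => (step x)^[n x] (init x) := by
  have key : ∀ x i, (fun p : γ × σ => (p.1, step p.1 p.2))^[i] (x, init x) =
      (x, (step x)^[i] (init x)) := by
    intro x i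
    induction i with
    | zero => rfl
    | succ i ih => rw [Function.iterate_succ_apply', ih, Function.iterate_succ_apply']
  have h := iterate (step := fun p : γ × σ => (p.1, step p.1 p.2)) (cnt := n)
    (init := fun x => (x, init x)) (b := fun x => 2 * sz x + 1 + b x) (PT.fst.pair hstep) hn
    (PT.id.pair hinit) ((((PolyB.const 2).mul .size).add (.const 1)).add hb) (fun x i hi => by
      rw [key, sz_pair]
      have := hsz x i (by simpa using hi)
      omega)
  have h2 := h.snd'
  simp only [key] at h2
  simpa using h2

theorem decide_enc_nil {p : α → Prop} [DecidablePred p] (h : ∀ a, p a ↔ Enc.enc a = []) :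
    PT fun a => decide (p a) := by
  refine ⟨.branch 0 (.push 0 true) (.seq (.clear 0) (.push 0 false))
    (.seq (.clear 0) (.push 0 false)), fun a => 2 * sz a + 1 + 1 + 1,
    ((((PolyB.const 2).mul .size).add (.const 1)).add (.const 1)).add (.const 1), fun a => ?_⟩
  by_cases ha : p a
  · have e := (h a).1 ha
    have ea : Enc.enc (decide (p a)) = [true] := by simp [ha, Enc.enc]
    rw [e, ea]
    have h1 : RunsIn (.push 0 true) (regs [[]]) 1 (regs [[true]]) :=
      .pushRegs _ _ _ _ (by simp) (by simp)
    exact (h1.branchEmpty (by simp [regs])).mono (by simp)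
  · have e : Enc.enc a ≠ [] := fun e => ha ((h a).2 e)
    obtain ⟨b, l, e⟩ := List.exists_cons_of_ne_nil e
    have h0 : RunsIn (.seq (.clear 0) (.push 0 false)) (regs [Enc.enc a])
        (2 * sz a + 1 + 1) (regs [[false]]) :=
      (RunsIn.clearRegs _ [[]] _ (by simp) (by simp)).seq
        (.pushRegs _ _ _ _ (by simp) (by simp))
    have ea : Enc.enc (decide (p a)) = [false] := by simp [ha, Enc.enc]
    rw [ea]
    refine RunsIn.branchCons (b := b) (l := l) (by simp [regs, e]) ?_
    cases b <;> exact h0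

theorem isNil : PT fun l : List α => decide (l = []) :=
  decide_enc_nil fun l => by
    cases l with
    | nil => simp [enc_nil]
    | cons a l => simp [enc_cons, enc_pair]

theorem isZero : PT fun n : ℕ => decide (n = 0) :=
  decide_enc_nil fun n => by simp [Enc.enc, unary]

theorem rawIsNil : PT fun x : Raw => decide (x.bits = []) := decide_enc_nil fun _ => Iff.rfl

theorem cons : PT fun p : α × List α => p.1 :: p.2 := of_enc_eq fun p => enc_cons p.1 p.2

theorem headD (d : α) : PT fun l : List α => l.headD d := by
  refine ⟨.branch 0 (.pushList 0 (Enc.enc d)) .first .first,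
    fun l => (sz d + 1 + (10 * sz l + 2 * sz l + 8)) + 1,
    (((PolyB.const _).add ((((PolyB.const 10).mul .size).add
      ((PolyB.const 2).mul .size)).add (.const _))).add (.const 1)), fun l => ?_⟩
  cases l with
  | nil =>
    have h1 := RunsIn.pushList [[]] 0 (Enc.enc d) (by simp)
    rw [enc_nil]
    simpa using (h1.branchEmpty (r := 0) (c₁ := .first) (c₂ := .first) (by simp [regs])).mono
      (T' := sz d + 1 + 8 + 1) (by simp [sz])
  | cons a l =>
    have h := (RunsIn.first (Enc.enc a) (Enc.enc l)).mono
      (T' := sz d + 1 + (10 * sz (a :: l) + 2 * sz (a :: l) + 8)) (by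
        rw [sz_cons]; simp only [sz]; omega)
    rw [enc_cons, enc_pair]
    obtain ⟨b, m, e⟩ : ∃ b m, dbl (Enc.enc a) ++ false :: Enc.enc l = b :: m :=
      List.exists_cons_of_ne_nil (by simp)
    refine RunsIn.branchCons (b := b) (l := m) (by simp [regs, e]) ?_
    cases b <;> exact h

theorem tail : PT fun l : List α => l.tail := by
  refine ⟨.branch 0 .skip .second .second, fun l => (8 * sz l + 7) + 1,
    (((PolyB.const 8).mul .size).add (.const _)).add (.const 1), fun l => ?_⟩
  cases l with
  | nil => exact (RunsIn.branchEmpty (by simp [regs, enc_nil]) (RunsIn.skip _)).mono (by simp)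
  | cons a l =>
    have h := (RunsIn.second (Enc.enc a) (Enc.enc l)).mono
      (T' := 8 * sz (a :: l) + 7) (by rw [sz_cons]; simp only [sz]; omega)
    rw [enc_cons, enc_pair]
    obtain ⟨b, m, e⟩ : ∃ b m, dbl (Enc.enc a) ++ false :: Enc.enc l = b :: m :=
      List.exists_cons_of_ne_nil (by simp)
    refine RunsIn.branchCons (b := b) (l := m) (by simp [regs, e]) ?_
    cases b <;> exact h

theorem succ : PT fun n : ℕ => n + 1 :=
  ⟨.push 0 true, fun _ => 1, .const 1, fun n => .pushRegs _ _ _ _ (by simp)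
    (by simp [Enc.enc, unary, List.replicate_succ])⟩

theorem pred : PT fun n : ℕ => n - 1 :=
  ⟨.pop 0, fun _ => 1, .const 1, fun n => .popRegs _ _ _ (by simp)
    (by simp [Enc.enc, unary])⟩

theorem rawTail : PT fun x : Raw => Raw.mk x.bits.tail :=
  ⟨.pop 0, fun _ => 1, .const 1, fun n => .popRegs _ _ _ (by simp) (by simp [Enc.enc])⟩

theorem rawHead : PT fun x : Raw => x.bits.headD false := by
  have h0 : ∀ (x : Raw) (b : Bool), RunsIn (.seq (.clear 0) (.push 0 b)) (regs [Enc.enc x])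
        (2 * sz x + 1 + 1) (regs [[b]]) := fun x b =>
      (RunsIn.clearRegs _ [[]] _ (by simp) (by simp)).seq
        (.pushRegs _ _ _ _ (by simp) (by simp))
  refine ⟨.branch 0 (.push 0 false) (.seq (.clear 0) (.push 0 false))
    (.seq (.clear 0) (.push 0 true)), fun a => 2 * sz a + 1 + 1 + 1,
    ((((PolyB.const 2).mul .size).add (.const 1)).add (.const 1)).add (.const 1), fun a => ?_⟩
  obtain ⟨l⟩ := a
  cases l with
  | nil =>
    exact (RunsIn.branchEmpty (by simp [regs, Enc.enc])
      (.pushRegs _ _ _ _ (by simp) (by simp [Enc.enc]))).mono (by simp)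
  | cons b l =>
    refine (RunsIn.branchCons (b := b) (l := l) (by simp [regs, Enc.enc]) ?_)
    cases b <;> exact h0 _ _

theorem rawCons : PT fun p : Bool × Raw => Raw.mk (p.1 :: p.2.bits) := by
  refine ⟨.seq (.pop 0) (.branch 0 .skip (.seq (.pop 0) (.seq (.pop 0) (.push 0 false)))
      (.seq (.pop 0) (.seq (.pop 0) (.push 0 true)))), fun _ => 5, .const 5, fun p => ?_⟩
  obtain ⟨b, l⟩ := p
  have e : Enc.enc (b, l) = true :: b :: false :: l.bits := by simp [Enc.enc, dbl]
  rw [e]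
  refine .seq (T := 1) (T' := 4) (s' := regs [b :: false :: l.bits])
    (.popRegs _ _ _ (by simp) (by simp))
    (.branchCons (T := 3) (b := b) (l := false :: l.bits) (by simp [regs]) ?_)
  cases b
  · exact .seq (T := 1) (T' := 2) (s' := regs [false :: l.bits]) (.popRegs _ _ _ (by simp) (by simp))
      (.seq (T := 1) (T' := 1) (s' := regs [l.bits]) (.popRegs _ _ _ (by simp) (by simp))
      (.pushRegs _ _ _ _ (by simp) (by simp [Enc.enc])))
  · exact .seq (T := 1) (T' := 2) (s' := regs [false :: l.bits]) (.popRegs _ _ _ (by simp) (by simp))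
      (.seq (T := 1) (T' := 1) (s' := regs [l.bits]) (.popRegs _ _ _ (by simp) (by simp))
      (.pushRegs _ _ _ _ (by simp) (by simp [Enc.enc])))

end PT

/-! ### Polynomial time functions on lists and numbers -/

namespace PT

attribute [fun_prop] PT
attribute [fun_prop] PT.id PT.const PT.comp PT.fst' PT.snd' PT.pair PT.cond

variable {α β γ δ κ σ : Type} [Enc α] [Enc β] [Enc γ] [Enc δ] [Enc κ] [Enc σ]

@[fun_prop]
theorem cons' {f : γ → α} {g : γ → List α} (hf : PT f) (hg : PT g) : PT fun x => f x :: g x :=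
  cons.comp (hf.pair hg)

@[fun_prop]
theorem tail' {f : γ → List α} (hf : PT f) : PT fun x => (f x).tail := tail.comp hf

@[fun_prop]
theorem headD' {f : γ → List α} (hf : PT f) (d : α) : PT fun x => (f x).headD d :=
  (headD d).comp hf

@[fun_prop]
theorem isNil' {f : γ → List α} (hf : PT f) : PT fun x => decide (f x = []) := isNil.comp hf

@[fun_prop]
theorem succ' {f : γ → ℕ} (hf : PT f) : PT fun x => f x + 1 := succ.comp hf

@[fun_prop]
theorem ite' {p : α → Prop} [DecidablePred p] {f g : α → β} (hp : PT fun a => decide (p a))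
    (hf : PT f) (hg : PT g) : PT fun a => if p a then f a else g a := ite hp hf hg

@[fun_prop]
theorem band {f g : γ → Bool} (hf : PT f) (hg : PT g) : PT fun x => f x && g x := by
  convert hf.cond hg (const false) using 2 with x; cases f x <;> simp

@[fun_prop]
theorem bnot {f : γ → Bool} (hf : PT f) : PT fun x => !f x := by
  convert hf.cond (const false) (const true) using 2 with x; cases f x <;> simp

@[fun_prop]
theorem bxor {f g : γ → Bool} (hf : PT f) (hg : PT g) : PT fun x => xor (f x) (g x) := by
  convert hf.cond hg.bnot hg using 2 with x; cases f x <;> simp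

@[fun_prop]
theorem decideAnd {p q : γ → Prop} [DecidablePred p] [DecidablePred q]
    (hp : PT fun x => decide (p x)) (hq : PT fun x => decide (q x)) :
    PT fun x => decide (p x ∧ q x) := by
  simpa using hp.band hq

/-! ### Folds -/

theorem foldl [Inhabited α] {step : γ → σ → α → σ} {l : γ → List α} {init : γ → σ} {b : γ → ℕ}
    (hstep : PT fun p : γ × (σ × α) => step p.1 p.2.1 p.2.2) (hl : PT l) (hinit : PT init)
    (hb : PolyB b) (hsz : ∀ x, ∀ l', l' <+: l x → sz (l'.foldl (step x) (init x)) ≤ b x) :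
    PT fun x => (l x).foldl (step x) (init x) := by
  -- The number of rounds will be the length of the encoding of the list, which can exceed the
  -- length of the list. So the step does nothing once the list is used up.
  let G : γ × (List α × σ) → γ × (List α × σ) := fun p =>
    if p.2.1 = [] then p else (p.1, p.2.1.tail, step p.1 p.2.2 (p.2.1.headD default))
  have key : ∀ x i, G^[i] (x, l x, init x) =
      (x, (l x).drop i, ((l x).take i).foldl (step x) (init x)) := by
    intro x i
    induction i with
    | zero => simp
    | succ i ih =>
      rw [Function.iterate_succ_apply', ih]
      by_cases h : i < (l x).length
      · have h' : (l x).drop i ≠ [] := by simpa using h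
        simp only [G, h', if_false]
        rw [List.take_succ_eq_append_getElem h, List.foldl_append, List.tail_drop]
        simp [List.headD_eq_head?_getD, List.getElem?_eq_getElem h]
      · have h' : (l x).drop i = [] := by simpa using h
        simp only [G, h', if_true]
        rw [List.take_of_length_le (by omega), List.take_of_length_le (by omega),
          List.drop_eq_nil_of_le (by omega)]
  have hG : PT G := by
    refine ite (by fun_prop) PT.id ?_
    exact PT.fst.pair ((by fun_prop : PT fun p : γ × (List α × σ) => p.2.1.tail).pair
      (hstep.comp (f := fun p : γ × (List α × σ) => (p.1, (p.2.2, p.2.1.headD default)))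
        (by fun_prop)))
  have h := iterate (step := G) (cnt := l) (init := fun x => (x, l x, init x))
    (b := fun x => 2 * sz x + 1 + (2 * sz (l x) + 1 + b x)) hG hl (by fun_prop)
    ((((PolyB.const 2).mul .size).add (.const 1)).add ((((PolyB.const 2).mul hl.size).add
      (.const 1)).add hb)) (fun x i _ => by
      rw [key]
      simp only [sz_pair]
      have h1 := hsz x _ (List.take_prefix i (l x))
      have h2 := sz_le_of_sublist (List.drop_sublist i (l x))
      omega)
  have h2 := h.snd'.snd'
  simp only [key] at h2
  refine (congrArg PT (funext fun x => ?_)).mp h2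
  rw [List.take_of_length_le (length_le_sz _)]

/-- Growth by an amount independent of the state adds up to a polynomial over the whole list; growth
by a factor would not. -/
theorem foldl_of_growth [Inhabited α] {step : γ → σ → α → σ} {l : γ → List α} {init : γ → σ}
    {g : γ → ℕ} (hstep : PT fun p : γ × (σ × α) => step p.1 p.2.1 p.2.2) (hl : PT l)
    (hinit : PT init) (hg : PolyB g)
    (hsz : ∀ x s, ∀ a ∈ l x, sz (step x s a) ≤ sz s + g x) :
    PT fun x => (l x).foldl (step x) (init x) := by
  refine foldl (b := fun x => sz (init x) + sz (l x) * g x) hstep hl hinit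
    (hinit.size.add (hl.size.mul hg)) fun x l' hl' => ?_
  have h1 : ∀ l' : List α, (∀ a ∈ l', a ∈ l x) → ∀ s,
      sz (l'.foldl (step x) s) ≤ sz s + l'.length * g x := by
    intro l'
    induction l' with
    | nil => simp
    | cons a l' ih =>
      intro hm s
      have h1 := ih (fun a ha => hm a (List.mem_cons_of_mem _ ha)) (step x s a)
      have h2 := hsz x s a (hm a List.mem_cons_self)
      rw [List.foldl_cons, List.length_cons, add_one_mul]
      omega
  refine (h1 l' (fun a ha => hl'.subset ha) _).trans ?_
  gcongr
  exact hl'.length_le.trans (length_le_sz _)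

@[fun_prop]
theorem drop {n : γ → ℕ} {f : γ → List α} (hn : PT n) (hf : PT f) :
    PT fun x => (f x).drop (n x) := by
  have e : ∀ (n : ℕ) (l : List α), List.tail^[n] l = l.drop n := by
    intro n
    induction n with
    | zero => simp
    | succ n ih => intro l; rw [Function.iterate_succ_apply', ih, List.tail_drop]
  have h := natIterate (step := fun (_ : γ) (l : List α) => l.tail) (by fun_prop) hn hf hf.size
    (fun x i _ => by
      rw [e]; exact sz_le_of_sublist (List.drop_sublist _ _))
  simpa only [e] using h

@[fun_prop]
theorem replicate {n : γ → ℕ} {f : γ → α} (hn : PT n) (hf : PT f) :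
    PT fun x => List.replicate (n x) (f x) := by
  have e : ∀ (n : ℕ) (a : α), (fun l => a :: l)^[n] [] = List.replicate n a := by
    intro n a
    induction n with
    | zero => simp
    | succ n ih => rw [Function.iterate_succ_apply', ih, List.replicate_succ]
  have e' : ∀ (n : ℕ) (a : α), sz (List.replicate n a) = n * (2 * sz a + 1) := by
    intro n a
    induction n with
    | zero => simp
    | succ n ih => rw [List.replicate_succ, sz_cons, ih]; ring
  have h := natIterate (step := fun (x : γ) (l : List α) => f x :: l) (by fun_prop) hn (const [])
    (hn.size.mul (((PolyB.const 2).mul hf.size).add (.const 1))) (fun x i hi => by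
      rw [e, e']; exact Nat.mul_le_mul_right _ (by simpa using hi))
  simpa only [e] using h

variable [Inhabited α] [Inhabited β]

@[fun_prop]
theorem reverse {f : γ → List α} (hf : PT f) : PT fun x => (f x).reverse := by
  have h := foldl_of_growth (step := fun (_ : γ) (s : List α) a => a :: s) (init := fun _ => [])
    (g := fun x => 2 * sz (f x) + 1) (by fun_prop) hf (by fun_prop)
    (((PolyB.const 2).mul hf.size).add (.const 1)) (fun x s a ha => by
      have := sz_le_of_mem ha
      simp; omega)
  simpa using h

@[fun_prop]
theorem append {f g : γ → List α} (hf : PT f) (hg : PT g) : PT fun x => f x ++ g x := by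
  have h := foldl_of_growth (step := fun (_ : γ) (s : List α) a => a :: s) (init := g)
    (g := fun x => 2 * sz (f x) + 1) (by fun_prop) hf.reverse hg
    (((PolyB.const 2).mul hf.size).add (.const 1)) (fun x s a ha => by
      have := sz_le_of_mem (List.mem_reverse.1 ha)
      simp; omega)
  simpa using h

@[fun_prop]
theorem map {f : γ → α → β} {l : γ → List α} (hf : PT fun p : γ × α => f p.1 p.2) (hl : PT l) :
    PT fun x => (l x).map (f x) := by
  obtain ⟨P, hP⟩ := hf.size
  have hg : PolyB fun x => 2 * P.eval (2 * sz x + 1 + sz (l x)) + 1 := by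
    obtain ⟨Q, hQ⟩ := ((((PolyB.const 2).mul .size).add (.const 1)).add hl.size :
      PolyB fun x => 2 * sz x + 1 + sz (l x))
    refine ((PolyB.const 2).mul ?_).add (.const 1)
    exact ⟨P.comp Q, fun x => by rw [Polynomial.eval_comp]; exact P.eval_mono_nat (hQ x)⟩
  have h := foldl_of_growth (step := fun (x : γ) (s : List β) a => f x a :: s)
    (init := fun _ => []) (by fun_prop) hl (by fun_prop) hg (fun x s a ha => by
      have h1 := sz_le_of_mem ha
      have h2 := hP (x, a)
      rw [sz_pair] at h2
      have h3 := P.eval_mono_nat (show 2 * sz x + 1 + sz a ≤ 2 * sz x + 1 + sz (l x) by omega)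
      simp only at h2
      simp only [sz_cons]; omega)
  simpa using h.reverse

@[fun_prop]
theorem flatten {f : γ → List (List α)} (hf : PT f) : PT fun x => (f x).flatten := by
  have h := foldl_of_growth (step := fun (_ : γ) (s : List α) a => s ++ a) (init := fun _ => [])
    (by fun_prop) hf (by fun_prop) hf.size (fun x s a ha => by
      have := sz_le_of_mem ha
      simp; omega)
  have e : ∀ (l : List (List α)) (s : List α), l.foldl (fun s a => s ++ a) s = s ++ l.flatten := by
    intro l
    induction l with
    | nil => simp
    | cons a l ih => intro s; simp [ih]
  simpa [e] using h

@[fun_prop]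
theorem length {f : γ → List α} (hf : PT f) : PT fun x => (f x).length := by
  have h := foldl_of_growth (step := fun (_ : γ) (s : ℕ) (_ : α) => s + 1) (init := fun _ => 0)
    (by fun_prop) hf (by fun_prop) (.const 1) (fun x s a ha => by simp)
  have e : ∀ (l : List α) (s : ℕ), l.foldl (fun s _ => s + 1) s = s + l.length := by
    intro l
    induction l with
    | nil => simp
    | cons a l ih => intro s; simp [ih]; omega
  simpa [e] using h

@[fun_prop]
theorem pred' {f : γ → ℕ} (hf : PT f) : PT fun x => f x - 1 := pred.comp hf

@[fun_prop]
theorem sub {f g : γ → ℕ} (hf : PT f) (hg : PT g) : PT fun x => f x - g x := by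
  have e : ∀ n m : ℕ, (fun a => a - 1)^[n] m = m - n := by
    intro n
    induction n with
    | zero => simp
    | succ n ih => intro m; rw [Function.iterate_succ_apply', ih]; omega
  have h := natIterate (step := fun (_ : γ) (a : ℕ) => a - 1) (by fun_prop) hg hf hf.size
    (fun x i _ => by rw [e]; simp)
  simpa only [e] using h

@[fun_prop]
theorem add {f g : γ → ℕ} (hf : PT f) (hg : PT g) : PT fun x => f x + g x := by
  have e : ∀ n m : ℕ, (fun a => a + 1)^[n] m = m + n := by
    intro n
    induction n with
    | zero => simp
    | succ n ih => intro m; rw [Function.iterate_succ_apply', ih]; omega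
  have h := natIterate (step := fun (_ : γ) (a : ℕ) => a + 1) (by fun_prop) hg hf
    (hf.size.add hg.size) (fun x i hi => by rw [e]; simpa using hi)
  simpa only [e] using h

@[fun_prop]
theorem mul {f g : γ → ℕ} (hf : PT f) (hg : PT g) : PT fun x => f x * g x := by
  have e : ∀ c n : ℕ, (fun a => a + c)^[n] 0 = c * n := by
    intro c n
    induction n with
    | zero => simp
    | succ n ih => rw [Function.iterate_succ_apply', ih]; ring
  have h := natIterate (step := fun (x : γ) (a : ℕ) => a + f x) (by fun_prop) hg (const 0)
    (hf.size.mul hg.size) (fun x i hi => by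
      rw [e]; simpa using Nat.mul_le_mul_left _ hi)
  simpa only [e] using h

@[fun_prop]
theorem decideLe {f g : γ → ℕ} (hf : PT f) (hg : PT g) : PT fun x => decide (f x ≤ g x) := by
  have h := isZero.comp (hf.sub hg)
  simpa only [Nat.sub_eq_zero_iff_le] using h

@[fun_prop]
theorem decideEqZero {f : γ → ℕ} (hf : PT f) : PT fun x => decide (f x = 0) := isZero.comp hf

@[fun_prop]
theorem min {f g : γ → ℕ} (hf : PT f) (hg : PT g) : PT fun x => Min.min (f x) (g x) := by
  simp only [Nat.min_def]
  fun_prop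

@[fun_prop]
theorem div {f g : γ → ℕ} (hf : PT f) (hg : PT g) : PT fun x => f x / g x := by
  have e : ∀ a d n : ℕ, 0 < d → (fun q => if (q + 1) * d ≤ a then q + 1 else q)^[n] 0 =
      Min.min n (a / d) := by
    intro a d n hd
    induction n with
    | zero => simp
    | succ n ih =>
      rw [Function.iterate_succ_apply', ih]
      simp only [← Nat.le_div_iff_mul_le hd]
      rcases le_total n (a / d) with h | h
      · rw [Nat.min_eq_left h]; split_ifs with h'
        · rw [Nat.min_eq_left h']
        · omega
      · rw [Nat.min_eq_right h, if_neg (by omega)]; omega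
  have e' : ∀ a d n : ℕ, (fun q => if (q + 1) * d ≤ a then q + 1 else q)^[n] 0 ≤ n := by
    intro a d n
    induction n with
    | zero => simp
    | succ n ih =>
      rw [Function.iterate_succ_apply']
      split_ifs <;> omega
  have h := natIterate (step := fun (x : γ) (q : ℕ) => if (q + 1) * g x ≤ f x then q + 1 else q)
    (by fun_prop) hf (const 0) hf.size (fun x i hi => by
      have := e' (f x) (g x) i
      simp only [sz_nat]; omega)
  -- For the divisor 0 the iteration would count up to `f x`, whereas the quotient is 0.
  have h2 : PT fun x => if g x = 0 then 0 else
      (fun q => if (q + 1) * g x ≤ f x then q + 1 else q)^[f x] 0 := by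
    fun_prop
  refine (congrArg PT (funext fun x => ?_)).mp h2
  by_cases hx : g x = 0
  · simp [hx]
  · rw [if_neg hx, e _ _ _ (Nat.pos_of_ne_zero hx), Nat.min_eq_right (Nat.div_le_self _ _)]

@[fun_prop]
theorem take {n : γ → ℕ} {f : γ → List α} (hn : PT n) (hf : PT f) :
    PT fun x => (f x).take (n x) := by
  have h : PT fun x => ((f x).reverse.drop ((f x).length - n x)).reverse := by fun_prop
  refine (congrArg PT (funext fun x => ?_)).mp h
  rw [List.drop_reverse, List.reverse_reverse, tsub_tsub_eq_min, min_comm,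
    ← List.take_eq_take_min]

@[fun_prop]
theorem zip {f : γ → List α} {g : γ → List β} (hf : PT f) (hg : PT g) :
    PT fun x => (f x).zip (g x) := by
  let step : List β × List (α × β) → α → List β × List (α × β) := fun s a =>
    if s.1 = [] then s else (s.1.tail, (a, s.1.headD default) :: s.2)
  have e : ∀ (l : List α) (s : List β × List (α × β)),
      l.foldl step s = (s.1.drop l.length, (l.zip s.1).reverse ++ s.2) := by
    intro l
    induction l with
    | nil => simp
    | cons a l ih =>
      rintro ⟨r, acc⟩
      rw [List.foldl_cons, ih]
      cases r <;> simp [step]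
  have hb : PolyB fun x => 2 * sz (g x) + 1 + (sz (f x) + sz (g x)) * 4 := 
    (((PolyB.const 2).mul hg.size).add (.const 1)).add ((hf.size.add hg.size).mul (.const 4))
  have hz : ∀ (l : List α) (r : List β), sz (l.zip r) ≤ (sz l + sz r) * 4 := by
    intro l
    induction l with
    | nil => simp
    | cons a l ih =>
      intro r
      cases r with
      | nil => simp
      | cons b r => have := ih r; simp; omega
  have h := foldl (step := fun (_ : γ) => step) (l := f) (init := fun x => (g x, []))
    (by simp only [step]; fun_prop) hf (by fun_prop) hb (fun x l' hl' => by
      rw [e]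
      have h1 := hz l' (g x)
      have h2 := sz_le_of_sublist hl'.sublist
      have h3 := sz_le_of_sublist (List.drop_sublist l'.length (g x))
      simp; omega)
  simp only [e] at h
  simpa using h.snd'.reverse

@[fun_prop]
theorem rawTail' {f : γ → Raw} (hf : PT f) : PT fun x => Raw.mk (f x).bits.tail := rawTail.comp hf

@[fun_prop]
theorem rawHead' {f : γ → Raw} (hf : PT f) : PT fun x => (f x).bits.headD false := rawHead.comp hf

@[fun_prop]
theorem rawCons' {f : γ → Bool} {g : γ → Raw} (hf : PT f) (hg : PT g) :
    PT fun x => Raw.mk (f x :: (g x).bits) := rawCons.comp (hf.pair hg)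

@[fun_prop]
theorem rawIsNil' {f : γ → Raw} (hf : PT f) : PT fun x => decide ((f x).bits = []) :=
  rawIsNil.comp hf

@[fun_prop]
theorem rawBits {f : γ → Raw} (hf : PT f) : PT fun x => (f x).bits := by
  suffices PT Raw.bits from this.comp hf
  let step : Raw × List Bool → Raw × List Bool := fun s =>
    if s.1.bits = [] then s else (Raw.mk s.1.bits.tail, s.1.bits.headD false :: s.2)
  have e : ∀ (l : List Bool) (n : ℕ) (acc : List Bool), step^[n] (Raw.mk l, acc) =
      (Raw.mk (l.drop n), (l.take n).reverse ++ acc) := by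
    intro l n
    induction n generalizing l with
    | zero => simp
    | succ n ih =>
      intro acc
      rw [Function.iterate_succ_apply]
      cases l with
      | nil =>
        have : step (Raw.mk [], acc) = (Raw.mk [], acc) := by simp [step]
        rw [this, ih]; simp
      | cons b l =>
        have : step (Raw.mk (b :: l), acc) = (Raw.mk l, b :: acc) := by simp [step]
        rw [this, ih]; simp
  have e' : ∀ l : List Bool, sz l = 3 * l.length := by
    intro l
    induction l with
    | nil => simp
    | cons b l ih => simp [ih]; ring
  have h := iterate (step := step) (cnt := fun x : Raw => x) (init := fun x => (x, []))
    (b := fun x => 5 * sz x + 1) (by simp only [step]; fun_prop) PT.id (by fun_prop)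
    (((PolyB.const 5).mul .size).add (.const 1)) (fun x i hi => by
      rw [e]
      simp [e', sz_raw]; omega)
  simp only [e] at h
  have h2 := h.snd'.reverse
  refine (congrArg PT (funext fun x => ?_)).mp h2
  simp [sz_raw]

@[fun_prop]
theorem rawMk {f : γ → List Bool} (hf : PT f) : PT fun x => Raw.mk (f x) := by
  have h := foldl_of_growth (step := fun (_ : γ) (s : Raw) b => Raw.mk (b :: s.bits))
    (init := fun _ => Raw.mk []) (by fun_prop) hf.reverse (by fun_prop) (.const 1)
    (fun x s a ha => by simp [sz_raw])
  have e : ∀ (l s : List Bool), l.foldl (fun (s : Raw) b => Raw.mk (b :: s.bits)) (Raw.mk s) =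
      Raw.mk (l.reverse ++ s) := by
    intro l
    induction l with
    | nil => simp
    | cons a l ih => intro s; simp [ih]
  simpa [e] using h

end PT

/-! ## From functions to programs and back -/

namespace RunsIn

theorem unary_reverse (n : ℕ) : (unary n).reverse = unary n := List.reverse_replicate ..

theorem outputsWithin {c : Cmd} {ins : List Bits} {T : ℕ} {s : Store} {out : Bits}
    (h : RunsIn c (regs ins) T s) (hs : s 0 = out) : c.OutputsWithin ins T out :=
  let ⟨t, ht, hr⟩ := h
  ⟨t, ht, s, hr, hs⟩

theorem packAt (l₁ l₂ : List Bits) (i : ℕ) (y z : Bits) (h₁ : l₁.length = i)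
    (h₂ : i + 1 + l₂.length = 3) :
    RunsIn (.pack i 3 4) (regs (l₁ ++ y :: l₂ ++ [z, []])) (9 * y.length + 3)
      (regs (l₁ ++ [] :: l₂ ++ [dbl y ++ false :: z, []])) := by
  have h0 : RunsIn (.push 3 false) (regs (l₁ ++ y :: l₂ ++ [z, []])) 1
      (regs (l₁ ++ y :: l₂ ++ [false :: z, []])) := by
    refine .pushRegs _ _ _ _ (by simp; omega) ?_
    rw [List.set_append_right _ _ (by simp; omega), List.getD_append_right _ _ _ _ (by simp; omega),
      show 3 - (l₁ ++ y :: l₂).length = 0 by simp; omega]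
    rfl
  have h1 := RunsIn.eat (r := i) (c := Cmd.push 4) (T := 1)
    (fun l d => l₁ ++ l :: l₂ ++ [false :: z, d])
    (fun l d => by simp; omega) (fun l d => by subst h₁; simp) (fun b l d => by
      refine .pushRegs _ _ _ _ (by simp; omega) ?_
      subst h₁
      rw [List.append_assoc, List.set_append_right _ _ le_rfl, Nat.sub_self]
      simp only [List.cons_append, List.set_cons_zero]
      rw [show l₁ ++ l :: (l₂ ++ [false :: z, d]) = (l₁ ++ l :: l₂ ++ [false :: z]) ++ [d] by simp,
        List.set_append_right _ _ (by simp; omega),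
        List.getD_append_right _ _ _ _ (by simp; omega),
        show 4 - (l₁ ++ l :: l₂ ++ [false :: z]).length = 0 by simp; omega]
      simp) y []
  have h2 := RunsIn.eat (r := 4) (c := fun b => .seq (.push 3 b) (.push 3 true)) (T := 2)
    (fun l d => l₁ ++ [] :: l₂ ++ [dbl d ++ false :: z, l])
    (fun l d => by simp; omega) (fun l d => by
      rw [List.getD_append_right _ _ _ _ (by simp; omega),
        show 4 - (l₁ ++ [] :: l₂).length = 1 by simp; omega]
      rfl) (fun b l d => by
      have hs : ∀ w w' x : Bits, (l₁ ++ [] :: l₂ ++ [w, x]).set 3 w' =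
          l₁ ++ [] :: l₂ ++ [w', x] := by
        intro w w' x
        rw [List.set_append_right _ _ (by simp; omega),
          show 3 - (l₁ ++ [] :: l₂).length = 0 by simp; omega]
        rfl
      have hg : ∀ w x : Bits, (l₁ ++ [] :: l₂ ++ [w, x]).getD 3 [] = w := by
        intro w x
        rw [List.getD_append_right _ _ _ _ (by simp; omega),
          show 3 - (l₁ ++ [] :: l₂).length = 0 by simp; omega]
        rfl
      have hs4 : ∀ w x x' : Bits, (l₁ ++ [] :: l₂ ++ [w, x]).set 4 x' =
          l₁ ++ [] :: l₂ ++ [w, x'] := by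
        intro w x x'
        rw [List.set_append_right _ _ (by simp; omega),
          show 4 - (l₁ ++ [] :: l₂).length = 1 by simp; omega]
        rfl
      rw [hs4]
      refine (RunsIn.pushRegs _ (l₁ ++ [] :: l₂ ++ [b :: (dbl d ++ false :: z), l]) _ _
        (by simp; omega) ?_).seq (.pushRegs _ _ _ _ (by simp; omega) ?_)
      · rw [hs, hg]
      · rw [hs, hg]; rfl) y.reverse []
  simp only [List.append_nil, List.reverse_reverse, List.length_reverse] at h1 h2
  exact (h0.seq (h1.seq h2)).mono (by omega)

end RunsIn

namespace PT

variable {α β γ δ : Type} [Enc α] [Enc β] [Enc γ] [Enc δ]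

theorem outputsWithin {f : α → β} (hf : PT f) : ∃ (c : Cmd) (P : Polynomial ℕ),
    ∀ a, c.OutputsWithin [Enc.enc a] (P.eval (sz a)) (Enc.enc (f a)) := by
  obtain ⟨c, T, ⟨P, hP⟩, h⟩ := hf
  exact ⟨c, P, fun a => ((h a).mono (hP a)).outputsWithin rfl⟩

/-- A program for a function of four arguments, which are given on four stacks. -/
theorem outputsWithin₄ {ε : Type} [Enc ε] {f : α × β × γ × δ → ε} (hf : PT f) :
    ∃ (c : Cmd) (P : Polynomial ℕ), ∀ a b x d,
      c.OutputsWithin [Enc.enc a, Enc.enc b, Enc.enc x, Enc.enc d]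
        (P.eval (sz a + sz b + sz x + sz d)) (Enc.enc (f (a, b, x, d))) := by
  obtain ⟨c, T, ⟨P, hP⟩, h⟩ := hf
  -- Packing stacks 2, 1, 0 in this order onto stack 3 builds the nested pair. It reaches stack 0 by
  -- two transfers, as each of them reverses it.
  refine ⟨.seq (.pack 2 3 4) (.seq (.pack 1 3 4) (.seq (.pack 0 3 4)
    (.seq (.eat 3 (.push 4)) (.seq (.eat 4 (.push 0)) c)))),
    (Polynomial.C 100 * Polynomial.X + Polynomial.C 100) +
      P.comp (Polynomial.C 2 * Polynomial.X + Polynomial.C 3), fun a b x d => ?_⟩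
  have e0 : regs [Enc.enc a, Enc.enc b, Enc.enc x, Enc.enc d] =
      regs [Enc.enc a, Enc.enc b, Enc.enc x, Enc.enc d, []] := by
    funext i
    match i with
    | 0 | 1 | 2 | 3 | 4 => rfl
    | i + 5 => rfl
  have e1 : ∀ x : Bits, regs [x] = regs [x, [], [], [], []] := by
    intro x
    funext i
    match i with
    | 0 | 1 | 2 | 3 | 4 => rfl
    | i + 5 => rfl
  have h2 := RunsIn.packAt [Enc.enc a, Enc.enc b] [] 2 (Enc.enc x) (Enc.enc d) rfl rfl
  have h1 := RunsIn.packAt [Enc.enc a] [[]] 1 (Enc.enc b) (Enc.enc (x, d)) rfl rfl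
  have h0 := RunsIn.packAt [] [[], []] 0 (Enc.enc a) (Enc.enc (b, x, d)) rfl rfl
  have h3 := RunsIn.eat (r := 3) (c := Cmd.push 4) (T := 1) (fun l d => [[], [], [], l, d])
    (by simp) (by simp) (fun b l d => .pushRegs _ _ _ _ (by simp) (by simp))
    (Enc.enc (a, b, x, d)) []
  have h4 := RunsIn.eat (r := 4) (c := Cmd.push 0) (T := 1) (fun l d => [d, [], [], [], l])
    (by simp) (by simp) (fun b l d => .pushRegs _ _ _ _ (by simp) (by simp))
    (Enc.enc (a, b, x, d)).reverse []
  simp only [List.append_nil, List.reverse_reverse, List.length_reverse, ← e1] at h3 h4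
  have h5 := h2.seq (h1.seq (h0.seq (h3.seq (h4.seq (h (a, b, x, d))))))
  refine RunsIn.outputsWithin (s := regs [Enc.enc (f (a, b, x, d))]) ?_ rfl
  rw [e0]
  refine h5.mono ?_
  have h6 := (hP (a, b, x, d)).trans (P.eval_mono_nat (b := 2 * (sz a + sz b + sz x + sz d) + 3) (by
    simp; omega))
  have h7 : (Enc.enc (a, b, x, d)).length = 2 * sz a + 1 + (2 * sz b + 1 + (2 * sz x + 1 + sz d)) := by
    simp [← sz_pair]; rfl
  simp only [h7, Polynomial.eval_add, Polynomial.eval_comp, Polynomial.eval_mul, Polynomial.eval_C,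
    Polynomial.eval_X]
  simp only [sz] at h6 ⊢
  omega

/-- A function which is computed by some program, not necessarily a clean one, is `PT`. -/
theorem of_outputsWithin {c : Cmd} {P : Polynomial ℕ} {f : ℕ → ℕ → Bits}
    (h : ∀ k ≥ 1, ∀ m, c.OutputsWithin [unary k, unary m] (P.eval (k + m)) (f k m)) :
    PT fun p : ℕ × ℕ => Raw.mk (f (p.1 + 1) p.2) := by
  -- Unpacking leaves the second component on stack 0 and the first, reversed, on stack 1. With
  -- swapped arguments these are the inputs of `c`, since a unary string is its own reverse. The
  -- shift by one provides `k ≥ 1` for every input.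
  have key : PT fun p : ℕ × ℕ => Raw.mk (f (p.2 + 1) p.1) := by
    -- Clearing stacks `1, …, W` leaves only the output; the 2 ensures that the second input is
    -- erased even if `c` never mentions its stack.
    let W := max c.width 2
    let Q : Polynomial ℕ := Polynomial.X + Polynomial.C 1 + P.comp (Polynomial.X + Polynomial.C 1)
    refine ⟨.seq .unpack (.seq (.push 0 true) (.seq c (.clearTo W))),
      fun p => (6 * p.1 + 6) + (1 + (Q.eval (sz p) + (W * (2 * Q.eval (sz p) + 1) + 1))),
      ?_, ?_⟩
    · have hQ : PolyB fun p : ℕ × ℕ => Q.eval (sz p) := ⟨Q, fun _ => le_rfl⟩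
      refine ((((PolyB.const 6).mul ?_).add (.const 6))).add ((PolyB.const 1).add (hQ.add
        (((PolyB.const W).mul (((PolyB.const 2).mul hQ).add (.const 1))).add (.const 1))))
      exact PolyB.size.mono fun p => by rw [sz_pair']; simp; omega
    · rintro ⟨m, k⟩
      have hu := RunsIn.unpack (unary m) (unary k)
      rw [RunsIn.unary_reverse] at hu
      have hp : RunsIn (.push 0 true) (regs [unary k, unary m, [], []]) 1
          (regs [unary (k + 1), unary m]) := by
        have e : regs [unary (k + 1), unary m] = regs [unary (k + 1), unary m, [], []] := by
          funext i
          match i with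
          | 0 | 1 | 2 | 3 => rfl
          | i + 4 => rfl
        rw [e]
        exact .pushRegs _ _ _ _ (by simp) (by simp [unary, List.replicate_succ])
      obtain ⟨t, ht, s', hr, hs⟩ := h (k + 1) (by omega) m
      have hsz : sz (m, k) = 2 * m + 1 + k := by simp
      have hPQ : P.eval (k + 1 + m) ≤ (P.comp (Polynomial.X + Polynomial.C 1)).eval (sz (m, k)) := by
        rw [Polynomial.eval_comp]
        exact P.eval_mono_nat (by simp; omega)
      have hQe : Q.eval (sz (m, k)) = sz (m, k) + 1 +
          (P.comp (Polynomial.X + Polynomial.C 1)).eval (sz (m, k)) := by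
        simp only [Q, Polynomial.eval_add, Polynomial.eval_X, Polynomial.eval_C]
      have hc := RunsIn.clearTo s' (Q.eval (sz (m, k))) W (fun r => by
        have h1 := hr.length_le r
        have h2 : (([unary (k + 1), unary m] : List Bits).getD r []).length ≤ k + 1 + m := by
          match r with
          | 0 => simp [unary]
          | 1 => simp [unary]
          | r + 2 => simp
        omega)
      have e : (fun r => if 1 ≤ r ∧ r ≤ W then [] else s' r) = regs [f (k + 1) m] := by
        funext r
        cases r with
        | zero => simp [regs, hs]
        | succ r =>
          split_ifs with hr'
          · simp [regs]
          · have h1 := hr.eq_of_width_le (r + 1) (by omega)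
            have h2 : ([unary (k + 1), unary m] : List Bits).length ≤ r + 1 := by simp; omega
            rw [h1, List.getD_eq_default _ _ h2]
            simp [regs]
      rw [e] at hc
      have hc' : RunsIn c (regs [unary (k + 1), unary m]) (Q.eval (sz (m, k))) s' :=
        ⟨t, by omega, hr⟩
      refine (hu.seq (hp.seq (hc'.seq hc))).mono ?_
      simp [unary]
  have := key.comp (f := fun p : ℕ × ℕ => (p.2, p.1)) (by fun_prop)
  simpa using this

/-- Search for the least `t` with `test k t`. -/
theorem search {test : ℕ → ℕ → Bool} {τ : ℕ → ℕ} {f : ℕ → ℕ → ℕ}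
    (htest : PT fun p : ℕ × ℕ => test p.1 p.2)
    (hτ : ∀ k ≥ 1, test k (τ k) = true ∧ ∀ t < τ k, test k t = false)
    (hf : PT fun p : ℕ × ℕ => f p.1 p.2) :
    ∃ (c : Cmd) (P : Polynomial ℕ), ∀ k ≥ 1,
      c.OutputsWithin [unary k] (P.eval (k + τ k)) (unary (f k (τ k))) := by
  have hstep : PT fun p : ℕ × ℕ => (p.1, p.2 + 1) := by fun_prop
  have hinit : PT fun k : ℕ => (k, 0) := by fun_prop
  obtain ⟨d, D, ⟨PD, hD⟩, hd⟩ := hinit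
  obtain ⟨e, E, ⟨PE, hE⟩, he⟩ := hstep
  obtain ⟨g, G, ⟨PG, hG⟩, hg⟩ := htest
  obtain ⟨c, T, ⟨PT, hT⟩, h⟩ := hf
  -- Stack 2 holds a flag which keeps the loop alive. The test runs in zone 1 on a copy of `(k, t)`;
  -- on failure `t` is incremented in zone 0, on success the flag is removed.
  let body : Cmd := .seq (.seq (.eat 0 (.push 3)) (.eat 3 fun b => .seq (.push 0 b) (.push 1 b)))
    (.seq (g.zone 1) (.branch 1 .skip (.seq (.pop 1) (e.zone 0)) (.seq (.pop 1) (.pop 2))))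
  let L : Polynomial ℕ := Polynomial.C 2 * Polynomial.X + Polynomial.C 1
  let R : Polynomial ℕ := Polynomial.C 9 * L + Polynomial.C 2 + (PG.comp L + (Polynomial.C 3 +
    PE.comp L))
  refine ⟨.seq d (.seq (.push 2 true) (.seq (.loop 2 body) c)),
    PD + (Polynomial.C 1 + ((Polynomial.X + Polynomial.C 1) * (R + Polynomial.C 1) + Polynomial.C 1
      + PT.comp L)), fun k hk => ?_⟩
  have hLe : ∀ i ≤ τ k, sz (k, i) ≤ L.eval (k + τ k) := by
    intro i hi; simp [L]; omega
  have hbody : ∀ i ≤ τ k, RunsIn body (regs [Enc.enc (k, i), [], [true], []])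
      (R.eval (k + τ k)) (if test k i then regs [Enc.enc (k, i)] else
        regs [Enc.enc (k, i + 1), [], [true], []]) := by
    intro i hi
    have hR : R.eval (k + τ k) = 9 * L.eval (k + τ k) + 2 + (PG.eval (L.eval (k + τ k)) + (3 +
        PE.eval (L.eval (k + τ k)))) := by
      simp [R]
    have h1 := RunsIn.dup' (Enc.enc (k, i)) [true]
    have h2 : RunsIn (g.zone 1) (regs [Enc.enc (k, i), Enc.enc (k, i), [true], []]) (G (k, i))
        (regs [Enc.enc (k, i), [test k i], [true], []]) :=
      .zone (i := 1) (by simp) (by simp) (hg (k, i))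
    have h3 : RunsIn (.pop 1) (regs [Enc.enc (k, i), [test k i], [true], []]) 1
        (regs [Enc.enc (k, i), [], [true], []]) := .popRegs _ _ _ (by simp) (by simp)
    have bE := (hE (k, i)).trans (PE.eval_mono_nat (hLe i hi))
    have bG := (hG (k, i)).trans (PG.eval_mono_nat (hLe i hi))
    have bs := hLe i hi
    have h4 : RunsIn (.branch 1 .skip (.seq (.pop 1) (e.zone 0)) (.seq (.pop 1) (.pop 2)))
        (regs [Enc.enc (k, i), [test k i], [true], []]) (3 + PE.eval (L.eval (k + τ k)))
        (if test k i then regs [Enc.enc (k, i)] else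
          regs [Enc.enc (k, i + 1), [], [true], []]) := by
      refine (RunsIn.branchCons (b := test k i) (l := []) (T := 2 + PE.eval (L.eval (k + τ k)))
        (by simp [regs]) ?_).mono (by omega)
      cases hb : test k i
      · rw [hb] at h3
        have h5 : RunsIn (e.zone 0) (regs [Enc.enc (k, i), [], [true], []]) (E (k, i))
            (regs [Enc.enc (k, i + 1), [], [true], []]) :=
          .zone (i := 0) (by simp) (by simp) (he (k, i))
        simpa using (h3.seq h5).mono (T' := 2 + PE.eval (L.eval (k + τ k))) (by omega)
      · rw [hb] at h3
        have h5 : RunsIn (.pop 2) (regs [Enc.enc (k, i), [], [true], []]) 1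
            (regs [Enc.enc (k, i)]) := by
          rw [regs_pad]
          exact .popRegs _ _ _ (by simp) (by simp)
        simpa using (h3.seq h5).mono (T' := 2 + PE.eval (L.eval (k + τ k))) (by omega)
    refine (h1.seq (h2.seq h4)).mono ?_
    simp only [sz] at bs
    omega
  have hloop : ∀ j ≤ τ k, RunsIn (.loop 2 body)
      (regs [Enc.enc (k, τ k - j), [], [true], []]) ((j + 1) * (R.eval (k + τ k) + 1) + 1)
      (regs [Enc.enc (k, τ k)]) := by
    intro j
    induction j with
    | zero =>
      intro _
      have h1 := hbody (τ k) le_rfl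
      rw [(hτ k hk).1, if_pos rfl] at h1
      exact (RunsIn.loopStep (by simp [regs]) h1 (RunsIn.loopDone (by simp [regs]))).mono (by
        simp)
    | succ j ih =>
      intro hj
      have h1 := hbody (τ k - (j + 1)) (by omega)
      rw [(hτ k hk).2 _ (by omega), show τ k - (j + 1) + 1 = τ k - j by omega] at h1
      refine (RunsIn.loopStep (by simp [regs]) h1 (ih (by omega))).mono ?_
      rw [add_one_mul (j + 1)]; omega
  have h1 := hloop (τ k) le_rfl
  rw [Nat.sub_self] at h1
  have h2 : RunsIn (.push 2 true) (regs [Enc.enc (k, 0)]) 1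
      (regs [Enc.enc (k, 0), [], [true], []]) := by
    rw [regs_pad]
    exact .pushRegs _ _ _ _ (by simp) (by simp)
  refine RunsIn.outputsWithin (((hd k).seq (h2.seq (h1.seq (h (k, τ k))))).mono ?_) rfl
  have b1 := (hD k).trans (PD.eval_mono_nat (show sz k ≤ k + τ k by simp))
  have b2 := (hT (k, τ k)).trans (PT.eval_mono_nat (hLe _ le_rfl))
  have b3 : (τ k + 1) * (R.eval (k + τ k) + 1) ≤ (k + τ k + 1) * (R.eval (k + τ k) + 1) :=
    Nat.mul_le_mul_right _ (by omega)
  simp only [Polynomial.eval_add, Polynomial.eval_mul, Polynomial.eval_X, Polynomial.eval_C,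
    Polynomial.eval_comp]
  omega

end PT

/-! ## Expectations of bounded functions -/

noncomputable section

/-- The expectation of `f`. -/
def ev {α : Type} (μ : PMF α) (f : α → ℝ) : ℝ := ∑' a, (μ a).toReal * f a

section Expectation

variable {α β : Type}

theorem summable_ev (μ : PMF α) {f : α → ℝ} {K : ℝ} (hf : ∀ a, |f a| ≤ K) :
    Summable fun a => (μ a).toReal * f a := by
  have h := (ENNReal.summable_toReal μ.tsum_coe_ne_top).mul_right K
  refine Summable.of_norm_bounded h fun a => ?_
  rw [Real.norm_eq_abs, abs_mul, abs_of_nonneg ENNReal.toReal_nonneg]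
  exact mul_le_mul_of_nonneg_left (hf a) ENNReal.toReal_nonneg

theorem ev_congr (μ : PMF α) {f g : α → ℝ} (h : ∀ a ∈ μ.support, f a = g a) :
    ev μ f = ev μ g := by
  refine tsum_congr fun a => ?_
  by_cases ha : a ∈ μ.support
  · rw [h a ha]
  · simp [(μ.apply_eq_zero_iff a).2 ha]

theorem ev_const (μ : PMF α) (c : ℝ) : (ev μ fun _ => c) = c := by
  rw [ev, tsum_mul_right, ← ENNReal.tsum_toReal_eq fun a => μ.apply_ne_top a, μ.tsum_coe]
  simp

theorem ev_mono (μ : PMF α) {f g : α → ℝ} {K L : ℝ} (hf : ∀ a, |f a| ≤ K)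
    (hg : ∀ a, |g a| ≤ L) (h : ∀ a, f a ≤ g a) : ev μ f ≤ ev μ g :=
  (summable_ev μ hf).tsum_le_tsum
    (fun a => mul_le_mul_of_nonneg_left (h a) ENNReal.toReal_nonneg) (summable_ev μ hg)

theorem ev_add (μ : PMF α) {f g : α → ℝ} {K L : ℝ} (hf : ∀ a, |f a| ≤ K)
    (hg : ∀ a, |g a| ≤ L) : (ev μ fun a => f a + g a) = ev μ f + ev μ g := by
  simp only [ev, mul_add]
  exact (summable_ev μ hf).tsum_add (summable_ev μ hg)

theorem ev_mul_left (μ : PMF α) (c : ℝ) (f : α → ℝ) : (ev μ fun a => c * f a) = c * ev μ f := by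
  simp only [ev, ← tsum_mul_left]
  exact tsum_congr fun a => by ring

theorem ev_neg (μ : PMF α) (f : α → ℝ) : (ev μ fun a => -f a) = -ev μ f := by
  simpa using ev_mul_left μ (-1) f

theorem ev_sub (μ : PMF α) {f g : α → ℝ} {K L : ℝ} (hf : ∀ a, |f a| ≤ K)
    (hg : ∀ a, |g a| ≤ L) : (ev μ fun a => f a - g a) = ev μ f - ev μ g := by
  have h := ev_add μ (g := fun a => -g a) hf (fun a => by rw [abs_neg]; exact hg a)
  rw [ev_neg] at h
  simpa [sub_eq_add_neg] using h

theorem ev_le (μ : PMF α) {f : α → ℝ} {K c : ℝ} (hf : ∀ a, |f a| ≤ K) (h : ∀ a, f a ≤ c) :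
    ev μ f ≤ c :=
  (ev_mono μ hf (fun _ => le_rfl) h).trans (ev_const μ c).le

theorem abs_ev_le (μ : PMF α) {f : α → ℝ} {K : ℝ} (hf : ∀ a, |f a| ≤ K) : |ev μ f| ≤ K := by
  refine abs_le.2 ⟨?_, ev_le μ hf fun a => (le_abs_self _).trans (hf a)⟩
  have h := ev_le μ (f := fun a => -f a) (K := K) (by simpa using hf)
    fun a => (neg_le_abs _).trans (hf a)
  rw [ev_neg] at h
  linarith

theorem ev_pure (a : α) (f : α → ℝ) : ev (PMF.pure a) f = f a := by
  rw [ev, tsum_eq_single a]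
  · simp
  · intro b hb; simp [hb]

/-- Fubini: boundedness of f gives absolute summability over the product. -/
theorem ev_bind (μ : PMF α) (κ : α → PMF β) {f : β → ℝ} {K : ℝ} (hf : ∀ b, |f b| ≤ K) :
    ev (μ.bind κ) f = ev μ fun a => ev (κ a) f := by
  have hs : Summable fun p : α × β => (μ p.1 * κ p.1 p.2).toReal := by
    refine ENNReal.summable_toReal ?_
    rw [ENNReal.tsum_prod (f := fun a b => μ a * κ a b)]
    simp [ENNReal.tsum_mul_left, PMF.tsum_coe]
  have hs' : Summable (Function.uncurry fun (b : β) (a : α) =>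
      (μ a).toReal * (κ a b).toReal * f b) := by
    refine Summable.of_norm_bounded ((hs.mul_right K).comp_injective Prod.swap_injective)
      fun p => ?_
    simp only [Function.uncurry, Function.comp, Prod.swap, ENNReal.toReal_mul, norm_mul,
      Real.norm_eq_abs, abs_of_nonneg ENNReal.toReal_nonneg]
    exact mul_le_mul_of_nonneg_left (hf _) (by positivity)
  have h1 : ev (μ.bind κ) f = ∑' b, ∑' a, (μ a).toReal * (κ a b).toReal * f b := by
    refine tsum_congr fun b => ?_
    rw [PMF.bind_apply, ENNReal.tsum_toReal_eq
      fun a => ENNReal.mul_ne_top (μ.apply_ne_top a) ((κ a).apply_ne_top b), tsum_mul_right]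
    simp only [ENNReal.toReal_mul]
  rw [h1, ← hs'.tsum_comm]
  refine tsum_congr fun a => ?_
  change _ = (μ a).toReal * ∑' b, (κ a b).toReal * f b
  rw [← tsum_mul_left]
  exact tsum_congr fun b => by ring

theorem ev_map (μ : PMF α) (g : α → β) {f : β → ℝ} {K : ℝ} (hf : ∀ b, |f b| ≤ K) :
    ev (μ.map g) f = ev μ fun a => f (g a) := by
  rw [PMF.map, ev_bind _ _ hf]
  simp [ev_pure]

theorem ev_bool (μ : PMF Bool) (f : Bool → ℝ) :
    ev μ f = (μ false).toReal * f false + (μ true).toReal * f true := by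
  rw [ev, tsum_bool]

theorem bool_add (μ : PMF Bool) : (μ false).toReal + (μ true).toReal = 1 := by
  simpa [ev_bool] using ev_const μ 1

theorem prob_eq_ev (μ : PMF α) (S : Set α) [DecidablePred (· ∈ S)] :
    prob μ S = ev μ fun a => if a ∈ S then 1 else 0 := by
  rw [prob, PMF.toOuterMeasure_apply, ENNReal.tsum_toReal_eq]
  · refine tsum_congr fun a => ?_
    by_cases h : a ∈ S <;> simp [h]
  · intro a
    by_cases h : a ∈ S <;> simp [h, μ.apply_ne_top]

end Expectation

/-! ## Prediction advantage as a supremum over bounded functions -/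

/-- `(-1)^b`. -/
def sgn (b : Bool) : ℝ := if b then -1 else 1

@[simp] theorem sgn_true : sgn true = -1 := rfl
@[simp] theorem sgn_false : sgn false = 1 := rfl
@[simp] theorem abs_sgn (b : Bool) : |sgn b| = 1 := by cases b <;> simp
theorem sgn_xor (a b : Bool) : sgn (xor a b) = sgn a * sgn b := by cases a <;> cases b <;> simp
theorem sgn_not (a : Bool) : sgn (!a) = -sgn a := by cases a <;> simp

theorem abs_sgn_mul (b : Bool) (x : ℝ) : |sgn b * x| = |x| := by simp [abs_mul]

/-- The advantage in guessing the bit from the other component is at most `q`. -/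
def AdvLe {Y : Type} (μ : PMF (Bool × Y)) (q : ℝ) : Prop :=
  ∀ g : Y → ℝ, (∀ y, |g y| ≤ 1) → ev μ (fun w => sgn w.1 * g w.2) ≤ q

namespace AdvLe

variable {X Y Z : Type} {μ : PMF (Bool × Y)} {q : ℝ}

theorem le_mul (h : AdvLe μ q) {K : ℝ} (hK : 0 ≤ K) (g : Y → ℝ) (hg : ∀ y, |g y| ≤ K) :
    ev μ (fun w => sgn w.1 * g w.2) ≤ K * q := by
  rcases hK.eq_or_lt with rfl | hK
  · have : g = fun _ => 0 := funext fun y => abs_nonpos_iff.1 (hg y)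
    simp [this, ev_const]
  · have h1 := h (fun y => K⁻¹ * g y) (fun y => by
      rw [abs_mul, abs_of_pos (inv_pos.2 hK), inv_mul_le_iff₀ hK]; simpa using hg y)
    have h2 : (fun w : Bool × Y => sgn w.1 * (K⁻¹ * g w.2)) =
        fun w => K⁻¹ * (sgn w.1 * g w.2) := by funext w; ring
    rw [h2, ev_mul_left, inv_mul_le_iff₀ hK] at h1
    exact h1

theorem map_iff {ν : PMF X} {f : X → Bool × Y} : AdvLe (ν.map f) q ↔
    ∀ g : Y → ℝ, (∀ y, |g y| ≤ 1) → ev ν (fun x => sgn (f x).1 * g (f x).2) ≤ q := by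
  refine forall_congr' fun g => imp_congr_right fun hg => ?_
  rw [ev_map _ _ (K := 1) fun w => by rw [abs_sgn_mul]; exact hg _]

end AdvLe

theorem ev_sgn_mul {Y : Type} (μ : PMF (Bool × Y)) {g : Y → ℝ} {K : ℝ} (hg : ∀ y, |g y| ≤ K) :
    ev μ (fun w => sgn w.1 * g w.2) =
      ∑' y, ((μ (false, y)).toReal - (μ (true, y)).toReal) * g y ∧
    Summable fun y => ((μ (false, y)).toReal - (μ (true, y)).toReal) * g y := by
  have hs := summable_ev μ (f := fun w => sgn w.1 * g w.2) (K := K)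
    fun w => by rw [abs_sgn_mul]; exact hg _
  have h1 := hs.comp_injective (Prod.mk_right_injective false)
  have h2 := hs.comp_injective (Prod.mk_right_injective true)
  simp only [Function.comp_def] at h1 h2
  have e : ∀ y, ((μ (false, y)).toReal - (μ (true, y)).toReal) * g y =
      (μ (false, y)).toReal * (sgn false * g y) + (μ (true, y)).toReal * (sgn true * g y) := by
    intro y; simp; ring
  simp only [e]
  refine ⟨?_, h1.add h2⟩
  rw [h1.tsum_add h2, ev, hs.tsum_prod, tsum_bool]

/-- With signs for bits, the advantage of a predictor f is E[(-1)^X (-1)^f(Y)]. This is linear in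
the sign function, so passing to functions with values in [-1, 1] does not increase the supremum.
The real-valued form survives averaging over other instances. -/
theorem predAdv_le_iff {Y : Type} (μ : PMF (Bool × Y)) (q : ℝ) :
    predAdv μ ≤ q ↔ AdvLe μ q := by
  have key : ∀ f : Y → Bool, 2 * prob μ {w | f w.2 = w.1} - 1 =
      ev μ fun w => sgn w.1 * sgn (f w.2) := by
    intro f
    have e : (fun w : Bool × Y => sgn w.1 * sgn (f w.2)) = fun w =>
        2 * (if w ∈ {w : Bool × Y | f w.2 = w.1} then (1 : ℝ) else 0) - 1 := by
      funext ⟨b, y⟩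
      have h : ∀ b c : Bool, sgn b * sgn c = 2 * (if c = b then (1 : ℝ) else 0) - 1 := by
        intro b c; cases b <;> cases c <;> norm_num
      exact h b (f y)
    rw [e, ev_sub μ (K := 2) (L := 1) (fun a => by split_ifs <;> simp) (by simp), ev_mul_left,
      ev_const, prob_eq_ev]
  have hle : ∀ f : Y → Bool, prob μ {w | f w.2 = w.1} ≤ 1 := by
    intro f
    rw [prob_eq_ev]
    exact ev_le μ (K := 1) (fun a => by split_ifs <;> simp) fun a => by split_ifs <;> simp
  have hbdd : BddAbove (Set.range fun f : Y → Bool => prob μ {w | f w.2 = w.1}) :=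
    ⟨1, by rintro _ ⟨f, rfl⟩; exact hle f⟩
  constructor
  · intro h g hg
    -- The maximum likelihood predictor, which is optimal for each `y` separately.
    have h1 := le_ciSup hbdd fun y => decide ((μ (false, y)).toReal < (μ (true, y)).toReal)
    have h2 := key fun y => decide ((μ (false, y)).toReal < (μ (true, y)).toReal)
    rw [predAdv] at h
    refine le_trans ?_ (show _ ≤ q by linarith [h2.symm.le])
    obtain ⟨e1, s1⟩ := ev_sgn_mul μ hg
    obtain ⟨e2, s2⟩ := ev_sgn_mul μ (K := 1)
      (g := fun y => sgn (decide ((μ (false, y)).toReal < (μ (true, y)).toReal))) (by simp)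
    rw [e1, e2]
    refine s1.tsum_le_tsum (fun y => ?_) s2
    have := abs_le.1 (hg y)
    by_cases hy : (μ (false, y)).toReal < (μ (true, y)).toReal
    · simp only [hy, decide_true, sgn_true]; nlinarith
    · simp only [hy, decide_false, sgn_false]; nlinarith
  · intro h
    have : (⨆ f : Y → Bool, prob μ {w | f w.2 = w.1}) ≤ (q + 1) / 2 := by
      refine ciSup_le fun f => ?_
      have h1 := h (fun y => sgn (f y)) (by simp)
      rw [← key] at h1
      linarith
    rw [predAdv]; linarith

/-! ## Lists of independent random variables -/

/-- The joint distribution of independent random variables. -/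
def seqL {X : Type} : List (PMF X) → PMF (List X)
  | [] => PMF.pure []
  | μ :: μs => μ.bind fun x => (seqL μs).map (x :: ·)

section SeqL

variable {X Y : Type}

theorem indep_map_ofFn {n : ℕ} (μ : Fin n → PMF X) :
    (indep n μ).map List.ofFn = seqL (List.ofFn μ) := by
  induction n with
  | zero => simp [indep, seqL, PMF.pure_map]
  | succ n ih =>
    rw [List.ofFn_succ, seqL, indep, PMF.map_bind, ← ih]
    congr 1
    funext a
    rw [PMF.map_comp, PMF.map_comp]
    congr 1
    funext w
    simp [List.ofFn_succ]

theorem length_of_mem_support {μs : List (PMF X)} {l : List X} (h : l ∈ (seqL μs).support) :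
    l.length = μs.length := by
  induction μs generalizing l with
  | nil => simp [seqL] at h; simp [h]
  | cons μ μs ih =>
    simp only [seqL, PMF.mem_support_bind_iff, PMF.mem_support_map_iff] at h
    obtain ⟨x, _, l', hl', rfl⟩ := h
    simp [ih hl']

theorem seqL_append (μs νs : List (PMF X)) :
    seqL (μs ++ νs) = (seqL μs).bind fun l => (seqL νs).map (l ++ ·) := by
  induction μs with
  | nil =>
    simp only [List.nil_append, seqL, PMF.pure_bind]
    exact (PMF.map_id _).symm
  | cons μ μs ih =>
    simp only [List.cons_append, seqL, PMF.bind_bind, ih, PMF.map_bind, PMF.bind_map,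
      Function.comp_def, PMF.map_comp]

theorem bind_congr_support (μ : PMF X) {κ κ' : X → PMF Y} (h : ∀ x ∈ μ.support, κ x = κ' x) :
    μ.bind κ = μ.bind κ' := by
  ext y
  rw [PMF.bind_apply, PMF.bind_apply]
  refine tsum_congr fun x => ?_
  by_cases hx : x ∈ μ.support
  · rw [h x hx]
  · simp [(μ.apply_eq_zero_iff x).2 hx]

/-- The first `m` blocks of length `r`. -/
def blocks (r : ℕ) : ℕ → List X → List (List X)
  | 0, _ => []
  | m + 1, l => l.take r :: blocks r m (l.drop r)

/-- Functions of disjoint blocks of independent variables are independent. -/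
theorem seqL_blocks (f : List X → Y) (r m : ℕ) (μs : List (PMF X)) (h : μs.length = m * r) :
    (seqL μs).map (fun l => (blocks r m l).map f) =
      seqL ((blocks r m μs).map fun G => (seqL G).map f) := by
  induction m generalizing μs with
  | zero =>
    have : μs = [] := List.length_eq_zero_iff.1 (by simpa using h)
    subst this
    simp [blocks, seqL, PMF.pure_map]
  | succ m ih =>
    have h1 : (μs.take r).length = r := by simp [h]; nlinarith
    have h2 : (μs.drop r).length = m * r := by simp [h, add_one_mul]
    conv_lhs => rw [← List.take_append_drop r μs, seqL_append]
    simp only [blocks, List.map_cons, seqL, PMF.map_bind, PMF.bind_map, ← ih _ h2, PMF.map_comp]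
    refine bind_congr_support _ fun l hl => ?_
    have hl' : l.length = r := (length_of_mem_support hl).trans h1
    congr 1
    funext l'
    simp [← hl']

theorem ev_seqL_cons (μ : PMF X) (μs : List (PMF X)) {f : List X → ℝ} {K : ℝ}
    (hf : ∀ l, |f l| ≤ K) :
    ev (seqL (μ :: μs)) f = ev μ fun x => ev (seqL μs) fun l => f (x :: l) := by
  rw [seqL, ev_bind _ _ hf]
  simp only [ev_map _ _ hf]

end SeqL

/-! ## Exclusive or, and revealed differences -/

/-- The exclusive or of the bits of `l`. -/
def xorAll (l : List Bool) : Bool := l.foldr xor false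

@[simp] theorem xorAll_nil : xorAll [] = false := rfl
@[simp] theorem xorAll_cons (b : Bool) (l : List Bool) : xorAll (b :: l) = xor b (xorAll l) := rfl

section Advantage

variable {I : Type} {q : ℝ}

/-- The sign of an exclusive or is the product of the signs. Averaging over all entries but the
first leaves a function of the first side information which is bounded by the inductive estimate,
and `AdvLe.le_mul` contributes one more factor q. -/
theorem ev_xor_le (hq : 0 ≤ q) (G : List (PMF (Bool × I))) (hG : ∀ μ ∈ G, AdvLe μ q)
    (g : List I → ℝ) (hg : ∀ l, |g l| ≤ 1) :
    |ev (seqL G) fun l => sgn (xorAll (l.map Prod.fst)) * g (l.map Prod.snd)| ≤ q ^ G.length := by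
  suffices ∀ g : List I → ℝ, (∀ l, |g l| ≤ 1) →
      (ev (seqL G) fun l => sgn (xorAll (l.map Prod.fst)) * g (l.map Prod.snd)) ≤
        q ^ G.length by
    refine abs_le.2 ⟨?_, this g hg⟩
    have h := this (fun l => -g l) (by simpa using hg)
    simp only [mul_neg, ev_neg] at h
    linarith
  clear hg g
  induction G with
  | nil => intro g hg; simpa [seqL, ev_pure] using (abs_le.1 (hg [])).2
  | cons μ G ih =>
    intro g hg
    have hbd : ∀ l : List (Bool × I),
        |sgn (xorAll (l.map Prod.fst)) * g (l.map Prod.snd)| ≤ 1 := fun l => by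
      rw [abs_sgn_mul]; exact hg _
    rw [ev_seqL_cons _ _ hbd]
    have ih' := ih fun ν hν => hG ν (List.mem_cons_of_mem _ hν)
    have e : (fun x : Bool × I => ev (seqL G) fun l =>
        sgn (xorAll ((x :: l).map Prod.fst)) * g ((x :: l).map Prod.snd)) = fun x =>
        sgn x.1 * ev (seqL G) fun l =>
          sgn (xorAll (l.map Prod.fst)) * g (x.2 :: l.map Prod.snd) := by
      funext x
      rw [← ev_mul_left]
      congr 1
      funext l
      simp [sgn_xor]; ring
    rw [e, List.length_cons, pow_succ]
    refine (hG μ List.mem_cons_self).le_mul (pow_nonneg hq _)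
      (fun y => ev (seqL G) fun l => sgn (xorAll (l.map Prod.fst)) * g (y :: l.map Prod.snd))
      fun y => abs_le.2 ⟨?_, ih' (fun l => g (y :: l)) fun l => hg _⟩
    have h := ih' (fun l => -g (y :: l)) fun l => by rw [abs_neg]; exact hg _
    simp only [mul_neg, ev_neg] at h
    linarith

/-- Flip the secret bit. -/
def flipBit (x : Bool × I) : Bool × I := (!x.1, x.2)

/-- Hybrid argument: the secrets are flipped one after the other. One flip costs at most 2q, because
the difference of H at the two values of a secret is the sign of that secret times a function of the
side information bounded by 2. -/
theorem ev_flip_le (G : List (PMF (Bool × I))) (hG : ∀ μ ∈ G, AdvLe μ q)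
    (H : List (Bool × I) → ℝ) (hH : ∀ l, |H l| ≤ 1) :
    ev (seqL G) H - ev (seqL G) (fun l => H (l.map flipBit)) ≤ 2 * (G.length * q) := by
  induction G generalizing H with
  | nil => simp [seqL, ev_pure]
  | cons μ G ih =>
    rw [ev_seqL_cons _ _ hH, ev_seqL_cons _ _ fun l => hH _]
    have ih' := ih fun ν hν => hG ν (List.mem_cons_of_mem _ hν)
    -- The hybrid in which all secrets but the first are flipped.
    let h : Bool × I → ℝ := fun x => ev (seqL G) fun l => H (x :: l.map flipBit)
    have hh : ∀ x, |h x| ≤ 1 := fun x => abs_ev_le _ fun l => hH _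
    have h1 : ev μ (fun x => ev (seqL G) fun l => H (x :: l)) - ev μ h ≤ 2 * (G.length * q) := by
      rw [← ev_sub μ (K := 1) (L := 1) (fun x => abs_ev_le _ fun l => hH _) hh]
      exact ev_le μ (K := 2) (fun x => (abs_sub _ _).trans
        (by linarith [hh x, abs_ev_le (seqL G) (f := fun l => H (x :: l)) fun l => hH _]))
        fun x => ih' (fun l => H (x :: l)) fun l => hH _
    have h2 : ev μ h - ev μ (fun x => h (flipBit x)) ≤ 2 * q := by
      rw [← ev_sub μ hh fun x => hh _]
      have e : (fun x => h x - h (flipBit x)) = fun x : Bool × I =>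
          sgn x.1 * (h (false, x.2) - h (true, x.2)) := by
        funext ⟨b, y⟩
        cases b <;> simp [flipBit]
      rw [e]
      exact (hG μ List.mem_cons_self).le_mul zero_le_two
        (fun y => h (false, y) - h (true, y)) fun y =>
          (abs_sub _ _).trans (by linarith [hh (false, y), hh (true, y)])
    have h3 : (fun x : Bool × I => ev (seqL G) fun l => H ((x :: l).map flipBit)) =
        fun x => h (flipBit x) := rfl
    rw [h3, List.length_cons]
    push_cast
    linarith

/-- A function which changes its sign if all secret bits are flipped. -/
theorem ev_odd_le (G : List (PMF (Bool × I))) (hG : ∀ μ ∈ G, AdvLe μ q)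
    (H : List (Bool × I) → ℝ) (hH : ∀ l, |H l| ≤ 1)
    (hodd : ∀ l, l.length = G.length → H (l.map flipBit) = -H l) :
    ev (seqL G) H ≤ G.length * q := by
  -- For odd H the left side of the hybrid bound is twice the expectation of H.
  have h1 := ev_flip_le G hG H hH
  rw [ev_congr (seqL G) (f := fun l => H (l.map flipBit)) (g := fun l => -H l)
    fun l hl => hodd l (length_of_mem_support hl), ev_neg] at h1
  linarith

end Advantage

/-! ## Majority -/

/-- The majority of the bits of `l`; the first bit in case of a tie. -/
def maj (l : List Bool) : Bool :=
  if l.length ≤ 2 * l.count (l.headD false) then l.headD false else !l.headD false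

/-- Breaking ties by the first bit makes the majority equivariant under flipping all bits, also for
lists of even length. The empty list fails because its default head is not flipped. -/
theorem maj_map_xor (x : Bool) {l : List Bool} (hl : l ≠ []) :
    maj (l.map (xor x)) = xor x (maj l) := by
  obtain ⟨a, l', rfl⟩ := List.exists_cons_of_ne_nil hl
  have hinj : Function.Injective (xor x) := fun a b h => by simpa using h
  have h := List.count_map_of_injective (a :: l') (xor x) hinj a
  simp only [maj, List.map_cons, List.headD_cons, List.length_cons, List.length_map] at h ⊢
  rw [h]
  by_cases h' : l'.length + 1 ≤ 2 * List.count a (a :: l')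
  · exact (if_pos h').trans (congrArg (xor x) (if_pos h').symm)
  · refine (if_neg h').trans (Eq.trans ?_ (congrArg (xor x) (if_neg h').symm))
    cases x <;> cases a <;> rfl

theorem length_le_of_maj {l : List Bool} (h : maj l = true) : l.length ≤ 2 * l.count true := by
  unfold maj at h
  split_ifs at h with h'
  · rwa [h] at h'
  · have h1 : l.headD false = false := by simpa using h
    have h2 := List.count_false_add_count_true l
    rw [h1] at h'
    omega

/-- The law of the combination by `f` of independent random variables. -/
def law {X Y : Type} (f : List X → Y) (G : List (PMF X)) : PMF Y := (seqL G).map f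

theorem ev_sgn (μ : PMF Bool) : ev μ sgn = 1 - 2 * (μ true).toReal := by
  rw [ev_bool, sgn_true, sgn_false]
  linarith [bool_add μ]

theorem toReal_law {X : Type} (f : List X → Bool) (G : List (PMF X)) :
    (law f G true).toReal = ev (seqL G) fun l => if f l then 1 else 0 := by
  have h := ev_map (seqL G) f (f := fun b => if b then (1 : ℝ) else 0) (K := 1)
    fun b => by cases b <;> simp
  rw [ev_bool] at h
  simpa [law] using h

/-- The biases of independent bits multiply under exclusive or, and so do nonnegative lower bounds
on them. -/
theorem pow_le_ev_xor {α : ℝ} (hα : 0 ≤ α) (G : List (PMF Bool))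
    (hG : ∀ μ ∈ G, α ≤ ev μ sgn) : α ^ G.length ≤ ev (law xorAll G) sgn := by
  rw [law, ev_map _ _ fun b => (abs_sgn b).le]
  induction G with
  | nil => simp [seqL, ev_pure]
  | cons μ G ih =>
    rw [ev_seqL_cons _ _ fun b => (abs_sgn _).le]
    have ih' := ih fun ν hν => hG ν (List.mem_cons_of_mem _ hν)
    have h1 := hG μ List.mem_cons_self
    have e : (fun x => ev (seqL G) fun l => sgn (xorAll (x :: l))) = fun x =>
        (ev (seqL G) fun l => sgn (xorAll l)) * sgn x := by
      funext x
      simp only [xorAll_cons, sgn_xor, ev_mul_left]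
      exact mul_comm _ _
    rw [e, ev_mul_left, List.length_cons, pow_succ]
    exact mul_le_mul ih' h1 hα ((pow_nonneg hα _).trans ih')

/-- The exponential moment method: the expectation of a product of weights factorizes. The constant
A collects the weights of the entries already processed in the induction. -/
theorem ev_le_weight {w : Bool → ℝ} (hw : ∀ b, 0 ≤ w b) {z : ℝ} (G : List (PMF Bool))
    (hG : ∀ μ ∈ G, ev μ w ≤ z) {f : List Bool → ℝ} (hf : ∀ l, |f l| ≤ 1) {A : ℝ} (hA : 0 ≤ A)
    (hfA : ∀ l, l.length = G.length → f l ≤ A * (l.map w).prod) :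
    ev (seqL G) f ≤ A * z ^ G.length := by
  induction G generalizing f A with
  | nil => simpa [seqL, ev_pure] using hfA [] rfl
  | cons μ G ih =>
    rw [ev_seqL_cons _ _ hf, ev_bool]
    have hz : 0 ≤ z := le_trans (by
      rw [ev_bool]
      exact add_nonneg (mul_nonneg ENNReal.toReal_nonneg (hw _))
        (mul_nonneg ENNReal.toReal_nonneg (hw _))) (hG μ List.mem_cons_self)
    have ih' : ∀ b, ev (seqL G) (fun l => f (b :: l)) ≤ A * w b * z ^ G.length := fun b =>
      ih (fun ν hν => hG ν (List.mem_cons_of_mem _ hν)) (fun l => hf _) (mul_nonneg hA (hw b))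
        fun l hl => (hfA (b :: l) (by simp [hl])).trans_eq (by rw [List.map_cons, List.prod_cons, mul_assoc])
    have h1 := hG μ List.mem_cons_self
    rw [ev_bool] at h1
    calc _ ≤ (μ false).toReal * (A * w false * z ^ G.length) +
          (μ true).toReal * (A * w true * z ^ G.length) := by
            gcongr
            · exact ih' false
            · exact ih' true
      _ = A * z ^ G.length * ((μ false).toReal * w false + (μ true).toReal * w true) := by ring
      _ ≤ A * z ^ G.length * z := by gcongr
      _ = _ := by rw [List.length_cons, pow_succ]; ring

/-- The Chernoff bound for the majority. -/
theorem maj_error_sq_le {α : ℝ} (hα : 0 ≤ α) (hα1 : α < 1) (G : List (PMF Bool))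
    (hG : ∀ μ ∈ G, α ≤ ev μ sgn) :
    (law maj G true).toReal ^ 2 ≤ (1 - α ^ 2) ^ G.length := by
  -- The optimal tilt: it minimizes (1 + α) / (2 s) + (1 - α) s / 2, and the minimum is the square
  -- root of 1 - α².
  let s := Real.sqrt ((1 + α) / (1 - α))
  have h1α : 0 < 1 - α := by linarith
  have hs2 : s ^ 2 = (1 + α) / (1 - α) := Real.sq_sqrt (by positivity)
  have hs : 1 ≤ s := by
    rw [← Real.sqrt_one]
    exact Real.sqrt_le_sqrt (by rw [le_div_iff₀ h1α]; linarith)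
  have hs0 : 0 < s := by linarith
  let z := (1 + α) / 2 * s⁻¹ + (1 - α) / 2 * s
  have hz : z ^ 2 = 1 - α ^ 2 := by
    have : z ^ 2 = (1 + α) ^ 2 / 4 * (s ^ 2)⁻¹ + (1 - α ^ 2) / 2 * (s⁻¹ * s) +
        (1 - α) ^ 2 / 4 * s ^ 2 := by simp only [z]; ring
    rw [this, hs2, inv_mul_cancel₀ hs0.ne']
    have : 1 + α ≠ 0 := by positivity
    field_simp
    ring
  let w : Bool → ℝ := fun b => if b then s else s⁻¹
  have hwt : w true = s := rfl
  have hwf : w false = s⁻¹ := rfl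
  have hprod : ∀ l : List Bool, (l.map w).prod * s ^ l.length = s ^ (2 * l.count true) := by
    intro l
    induction l with
    | nil => simp
    | cons b l ih =>
      rw [List.map_cons, List.prod_cons, List.length_cons, pow_succ]
      cases b
      · rw [List.count_cons_of_ne (by simp), ← ih, hwf]
        field_simp
      · rw [List.count_cons_self, mul_add, pow_add, ← ih, hwt]
        ring
  have key : (law maj G true).toReal ≤ 1 * z ^ G.length := by
    rw [toReal_law]
    refine ev_le_weight (w := w) (fun b => by cases b <;> simp [w, hs0.le]) G (fun μ hμ => ?_)
      (fun l => by split_ifs <;> simp) zero_le_one fun l _ => ?_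
    · have h1 := hG μ hμ
      rw [ev_sgn] at h1
      have h2 := bool_add μ
      -- As the weight of `true` is the larger one, the mean weight increases with the error
      -- probability, so bias exactly α is the worst case.
      have h3 : s⁻¹ ≤ s := (inv_le_one_of_one_le₀ hs).trans hs
      rw [ev_bool]
      simp only [w, z, Bool.false_eq_true, if_false, if_true]
      have e : (μ false).toReal = 1 - (μ true).toReal := by linarith
      rw [e]
      nlinarith
    · have h0 : 0 ≤ (l.map w).prod := List.prod_nonneg fun x hx => by
        obtain ⟨b, _, rfl⟩ := List.mem_map.1 hx
        cases b <;> simp [w, hs0.le]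
      split_ifs with hm
      -- At least half of the bits are true, so the product of the weights is at least 1.
      · have h1 := pow_le_pow_right₀ hs (length_le_of_maj hm)
        rw [← hprod] at h1
        have h2 : 0 < s ^ l.length := by positivity
        rw [one_mul]
        by_contra hlt
        push Not at hlt
        nlinarith
      · linarith
  rw [one_mul] at key
  calc _ ≤ (z ^ G.length) ^ 2 := pow_le_pow_left₀ ENNReal.toReal_nonneg key 2
    _ = _ := by rw [← hz, ← pow_mul, ← pow_mul, mul_comm]

/-- A wrong majority requires a pair of wrong bits, and there are three pairs. -/
theorem maj_three_error_le {p : ℝ} (G : List (PMF Bool)) (hlen : G.length = 3)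
    (hG : ∀ μ ∈ G, (μ true).toReal ≤ p) : (law maj G true).toReal ≤ 3 * p ^ 2 := by
  obtain ⟨μ, ν, ξ, rfl⟩ := List.length_eq_three.1 hlen
  have hbd : ∀ l : List Bool, |(if maj l then (1 : ℝ) else 0)| ≤ 1 := fun l => by
    split_ifs <;> simp
  have hev : ∀ f : List Bool → ℝ, (∀ l, |f l| ≤ 1) → ev (seqL [μ, ν, ξ]) f =
      ev μ fun a => ev ν fun b => ev ξ fun c => f [a, b, c] := by
    intro f hf
    rw [ev_seqL_cons _ _ hf]
    congr 1; funext a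
    rw [ev_seqL_cons _ _ fun l => hf _]
    congr 1; funext b
    rw [ev_seqL_cons _ _ fun l => hf _]
    simp only [seqL, ev_pure]
  rw [toReal_law, hev _ hbd]
  simp only [ev_bool]
  have a1 := hG μ (by simp)
  have a2 := hG ν (by simp)
  have a3 := hG ξ (by simp)
  have n1 : (0 : ℝ) ≤ (μ true).toReal := ENNReal.toReal_nonneg
  have n2 : (0 : ℝ) ≤ (ν true).toReal := ENNReal.toReal_nonneg
  have n3 : (0 : ℝ) ≤ (ξ true).toReal := ENNReal.toReal_nonneg
  have b1 := bool_add μ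
  have b2 := bool_add ν
  have b3 := bool_add ξ
  have e1 : (μ false).toReal = 1 - (μ true).toReal := by linarith
  have e2 : (ν false).toReal = 1 - (ν true).toReal := by linarith
  have e3 : (ξ false).toReal = 1 - (ξ true).toReal := by linarith
  have m1 : maj [false, false, false] = false := rfl
  have m2 : maj [false, false, true] = false := rfl
  have m3 : maj [false, true, false] = false := rfl
  have m4 : maj [false, true, true] = true := rfl
  have m5 : maj [true, false, false] = false := rfl
  have m6 : maj [true, false, true] = true := rfl
  have m7 : maj [true, true, false] = true := rfl
  have m8 : maj [true, true, true] = true := rfl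
  simp only [m1, m2, m3, m4, m5, m6, m7, m8, if_true, Bool.false_eq_true, if_false]
  have h12 := mul_le_mul a1 a2 n2 (n1.trans a1)
  have h13 := mul_le_mul a1 a3 n3 (n1.trans a1)
  have h23 := mul_le_mul a2 a3 n3 (n2.trans a2)
  have h123 : 0 ≤ (μ true).toReal * (ν true).toReal * (ξ true).toReal := by positivity
  rw [e1, e2, e3]
  nlinarith

/-! ## Combining the entries of lists -/

section Combine

variable {X Y : Type}

/-- The list `l`, cut into blocks of length `r`. -/
def chunks (r : ℕ) (l : List X) : List (List X) := blocks r (l.length / r) l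

theorem length_blocks (r m : ℕ) (l : List X) : (blocks r m l).length = m := by
  induction m generalizing l with
  | zero => rfl
  | succ m ih => simp [blocks, ih]

@[simp] theorem length_chunks (r : ℕ) (l : List X) : (chunks r l).length = l.length / r :=
  length_blocks _ _ _

theorem blocks_map (φ : X → Y) (r m : ℕ) (l : List X) :
    blocks r m (l.map φ) = (blocks r m l).map (List.map φ) := by
  induction m generalizing l with
  | zero => rfl
  | succ m ih => simp [blocks, List.map_take, ← ih, List.map_drop]

theorem chunks_map (φ : X → Y) (r : ℕ) (l : List X) :
    chunks r (l.map φ) = (chunks r l).map (List.map φ) := by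
  rw [chunks, List.length_map, blocks_map, chunks]

theorem mem_blocks {r m : ℕ} {l G : List X} (hm : m * r ≤ l.length) (h : G ∈ blocks r m l) :
    G.length = r ∧ G ⊆ l := by
  induction m generalizing l with
  | zero => simp [blocks] at h
  | succ m ih =>
    rw [add_one_mul] at hm
    rcases List.mem_cons.1 h with rfl | h
    · exact ⟨by simp; omega, List.take_subset _ _⟩
    · have := ih (by simp; omega) h
      exact ⟨this.1, fun x hx => List.drop_subset _ _ (this.2 hx)⟩

theorem mem_chunks {r : ℕ} {l G : List X} (h : G ∈ chunks r l) : G.length = r ∧ G ⊆ l :=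
  mem_blocks (Nat.div_mul_le_self _ _) h

theorem flatten_blocks {r m : ℕ} {l : List X} (h : l.length = m * r) :
    (blocks r m l).flatten = l := by
  induction m generalizing l with
  | zero => simpa [blocks, eq_comm] using h
  | succ m ih =>
    rw [blocks, List.flatten_cons, ih (by simp [h, add_one_mul]), List.take_append_drop]

theorem flatten_chunks {r : ℕ} {l : List X} (h : r ∣ l.length) : (chunks r l).flatten = l :=
  flatten_blocks (Nat.div_mul_cancel h).symm

theorem chunks_flatten {r : ℕ} (hr : 0 < r) (L : List (List X)) (h : ∀ G ∈ L, G.length = r) :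
    chunks r L.flatten = L := by
  have hlen : L.flatten.length = L.length * r := by
    induction L with
    | nil => simp
    | cons G L ih =>
      rw [List.flatten_cons, List.length_append, ih fun G hG => h G (List.mem_cons_of_mem _ hG),
        h G List.mem_cons_self, List.length_cons]
      ring
  rw [chunks, hlen, Nat.mul_div_cancel _ hr]
  clear hlen
  induction L with
  | nil => rfl
  | cons G L ih =>
    have hG := h G List.mem_cons_self
    rw [List.length_cons, blocks, List.flatten_cons, ← hG, List.take_left, List.drop_left, hG,
      ih fun G hG => h G (List.mem_cons_of_mem _ hG)]

/-- Combine blocks of length `rs.1` by `f`, then blocks of length `rs.2` of the results by `g`. -/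
def combine (f g : List X → X) (rs : ℕ × ℕ) (l : List X) : List X :=
  (chunks rs.2 ((chunks rs.1 l).map f)).map g

def combines (f g : List X → X) (lv : List (ℕ × ℕ)) (l : List X) : List X :=
  lv.foldl (fun l rs => combine f g rs l) l

@[simp] theorem combines_nil (f g : List X → X) (l : List X) : combines f g [] l = l := rfl

@[simp] theorem combines_cons (f g : List X → X) (rs : ℕ × ℕ) (lv : List (ℕ × ℕ)) (l : List X) :
    combines f g (rs :: lv) l = combines f g lv (combine f g rs l) := rfl

@[simp] theorem length_combine (f g : List X → X) (rs : ℕ × ℕ) (l : List X) :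
    (combine f g rs l).length = l.length / rs.1 / rs.2 := by
  simp [combine]

/-- The number of inputs of the steps `lv`, if they have one output. -/
def lvSize (lv : List (ℕ × ℕ)) : ℕ := (lv.map fun rs => rs.1 * rs.2).prod

/-- The lengths of all blocks are positive. -/
def LvPos (lv : List (ℕ × ℕ)) : Prop := ∀ rs ∈ lv, 0 < rs.1 ∧ 0 < rs.2

theorem length_combine_of {f g : List X → X} {rs : ℕ × ℕ} {lv : List (ℕ × ℕ)} {l : List X}
    (hlv : LvPos (rs :: lv)) (hl : l.length = lvSize (rs :: lv)) :
    (combine f g rs l).length = lvSize lv := by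
  obtain ⟨h1, h2⟩ := hlv rs List.mem_cons_self
  rw [length_combine, hl, lvSize, List.map_cons, List.prod_cons, Nat.div_div_eq_div_mul,
    Nat.mul_div_cancel_left _ (Nat.mul_pos h1 h2), lvSize]

theorem dvd_of_length {rs : ℕ × ℕ} {lv : List (ℕ × ℕ)} {l : List X} (hlv : LvPos (rs :: lv))
    (hl : l.length = lvSize (rs :: lv)) : rs.1 ∣ l.length ∧ rs.2 ∣ l.length / rs.1 := by
  obtain ⟨h1, h2⟩ := hlv rs List.mem_cons_self
  have e : l.length = rs.1 * (rs.2 * lvSize lv) := by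
    rw [hl, lvSize, List.map_cons, List.prod_cons, lvSize, mul_assoc]
  refine ⟨⟨_, e⟩, ?_⟩
  rw [e, Nat.mul_div_cancel_left _ h1]
  exact dvd_mul_right _ _

theorem length_combines {f g : List X → X} {lv : List (ℕ × ℕ)} {l : List X} (hlv : LvPos lv)
    (hl : l.length = lvSize lv) : (combines f g lv l).length = 1 := by
  induction lv generalizing l with
  | nil => simpa [lvSize] using hl
  | cons rs lv ih =>
    exact ih (fun x hx => hlv x (List.mem_cons_of_mem _ hx)) (length_combine_of hlv hl)

/-- Naturality. It lets one tree of richer nodes project to the sender's pairs, to the error bits,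
or to what the receiver knows. The map g is a majority or a head, for which the empty block has to
be excluded. -/
theorem combine_map {f g : List X → X} {f' g' : List Y → Y} {φ : Y → X}
    (hf : ∀ G, f (G.map φ) = φ (f' G)) (hg : ∀ G, G ≠ [] → g (G.map φ) = φ (g' G))
    {rs : ℕ × ℕ} (hrs : 0 < rs.2) (l : List Y) :
    combine f g rs (l.map φ) = (combine f' g' rs l).map φ := by
  have e : f ∘ List.map φ = φ ∘ f' := funext hf
  unfold combine
  have e1 : (chunks rs.1 (l.map φ)).map f = ((chunks rs.1 l).map f').map φ := by
    rw [chunks_map, List.map_map, e, ← List.map_map]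
  rw [e1, chunks_map, List.map_map, List.map_map]
  refine List.map_congr_left fun G hG => hg G fun h => ?_
  have := (mem_chunks hG).1
  simp [h] at this
  omega

theorem combines_map {f g : List X → X} {f' g' : List Y → Y} {φ : Y → X}
    (hf : ∀ G, f (G.map φ) = φ (f' G)) (hg : ∀ G, G ≠ [] → g (G.map φ) = φ (g' G))
    {lv : List (ℕ × ℕ)} (hlv : LvPos lv) (l : List Y) :
    combines f g lv (l.map φ) = (combines f' g' lv l).map φ := by
  induction lv generalizing l with
  | nil => rfl
  | cons rs lv ih =>
    rw [combines_cons, combines_cons, combine_map hf hg (hlv rs List.mem_cons_self).2,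
      ih fun x hx => hlv x (List.mem_cons_of_mem _ hx)]

theorem seqL_chunks (f : List X → Y) {r : ℕ} {μs : List (PMF X)} (h : r ∣ μs.length) :
    (seqL μs).map (fun l => (chunks r l).map f) = seqL ((chunks r μs).map (law f)) := by
  have e := seqL_blocks f r (μs.length / r) μs (Nat.div_mul_cancel h).symm
  rw [chunks]
  unfold law
  rw [← e, PMF.map, PMF.map]
  refine bind_congr_support _ fun l hl => ?_
  simp only [Function.comp, chunks, length_of_mem_support hl]

/-- The nodes of one level depend on disjoint sets of inputs, so they stay independent, and their
laws are computed by the same tree over laws. -/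
theorem seqL_combines (f g : List X → X) {lv : List (ℕ × ℕ)} (hlv : LvPos lv) {μs : List (PMF X)}
    (h : μs.length = lvSize lv) :
    (seqL μs).map (combines f g lv) = seqL (combines (law f) (law g) lv μs) := by
  induction lv generalizing μs with
  | nil => exact PMF.map_id _
  | cons rs lv ih =>
    have e : combines f g (rs :: lv) = combines f g lv ∘
        (fun l => (chunks rs.2 l).map g) ∘ fun l => (chunks rs.1 l).map f := rfl
    obtain ⟨h1, h2⟩ := dvd_of_length hlv h
    rw [e, ← PMF.map_comp, ← PMF.map_comp, seqL_chunks f h1, seqL_chunks g (by simpa using h2),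
      combines_cons]
    exact ih (fun x hx => hlv x (List.mem_cons_of_mem _ hx)) (length_combine_of hlv h)

theorem forall_mem_combine {f g : List X → X} {rs : ℕ × ℕ} {l : List X} {P Q R : X → Prop}
    (hf : ∀ G : List X, G.length = rs.1 → (∀ x ∈ G, P x) → Q (f G))
    (hg : ∀ G : List X, G.length = rs.2 → (∀ x ∈ G, Q x) → R (g G)) (hl : ∀ x ∈ l, P x) :
    ∀ x ∈ combine f g rs l, R x := by
  intro x hx
  obtain ⟨G, hG, rfl⟩ := List.mem_map.1 hx
  refine hg G (mem_chunks hG).1 fun y hy => ?_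
  obtain ⟨G', hG', rfl⟩ := List.mem_map.1 ((mem_chunks hG).2 hy)
  exact hf G' (mem_chunks hG').1 fun z hz => hl z ((mem_chunks hG').2 hz)

end Combine

/-! ## The protocol on lists

Both players hold pairs `(h, v)`; the pairs of sender and receiver satisfy
`v_S ⊕ v_R = h_S h_R ⊕ e` with an error bit `e`. -/

/-- Componentwise exclusive or. -/
def xorPairs (l : List (Bool × Bool)) : Bool × Bool :=
  (xorAll (l.map Prod.fst), xorAll (l.map Prod.snd))

def headPair (l : List (Bool × Bool)) : Bool × Bool := l.headD (false, false)

/-- The differences of the entries to the first entry. -/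
def headDiffs (l : List (Bool × Bool)) : List (Bool × Bool) :=
  l.map fun x => (xor x.1 (headPair l).1, xor x.2 (headPair l).2)

/-- What the sender reveals at one level. -/
def levelMsg (rs : ℕ × ℕ) (l : List (Bool × Bool)) : List (Bool × Bool) :=
  ((chunks rs.2 ((chunks rs.1 l).map xorPairs)).map headDiffs).flatten

/-- What the sender reveals at all levels. -/
def sendMsg : List (ℕ × ℕ) → List (Bool × Bool) → List (Bool × Bool)
  | [], _ => []
  | rs :: lv, l => levelMsg rs l ++ sendMsg lv (combine xorPairs headPair rs l)

/-- The receiver, with choice bit `c`, uses the message of the sender for one level. -/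
def recvLevel (c : Bool) (st : List Bool × List (Bool × Bool)) (rs : ℕ × ℕ) :
    List Bool × List (Bool × Bool) :=
  let l := (chunks rs.1 st.1).map xorAll
  ((chunks rs.2 ((l.zip st.2).map fun p => xor p.1 (xor p.2.2 (c && p.2.1)))).map maj,
    st.2.drop l.length)

def recvRoot (c : Bool) (lv : List (ℕ × ℕ)) (l : List Bool) (msg : List (Bool × Bool)) : Bool :=
  (lv.foldl (recvLevel c) (l, msg)).1.headD false

/-- The message by which the receiver makes all choice bits equal. -/
def choiceDiffs (ys : List (Bool × Bool)) : List Bool := ys.map fun y => xor y.1 (headPair ys).1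

def align (xs : List (Bool × Bool)) (d : List Bool) : List (Bool × Bool) :=
  (xs.zip d).map fun p => (p.1.1, xor p.1.2 (p.1.1 && p.2))

def senderMsg (lv : List (ℕ × ℕ)) (xs : List (Bool × Bool)) (d : List Bool) :
    List (Bool × Bool) := sendMsg lv (align xs d)

def senderOut (lv : List (ℕ × ℕ)) (xs : List (Bool × Bool)) (d : List Bool) : Bool × Bool :=
  headPair (combines xorPairs headPair lv (align xs d))

def receiverOut (lv : List (ℕ × ℕ)) (ys msg : List (Bool × Bool)) : Bool × Bool :=
  ((headPair ys).1, recvRoot (headPair ys).1 lv (ys.map Prod.snd) msg)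

/-- The error bit of two pairs. -/
def errPair (x y : Bool × Bool) : Bool := xor (xor x.2 y.2) (x.1 && y.1)

/-- The error bit of the protocol, as a function of the error bits of the instances. -/
def errRoot (lv : List (ℕ × ℕ)) (es : List Bool) : Bool :=
  (combines xorAll maj lv es).headD false

theorem xorAll_map_xor {X : Type} (f g : X → Bool) (l : List X) :
    xorAll (l.map fun x => xor (f x) (g x)) = xor (xorAll (l.map f)) (xorAll (l.map g)) := by
  induction l with
  | nil => rfl
  | cons a l ih =>
    simp only [List.map_cons, xorAll_cons, ih]
    generalize xorAll (l.map f) = u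
    generalize xorAll (l.map g) = v
    cases f a <;> cases g a <;> cases u <;> cases v <;> rfl

theorem xorAll_map_and {X : Type} (c : Bool) (f : X → Bool) (l : List X) :
    xorAll (l.map fun x => c && f x) = (c && xorAll (l.map f)) := by
  induction l with
  | nil => simp
  | cons a l ih =>
    simp only [List.map_cons, xorAll_cons, ih]
    cases c <;> simp

/-! ### Correctness -/

/-- What the receiver has at a node where the sender has `p.1`, and the error bit is `p.2`. -/
def recvBit (c : Bool) (p : (Bool × Bool) × Bool) : Bool := xor (xor p.1.2 (c && p.1.1)) p.2

def xorNode (l : List ((Bool × Bool) × Bool)) : (Bool × Bool) × Bool :=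
  (xorPairs (l.map Prod.fst), xorAll (l.map Prod.snd))

def majNode (l : List ((Bool × Bool) × Bool)) : (Bool × Bool) × Bool :=
  (headPair (l.map Prod.fst), maj (l.map Prod.snd))

/-- The relation v ⊕ y = c h ⊕ e is linear once c is common to all entries. -/
theorem xorAll_map_recvBit (c : Bool) (l : List ((Bool × Bool) × Bool)) :
    xorAll (l.map (recvBit c)) = recvBit c (xorNode l) := by
  simp only [recvBit, xorNode, xorPairs, List.map_map]
  rw [← xorAll_map_and c, ← xorAll_map_xor, ← xorAll_map_xor]
  rfl

theorem zip_flatten {X Y : Type} (L : List (List X)) (f : List X → List Y)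
    (h : ∀ G, (f G).length = G.length) (rest : List Y) :
    L.flatten.zip ((L.map f).flatten ++ rest) = (L.map fun G => G.zip (f G)).flatten := by
  induction L with
  | nil => simp
  | cons G L ih =>
    simp only [List.map_cons, List.flatten_cons, List.append_assoc]
    rw [List.zip_append (h G).symm, ih]

/-- Adding the revealed difference turns the bit at entry i of a block into v ⊕ c h ⊕ eᵢ, where (h,
v) is the pair of the first entry. So the receiver takes the majority of copies of one bit,
disturbed by the error bits. Divisibility makes the message cover exactly the exclusive ors. -/
theorem recvLevel_eq (c : Bool) {rs : ℕ × ℕ} (hrs : 0 < rs.2) (l : List ((Bool × Bool) × Bool))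
    (h2 : rs.2 ∣ l.length / rs.1) (rest : List (Bool × Bool)) :
    recvLevel c (l.map (recvBit c), levelMsg rs (l.map Prod.fst) ++ rest) rs =
      ((combine xorNode majNode rs l).map (recvBit c), rest) := by
  set C := chunks rs.2 ((chunks rs.1 l).map xorNode) with hC
  have hl1 : C.flatten = (chunks rs.1 l).map xorNode := flatten_chunks (by simpa using h2)
  have e1 : (chunks rs.1 (l.map (recvBit c))).map xorAll = C.flatten.map (recvBit c) := by
    rw [hl1, chunks_map, List.map_map, List.map_map]
    exact List.map_congr_left fun G _ => xorAll_map_recvBit c G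
  have e2 : levelMsg rs (l.map Prod.fst) =
      (C.map fun G => headDiffs (G.map Prod.fst)).flatten := by
    have : (chunks rs.1 (l.map Prod.fst)).map xorPairs =
        ((chunks rs.1 l).map xorNode).map Prod.fst := by
      rw [chunks_map, List.map_map, List.map_map]; rfl
    rw [levelMsg, this, chunks_map, List.map_map]
    rfl
  have e3 : (levelMsg rs (l.map Prod.fst)).length = (C.flatten.map (recvBit c)).length := by
    rw [e2]
    simp only [List.length_flatten, List.map_map, List.length_map]
    congr 1
    exact List.map_congr_left fun G _ => by simp [headDiffs]
  have e4 : (C.flatten.map (recvBit c)).zip (levelMsg rs (l.map Prod.fst) ++ rest) =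
      ((C.map fun G => G.zip (headDiffs (G.map Prod.fst))).flatten).map
        (Prod.map (recvBit c) id) := by
    rw [← zip_flatten C (fun G => headDiffs (G.map Prod.fst)) (by simp [headDiffs]), ← e2,
      List.zip_map_left]
  simp only [recvLevel]
  rw [e1, e4, ← e3, List.drop_left]
  refine Prod.ext ?_ rfl
  simp only [List.map_map, List.map_flatten]
  rw [chunks_flatten hrs, combine, ← hC, List.map_map, List.map_map]
  · refine List.map_congr_left fun G hG => ?_
    have hne : G ≠ [] := fun h => by
      have := (mem_chunks hG).1; simp [h] at this; omega
    have hz : G.zip (headDiffs (G.map Prod.fst)) = G.map fun x => (x,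
        (xor x.1.1 (headPair (G.map Prod.fst)).1, xor x.1.2 (headPair (G.map Prod.fst)).2)) := by
      rw [headDiffs, List.map_map]
      have : G.zip (G.map fun x : (Bool × Bool) × Bool =>
          (xor x.1.1 (headPair (G.map Prod.fst)).1, xor x.1.2 (headPair (G.map Prod.fst)).2)) =
          (G.map id).zip (G.map fun x : (Bool × Bool) × Bool =>
          (xor x.1.1 (headPair (G.map Prod.fst)).1, xor x.1.2 (headPair (G.map Prod.fst)).2)) := by
        simp
      refine this.trans ?_
      rw [List.zip_map']
      rfl
    simp only [Function.comp_apply]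
    rw [hz, List.map_map]
    simp only [majNode]
    generalize headPair (G.map Prod.fst) = p
    have : recvBit c (p, maj (G.map Prod.snd)) =
        xor (xor p.2 (c && p.1)) (maj (G.map Prod.snd)) := rfl
    -- The common value v ⊕ c h is moved out of the majority by equivariance.
    rw [this, ← maj_map_xor _ (by simpa using hne), List.map_map, List.map_map]
    congr 1
    refine List.map_congr_left fun x _ => ?_
    obtain ⟨⟨a, b⟩, e⟩ := x
    obtain ⟨a', b'⟩ := p
    simp only [Function.comp_apply, Prod.map, recvBit, id]
    cases a <;> cases b <;> cases e <;> cases a' <;> cases b' <;> cases c <;> rfl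
  · intro G' hG'
    obtain ⟨G, hG, rfl⟩ := List.mem_map.1 hG'
    simp [headDiffs, (mem_chunks hG).1]

theorem recv_foldl_eq (c : Bool) {lv : List (ℕ × ℕ)} (hlv : LvPos lv)
    (l : List ((Bool × Bool) × Bool)) (hl : l.length = lvSize lv) (rest : List (Bool × Bool)) :
    lv.foldl (recvLevel c) (l.map (recvBit c), sendMsg lv (l.map Prod.fst) ++ rest) =
      ((combines xorNode majNode lv l).map (recvBit c), rest) := by
  induction lv generalizing l with
  | nil => rfl
  | cons rs lv ih =>
    obtain ⟨h1, h2⟩ := dvd_of_length hlv hl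
    have hrs := (hlv rs List.mem_cons_self).2
    have e : combine xorPairs headPair rs (l.map Prod.fst) =
        (combine xorNode majNode rs l).map Prod.fst :=
      combine_map (φ := Prod.fst) (f' := xorNode) (g' := majNode) (fun _ => rfl) (fun _ _ => rfl)
        hrs l
    rw [List.foldl_cons, sendMsg, List.append_assoc, recvLevel_eq c hrs l h2, e,
      ih (fun x hx => hlv x (List.mem_cons_of_mem _ hx)) _ (length_combine_of hlv hl), combines_cons]

/-- The instances' pairs, with the sender's pair aligned and the error bit. -/
def alignedNode (c : Bool) (p : (Bool × Bool) × (Bool × Bool)) : (Bool × Bool) × Bool :=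
  ((p.1.1, xor p.1.2 (p.1.1 && xor p.2.1 c)), errPair p.1 p.2)

theorem align_eq (l : List ((Bool × Bool) × (Bool × Bool))) :
    align (l.map Prod.fst) (choiceDiffs (l.map Prod.snd)) =
      l.map fun p => (alignedNode (headPair (l.map Prod.snd)).1 p).1 := by
  rw [align, choiceDiffs, List.map_map, List.zip_map', List.map_map]
  rfl

/-- After alignment all instances have the choice bit c and unchanged error bits, so the error bits
run through the tree on their own. The error of the protocol is therefore a function of the errors
of the instances. -/
theorem protocol_correct {lv : List (ℕ × ℕ)} (hlv : LvPos lv)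
    (l : List ((Bool × Bool) × (Bool × Bool))) (hl : l.length = lvSize lv) :
    errPair (senderOut lv (l.map Prod.fst) (choiceDiffs (l.map Prod.snd)))
      (receiverOut lv (l.map Prod.snd)
        (senderMsg lv (l.map Prod.fst) (choiceDiffs (l.map Prod.snd)))) =
    errRoot lv (l.map fun p => errPair p.1 p.2) := by
  set c := (headPair (l.map Prod.snd)).1 with hc
  have e1 : align (l.map Prod.fst) (choiceDiffs (l.map Prod.snd)) =
      (l.map (alignedNode c)).map Prod.fst := by
    rw [align_eq, List.map_map]; rfl
  have e2 : (l.map Prod.snd).map Prod.snd = (l.map (alignedNode c)).map (recvBit c) := by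
    rw [List.map_map, List.map_map]
    refine List.map_congr_left fun p _ => ?_
    obtain ⟨⟨a, b⟩, a', b'⟩ := p
    simp only [Function.comp_apply, alignedNode, recvBit, errPair]
    generalize c = c
    cases a <;> cases b <;> cases a' <;> cases b' <;> cases c <;> rfl
  have e3 : (l.map fun p => errPair p.1 p.2) = (l.map (alignedNode c)).map Prod.snd := by
    rw [List.map_map]; rfl
  rw [senderOut, receiverOut, recvRoot, senderMsg, e1, e2, e3, errRoot, ← hc]
  have h := recv_foldl_eq c hlv (l.map (alignedNode c)) (by simpa using hl) []
  rw [List.append_nil] at h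
  rw [h, combines_map (φ := Prod.fst) (f' := xorNode) (g' := majNode) (fun _ => rfl)
    (fun _ _ => rfl) hlv, combines_map (φ := Prod.snd) (f := xorAll) (g := maj) (f' := xorNode) (g' := majNode)
    (fun _ => rfl) (fun _ _ => rfl) hlv]
  have h1 := length_combines (f := xorNode) (g := majNode) hlv
    (l := l.map (alignedNode c)) (by simpa using hl)
  obtain ⟨x, hx⟩ := List.length_eq_one_iff.1 h1
  rw [hx]
  obtain ⟨⟨a, b⟩, e⟩ := x
  simp only [List.map_cons, List.map_nil, headPair, List.headD_cons, recvBit, errPair]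
  cases a <;> cases b <;> cases e <;> cases c <;> rfl

theorem seqL_map {X Y : Type} (f : X → Y) (μs : List (PMF X)) :
    (seqL μs).map (List.map f) = seqL (μs.map fun μ => μ.map f) := by
  induction μs with
  | nil => simp [seqL, PMF.pure_map]
  | cons μ μs ih =>
    simp only [seqL, List.map_cons, PMF.map_bind, PMF.bind_map, Function.comp_def, ← ih,
      PMF.map_comp]

/-! ## Security against the receiver -/

/-- What a corrupted receiver knows about a node: his data about the inputs, the revealed
differences, and the bit `k` such that the sender's pair is `(s, k ⊕ c s)`, where `s` is secret. -/
inductive Info (V : Type) : Type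
  | leaf (v : V) (k : Bool) : Info V
  | node (children : List (Info V)) (diffs : List Bool) (k : Bool) : Info V

namespace Info

variable {V : Type}

def k : Info V → Bool
  | leaf _ k => k
  | node _ _ k => k

def children : Info V → List (Info V)
  | leaf _ _ => []
  | node l _ _ => l

def diffs : Info V → List Bool
  | leaf _ _ => []
  | node _ d _ => d

def data? : Info V → Option V
  | leaf v _ => some v
  | node _ _ _ => none

end Info

section ReceiverSecurity

variable {V : Type}

/-- An exclusive or reveals nothing, hence the empty list of differences; the bits k add up. -/
def xorInfo (l : List (Bool × Info V)) : Bool × Info V :=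
  (xorAll (l.map Prod.fst), .node (l.map Prod.snd) [] (xorAll (l.map fun x => x.2.k)))

def headInfo (l : List (Bool × Info V)) : Bool × Info V := l.headD (false, .node [] [] false)

/-- Only the differences of the secrets are recorded: the revealed second components follow from
them, from the bits k and from c. -/
def majInfo (l : List (Bool × Info V)) : Bool × Info V :=
  ((headInfo l).1, .node (l.map Prod.snd) (l.map fun x => xor x.1 (headInfo l).1) (headInfo l).2.k)

theorem advLe_xorInfo {q : ℝ} (hq : 0 ≤ q) (G : List (PMF (Bool × Info V)))
    (hG : ∀ μ ∈ G, AdvLe μ q) : AdvLe (law xorInfo G) (q ^ G.length) := by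
  refine AdvLe.map_iff.2 fun g hg => ?_
  have h := ev_xor_le hq G hG
    (fun infos => g (.node infos [] (xorAll (infos.map Info.k)))) fun l => hg _
  simp only [List.map_map] at h
  exact (le_abs_self _).trans h

/-- Flipping all secrets of the block flips the secret of the node and leaves the recorded
information unchanged, so `ev_odd_le` applies. -/
theorem advLe_majInfo {q : ℝ} (G : List (PMF (Bool × Info V))) (h0 : G ≠ [])
    (hG : ∀ μ ∈ G, AdvLe μ q) : AdvLe (law majInfo G) (G.length * q) := by
  refine AdvLe.map_iff.2 fun g hg => ?_
  refine ev_odd_le G hG _ (fun l => by rw [abs_sgn_mul]; exact hg _) fun l hl => ?_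
  obtain ⟨⟨b, i⟩, l', rfl⟩ : ∃ x l', l = x :: l' := List.exists_cons_of_ne_nil fun h => h0 (by
    rw [h] at hl; exact List.length_eq_zero_iff.1 hl.symm)
  have e : (majInfo (((b, i) :: l').map flipBit)).2 = (majInfo ((b, i) :: l')).2 := by
    simp only [majInfo, headInfo, List.map_map, List.map_cons, List.headD_cons, flipBit]
    congr 2
    · simp
    · refine List.map_congr_left fun x _ => ?_
      simp [flipBit]
  rw [e]
  simp [majInfo, headInfo, flipBit, sgn_not]

/-- The bound on the receiver's advantage after the levels `lv`. -/
def advBound (lv : List (ℕ × ℕ)) (q : ℝ) : ℝ := lv.foldl (fun q rs => rs.2 * q ^ rs.1) q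

theorem advLe_combines {lv : List (ℕ × ℕ)} (hlv : LvPos lv) {q : ℝ} (hq : 0 ≤ q)
    {μs : List (PMF (Bool × Info V))} (hμ : ∀ μ ∈ μs, AdvLe μ q) :
    ∀ μ ∈ combines (law xorInfo) (law majInfo) lv μs, AdvLe μ (advBound lv q) := by
  induction lv generalizing μs q with
  | nil => exact hμ
  | cons rs lv ih =>
    obtain ⟨h1, h2⟩ := hlv rs List.mem_cons_self
    refine ih (fun x hx => hlv x (List.mem_cons_of_mem _ hx)) (by positivity) ?_
    exact forall_mem_combine (P := fun μ => AdvLe μ q) (Q := fun μ => AdvLe μ (q ^ rs.1))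
      (fun G hG hP => hG ▸ advLe_xorInfo hq G hP)
      (fun G hG hP => by
        have h := advLe_majInfo G (fun h => by simp [h] at hG; omega) hP
        rwa [hG] at h) hμ

/-- The sender's pair. -/
def senderPair (c : Bool) (x : Bool × Info V) : Bool × Bool := (x.1, xor x.2.k (c && x.1))

theorem xorPairs_map_senderPair (c : Bool) (l : List (Bool × Info V)) :
    xorPairs (l.map (senderPair c)) = senderPair c (xorInfo l) := by
  simp only [xorPairs, senderPair, xorInfo, List.map_map, Info.k]
  refine Prod.ext rfl ?_
  simp only
  rw [← xorAll_map_and c, ← xorAll_map_xor]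
  rfl

theorem headPair_map_senderPair (c : Bool) {l : List (Bool × Info V)} (hl : l ≠ []) :
    headPair (l.map (senderPair c)) = senderPair c (majInfo l) := by
  obtain ⟨x, l, rfl⟩ := List.exists_cons_of_ne_nil hl
  rfl

/-- The information of a node contains that of its children; each level is undone by descending
twice, through the majority and through the exclusive or. -/
theorem exists_infos {lv : List (ℕ × ℕ)} (hlv : LvPos lv) :
    ∃ Θ : List (Info V) → List (Info V), ∀ l : List (Bool × Info V), l.length = lvSize lv →
      Θ ((combines xorInfo majInfo lv l).map Prod.snd) = l.map Prod.snd := by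
  induction lv with
  | nil => exact ⟨id, fun l _ => rfl⟩
  | cons rs lv ih =>
    obtain ⟨Θ, hΘ⟩ := ih fun x hx => hlv x (List.mem_cons_of_mem _ hx)
    refine ⟨fun I => ((Θ I).flatMap Info.children).flatMap Info.children, fun l hl => ?_⟩
    obtain ⟨h1, h2⟩ := dvd_of_length hlv hl
    rw [combines_cons]
    simp only
    rw [hΘ _ (length_combine_of hlv hl)]
    have e1 : ((combine xorInfo majInfo rs l).map Prod.snd).flatMap Info.children =
        ((chunks rs.1 l).map xorInfo).map Prod.snd := by
      rw [combine, List.map_map, List.flatMap_map]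
      conv_rhs => rw [← flatten_chunks (l := (chunks rs.1 l).map xorInfo) (r := rs.2)
        (by simpa using h2), List.map_flatten]
      rfl
    have e2 : (((chunks rs.1 l).map xorInfo).map Prod.snd).flatMap Info.children =
        l.map Prod.snd := by
      rw [List.map_map, List.flatMap_map]
      conv_rhs => rw [← flatten_chunks h1, List.map_flatten]
      rfl
    rw [e1, e2]

/-- This justifies that messages need not be stored in the nodes: they can be recomputed from the
information at the root and the common choice bit. -/
theorem exists_sendMsg {lv : List (ℕ × ℕ)} (hlv : LvPos lv) :
    ∃ Ψ : Bool → List (Info V) → List (Bool × Bool), ∀ c, ∀ l : List (Bool × Info V),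
      l.length = lvSize lv →
      Ψ c ((combines xorInfo majInfo lv l).map Prod.snd) = sendMsg lv (l.map (senderPair c)) := by
  induction lv with
  | nil => exact ⟨fun _ _ => [], fun c l _ => rfl⟩
  | cons rs lv ih =>
    have hlv' : LvPos lv := fun x hx => hlv x (List.mem_cons_of_mem _ hx)
    obtain ⟨Ψ, hΨ⟩ := ih hlv'
    obtain ⟨Θ, hΘ⟩ := exists_infos (V := V) hlv'
    -- With pairs (s, k ⊕ c s), a difference d of secrets comes with the difference of the bits k,
    -- plus c d. The bit k of a majority node is that of its first child.
    let D : Bool → Info V → List (Bool × Bool) := fun c i =>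
      (i.diffs.zip i.children).map fun p => (p.1, xor (xor p.2.k i.k) (c && p.1))
    refine ⟨fun c I => (Θ I).flatMap (D c) ++ Ψ c I, fun c l hl => ?_⟩
    obtain ⟨h1, h2⟩ := dvd_of_length hlv hl
    have hrs := (hlv rs List.mem_cons_self).2
    rw [combines_cons]
    simp only
    rw [hΘ _ (length_combine_of hlv hl), hΨ _ _ (length_combine_of hlv hl), sendMsg,
      combine_map (φ := senderPair c) (f' := xorInfo) (g' := majInfo)
        (xorPairs_map_senderPair c) (fun _ => headPair_map_senderPair c) hrs]
    congr 1
    have e : (chunks rs.1 (l.map (senderPair c))).map xorPairs =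
        ((chunks rs.1 l).map xorInfo).map (senderPair c) := by
      rw [chunks_map, List.map_map, List.map_map]
      exact List.map_congr_left fun G _ => xorPairs_map_senderPair c G
    rw [levelMsg, e, chunks_map, List.map_map, combine, List.map_map, List.flatMap_map,
      List.flatMap_def]
    congr 1
    refine List.map_congr_left fun G hG => ?_
    have hne : G ≠ [] := fun h => by
      have := (mem_chunks hG).1; simp [h] at this; omega
    simp only [Function.comp_apply, headDiffs, headPair_map_senderPair c hne, D, majInfo,
      Info.diffs, Info.children, List.map_map]
    rw [List.zip_map', List.map_map]
    refine List.map_congr_left fun x _ => ?_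
    generalize headInfo G = y
    obtain ⟨a, i⟩ := x
    obtain ⟨b, j⟩ := y
    simp only [Function.comp_apply, senderPair]
    have e : ∀ (l : List (Info V)) d, (Info.node l d j.k).k = j.k := fun _ _ => rfl
    rw [e]
    generalize i.k = u
    generalize j.k = v
    cases a <;> cases b <;> cases c <;> cases u <;> cases v <;> rfl

/-- What the instances give to the players, and what they give in addition to the corrupted
player. -/
abbrev Record (W : Type) := (Bool × Bool) × (Bool × Bool) × W

/-- The secret of the sender and the data of the corrupted receiver. -/
def forReceiver (w : Record V) : Bool × (((Bool × Bool) × V) × Bool) :=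
  (w.1.1, (w.2, errPair w.1 w.2.1))

/-- The corrupted receiver's view, including the final error bit, is a function of the information
at the root, so the bound for the law of the root applies. -/
theorem receiver_secure {lv : List (ℕ × ℕ)} (hlv : LvPos lv) {q : ℝ} (hq : 0 ≤ q)
    {μs : List (PMF (Record V))} (hlen : μs.length = lvSize lv)
    (hμ : ∀ μ ∈ μs, AdvLe (μ.map forReceiver) q)
    (g : List ((Bool × Bool) × V) → List (Bool × Bool) → Bool → ℝ) (hg : ∀ a b c, |g a b c| ≤ 1) :
    (ev (seqL μs) fun l =>
      sgn (senderOut lv (l.map Prod.fst) (choiceDiffs (l.map fun w => w.2.1))).1 *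
        g (l.map Prod.snd)
          (senderMsg lv (l.map Prod.fst) (choiceDiffs (l.map fun w => w.2.1)))
          (errRoot lv (l.map fun w => errPair w.1 w.2.1))) ≤ advBound lv q := by
  obtain ⟨Θ, hΘ⟩ := exists_infos (V := ((Bool × Bool) × V) × Bool) hlv
  obtain ⟨Ψ, hΨ⟩ := exists_sendMsg (V := ((Bool × Bool) × V) × Bool) hlv
  -- Alignment gives v ⊕ h (cᵢ ⊕ c) = (yᵢ ⊕ eᵢ) ⊕ c h, so k = yᵢ ⊕ eᵢ. It does not depend on c, and
  -- it is a function of the data in `AdvLe`, since these include the error bit.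
  let toX : Record V → Bool × Info (((Bool × Bool) × V) × Bool) := fun w =>
    (w.1.1, .leaf (w.2, errPair w.1 w.2.1) (xor w.2.1.2 (errPair w.1 w.2.1)))
  let data : List (Info (((Bool × Bool) × V) × Bool)) → List (((Bool × Bool) × V) × Bool) :=
    fun I => (Θ I).filterMap Info.data?
  -- The common choice bit is read off the data of the first leaf.
  let G : List (Info (((Bool × Bool) × V) × Bool)) → ℝ := fun I =>
    g ((data I).map Prod.fst)
      (Ψ (headPair ((data I).map fun d => d.1.1)).1 I) (errRoot lv ((data I).map Prod.snd))
  let F : List (Bool × Info (((Bool × Bool) × V) × Bool)) → ℝ := fun L =>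
    sgn (headInfo L).1 * G (L.map Prod.snd)
  have hF : ∀ L, |F L| ≤ 1 := fun L => by rw [abs_sgn_mul]; exact hg _ _ _
  have key : ∀ l : List (Record V), l.length = lvSize lv →
      sgn (senderOut lv (l.map Prod.fst) (choiceDiffs (l.map fun w => w.2.1))).1 *
        g (l.map Prod.snd)
          (senderMsg lv (l.map Prod.fst) (choiceDiffs (l.map fun w => w.2.1)))
          (errRoot lv (l.map fun w => errPair w.1 w.2.1)) =
      F (combines xorInfo majInfo lv (l.map toX)) := by
    intro l hl
    have hl' : (l.map toX).length = lvSize lv := by simpa using hl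
    have hd : data ((combines xorInfo majInfo lv (l.map toX)).map Prod.snd) =
        l.map fun w => (w.2, errPair w.1 w.2.1) := by
      simp only [data]
      rw [hΘ _ hl', List.map_map, List.filterMap_map, ← List.filterMap_eq_map]
      rfl
    simp only [F, G, hd, hΨ _ _ hl', List.map_map]
    have hal : align (l.map Prod.fst) (choiceDiffs (l.map fun w => w.2.1)) =
        (l.map toX).map (senderPair (headPair (l.map fun w => w.2.1)).1) := by
      have := align_eq (l.map fun w => (w.1, w.2.1))
      rw [List.map_map, List.map_map, List.map_map] at this
      refine this.trans ?_
      rw [List.map_map]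
      refine List.map_congr_left fun w _ => ?_
      obtain ⟨⟨a, b⟩, ⟨a', b'⟩, v⟩ := w
      simp only [Function.comp_def, alignedNode, toX, senderPair, errPair, Info.k]
      generalize (headPair (l.map fun w => w.2.1)).1 = c
      cases a <;> cases b <;> cases a' <;> cases b' <;> cases c <;> rfl
    have hroot : (senderOut lv (l.map Prod.fst) (choiceDiffs (l.map fun w => w.2.1))).1 =
        (headInfo (combines xorInfo majInfo lv (l.map toX))).1 := by
      rw [senderOut, hal, combines_map (xorPairs_map_senderPair _)
        (fun _ => headPair_map_senderPair _) hlv]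
      obtain ⟨x, hx⟩ := List.length_eq_one_iff.1 (length_combines (f := xorInfo) (g := majInfo)
        hlv hl')
      rw [hx]; rfl
    rw [hroot, senderMsg, hal]
    simp only [List.map_map]
    rfl
  rw [ev_congr (seqL μs) fun l hl => key l ((length_of_mem_support hl).trans hlen)]
  rw [← ev_map (seqL μs) (fun l => combines xorInfo majInfo lv (l.map toX)) hF]
  have e : (fun l => combines xorInfo majInfo lv (l.map toX)) =
      combines xorInfo majInfo lv ∘ List.map toX := rfl
  rw [e, ← PMF.map_comp, seqL_map, seqL_combines _ _ hlv (by simpa using hlen)]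
  have hall := advLe_combines (μs := μs.map fun μ => μ.map toX) hlv hq (by
    intro ν hν
    obtain ⟨μ, hμ', rfl⟩ := List.mem_map.1 hν
    have h := hμ μ hμ'
    rw [AdvLe.map_iff] at h ⊢
    exact fun g hg => h (fun d => g (.leaf d (xor d.1.1.2 d.2))) fun _ => hg _)
  obtain ⟨ν, hν⟩ := List.length_eq_one_iff.1 (length_combines (f := law xorInfo)
    (g := law majInfo) hlv (l := μs.map fun μ => μ.map toX) (by simpa using hlen))
  rw [hν] at hall ⊢
  rw [ev_seqL_cons _ _ hF]
  simp only [seqL, ev_pure]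
  exact hall ν (by simp) (fun i => G [i]) fun _ => hg _ _ _

end ReceiverSecurity

/-! ## Security against the sender -/

/-- The choice bit of the receiver and the data of the corrupted sender. -/
def forSender {U : Type} (w : Record U) : Bool × (((Bool × Bool) × U) × Bool) :=
  (w.2.1.1, ((w.1, w.2.2), errPair w.1 w.2.1))

/-- Only the differences of the choice bits are sent. Flipping all choice bits, with data and error
bits fixed, preserves them and flips the output bit, so the advantage is at most n · 0. -/
theorem sender_secure {U : Type} (lv : List (ℕ × ℕ)) {μs : List (PMF (Record U))}
    (hne : μs ≠ []) (hμ : ∀ μ ∈ μs, AdvLe (μ.map forSender) 0)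
    (g : List ((Bool × Bool) × U) → List Bool → Bool → ℝ) (hg : ∀ a b c, |g a b c| ≤ 1) :
    (ev (seqL μs) fun l =>
      sgn (headPair (l.map fun w => w.2.1)).1 *
        g (l.map fun w => (w.1, w.2.2)) (choiceDiffs (l.map fun w => w.2.1))
          (errRoot lv (l.map fun w => errPair w.1 w.2.1))) ≤ 0 := by
  let H : List (Bool × (((Bool × Bool) × U) × Bool)) → ℝ := fun L =>
    sgn ((L.map Prod.fst).headD false) * g (L.map fun x => x.2.1)
      (L.map fun x => xor x.1 ((L.map Prod.fst).headD false)) (errRoot lv (L.map fun x => x.2.2))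
  have hH : ∀ L, |H L| ≤ 1 := fun L => by rw [abs_sgn_mul]; exact hg _ _ _
  have e : (fun l : List (Record U) => sgn (headPair (l.map fun w => w.2.1)).1 *
        g (l.map fun w => (w.1, w.2.2)) (choiceDiffs (l.map fun w => w.2.1))
          (errRoot lv (l.map fun w => errPair w.1 w.2.1))) = fun l => H (l.map forSender) := by
    funext l
    have h0 : (headPair (l.map fun w => w.2.1)).1 =
        (((l.map forSender).map Prod.fst).headD false) := by
      cases l <;> rfl
    simp only [H, choiceDiffs]
    rw [h0]
    simp only [List.map_map]
    rfl
  rw [e, ← ev_map (seqL μs) (List.map forSender) hH, seqL_map]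
  have h := ev_odd_le (μs.map fun μ => μ.map forSender) (q := 0) (by
    intro ν hν
    obtain ⟨μ, hμ', rfl⟩ := List.mem_map.1 hν
    exact hμ μ hμ') H hH (fun L hL => by
      obtain ⟨⟨b, x⟩, L, rfl⟩ : ∃ x L', L = x :: L' := List.exists_cons_of_ne_nil fun h => hne (by
        rw [h] at hL; exact List.length_eq_zero_iff.1 (by simpa using hL.symm))
      simp only [H, List.map_cons, List.headD_cons, List.map_map, flipBit, sgn_not,
        Function.comp_def, neg_mul]
      simp)
  simpa using h

/-! ## The error and the advantage over all levels -/

/-- One level which makes the players' problem well-conditioned, and `J` levels which amplify. -/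
def levels (l N J : ℕ) : List (ℕ × ℕ) := (l, N) :: List.replicate J (2, 3)

theorem lvPos_levels {l N : ℕ} (hl : 0 < l) (hN : 0 < N) (J : ℕ) : LvPos (levels l N J) := by
  intro rs h
  rcases List.mem_cons.1 h with rfl | h
  · exact ⟨hl, hN⟩
  · rw [(List.mem_replicate.1 h).2]; exact ⟨by norm_num, by norm_num⟩

theorem lvSize_levels (l N J : ℕ) : lvSize (levels l N J) = l * N * 6 ^ J := by
  simp [lvSize, levels]

/-- An error p / 12 becomes at most p / 6 after the exclusive or of two bits, and then at most 3 (p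
/ 6)² = p² / 12 after the majority of three. -/
theorem error_combine_le {p : ℝ} {μs : List (PMF Bool)} (hμ : ∀ μ ∈ μs, 12 * (μ true).toReal ≤ p)
    (hp : 0 ≤ p) (hp1 : p ≤ 1) :
    ∀ ν ∈ combine (law xorAll) (law maj) (2, 3) μs, 12 * (ν true).toReal ≤ p ^ 2 := by
  refine forall_mem_combine (P := fun μ => 12 * (μ true).toReal ≤ p)
    (Q := fun μ => (μ true).toReal ≤ p / 6) (fun G hG hP => ?_) (fun G hG hQ => ?_) hμ
  · have h := pow_le_ev_xor (α := 1 - p / 6) (by linarith) G fun μ hμ => by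
      rw [ev_sgn]; linarith [hP μ hμ]
    rw [ev_sgn, hG] at h
    nlinarith
  · have h := maj_three_error_le G hG hQ
    linarith

theorem error_combines_le (J : ℕ) {p : ℝ} {μs : List (PMF Bool)}
    (hμ : ∀ μ ∈ μs, 12 * (μ true).toReal ≤ p) (hp : 0 ≤ p) (hp1 : p ≤ 1) :
    ∀ ν ∈ combines (law xorAll) (law maj) (List.replicate J (2, 3)) μs,
      12 * (ν true).toReal ≤ p ^ 2 ^ J := by
  induction J generalizing p μs with
  | zero => simpa using hμ
  | succ J ih =>
    have h := ih (error_combine_le hμ hp hp1) (sq_nonneg p) (pow_le_one₀ hp hp1)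
    rwa [← pow_mul, ← pow_succ'] at h

theorem errRoot_le {l N J k : ℕ} (hl : 0 < l) (hN : 0 < N) {α : ℝ} (hα : 0 ≤ α) (hα1 : α < 1)
    (h : 5 ≤ N * α ^ (2 * l)) (hJ : 64 * k ≤ 2 ^ J) {μs : List (PMF Bool)}
    (hlen : μs.length = lvSize (levels l N J)) (hμ : ∀ μ ∈ μs, α ≤ ev μ sgn) :
    ((seqL μs).map (errRoot (levels l N J)) true).toReal ≤ 1 / 2 ^ k := by
  have hlv := lvPos_levels hl hN J
  obtain ⟨ν, hν⟩ := List.length_eq_one_iff.1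
    (length_combines (f := law xorAll) (g := law maj) hlv hlen)
  have e : (seqL μs).map (errRoot (levels l N J)) = ν := by
    have e0 : errRoot (levels l N J) =
        (fun l => l.headD false) ∘ combines xorAll maj (levels l N J) := rfl
    rw [e0, ← PMF.map_comp, seqL_combines _ _ hlv hlen, hν]
    simp only [seqL, PMF.pure_map, PMF.map_bind]
    exact PMF.bind_pure ν
  rw [e]
  -- The square of the error is at most exp(-5), and 144 exp(-5) ≈ 0.9703. The value 0.971 leaves
  -- room for replacing e by 2.718.
  have h1 : ∀ ξ ∈ combine (law xorAll) (law maj) (l, N) μs,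
      12 * (ξ true).toReal ≤ Real.sqrt 0.971 := by
    refine forall_mem_combine (P := fun μ => α ≤ ev μ sgn) (Q := fun μ => α ^ l ≤ ev μ sgn)
      (fun G hG hP => by
        have h := pow_le_ev_xor hα G hP
        rwa [hG] at h) (fun G hG hQ => ?_) hμ
    have hαl : α ^ l < 1 := pow_lt_one₀ hα hα1 hl.ne'
    have h2 := maj_error_sq_le (pow_nonneg hα l) hαl G hQ
    rw [hG, ← pow_mul, mul_comm l 2] at h2
    simp only at h2
    refine Real.le_sqrt_of_sq_le ?_
    have hx : α ^ (2 * l) ≤ 1 := pow_le_one₀ hα hα1.le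
    have h3 : (1 - α ^ (2 * l)) ^ N ≤ Real.exp (-5) := by
      calc _ ≤ Real.exp (-α ^ (2 * l)) ^ N := by
            refine pow_le_pow_left₀ (by linarith) ?_ N
            linarith [Real.add_one_le_exp (-α ^ (2 * l))]
        _ = Real.exp (-(N * α ^ (2 * l))) := by
            rw [← Real.exp_nat_mul]; congr 1; ring
        _ ≤ _ := Real.exp_le_exp.2 (by linarith)
    have h4 : Real.exp (-5) ≤ 1 / 2.718 ^ 5 := by
      rw [Real.exp_neg, ← one_div]
      refine one_div_le_one_div_of_le (by norm_num) ?_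
      have h5 : (2.718 : ℝ) ≤ Real.exp 1 := by linarith [Real.exp_one_gt_d9]
      calc (2.718 : ℝ) ^ 5 ≤ Real.exp 1 ^ 5 := pow_le_pow_left₀ (by norm_num) h5 5
        _ = Real.exp 5 := by rw [← Real.exp_nat_mul]; norm_num
    calc _ = 144 * (law maj G true).toReal ^ 2 := by ring
      _ ≤ 144 * (1 / 2.718 ^ 5) := by gcongr; linarith
      _ ≤ _ := by norm_num
  have h3 : Real.sqrt 0.971 ≤ 1 := Real.sqrt_le_one.2 (by norm_num)
  have h2 := error_combines_le J h1 (Real.sqrt_nonneg _) h3 ν (by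
    have : ν ∈ combines (law xorAll) (law maj) (levels l N J) μs := by rw [hν]; simp
    exact this)
  calc (ν true).toReal ≤ 12 * (ν true).toReal := by
        linarith [(ENNReal.toReal_nonneg : 0 ≤ (ν true).toReal)]
    _ ≤ Real.sqrt 0.971 ^ 2 ^ J := h2
    _ ≤ Real.sqrt 0.971 ^ (64 * k) := pow_le_pow_of_le_one (Real.sqrt_nonneg _) h3 hJ
    -- As 0.971 ^ 32 ≈ 0.39 < 1 / 2, a number 64 k of square roots suffices.
    _ = ((Real.sqrt 0.971 ^ 2) ^ 32) ^ k := by rw [← pow_mul, ← pow_mul]; congr 1; ring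
    _ ≤ (1 / 2) ^ k := by
        rw [Real.sq_sqrt (by norm_num)]
        exact pow_le_pow_left₀ (by norm_num) (by norm_num) k
    _ = _ := by rw [div_pow, one_pow]

/-- A level sends q to 3 q², which squares 3 q. -/
theorem advBound_replicate (J : ℕ) (q : ℝ) :
    3 * advBound (List.replicate J (2, 3)) q = (3 * q) ^ 2 ^ J := by
  induction J generalizing q with
  | zero => simp [advBound]
  | succ J ih =>
    have : advBound (List.replicate (J + 1) (2, 3)) q =
        advBound (List.replicate J (2, 3)) ((3 : ℕ) * q ^ 2) := rfl
    rw [this, ih, pow_succ' 2 J, pow_mul]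
    congr 1
    push_cast
    ring

theorem advBound_levels_le {l N J k : ℕ} {q : ℝ} (hq : 0 ≤ q) (h : N * q ^ l ≤ 2 / 11)
    (hJ : 64 * k ≤ 2 ^ J) : advBound (levels l N J) q ≤ 1 / 2 ^ k := by
  have e : advBound (levels l N J) q = advBound (List.replicate J (2, 3)) (N * q ^ l) := rfl
  have h1 := advBound_replicate J (N * q ^ l)
  have h0 : 0 ≤ 3 * (N * q ^ l) := by positivity
  have h2 : (3 * (N * q ^ l)) ^ 2 ^ J ≤ (1 / 2) ^ k :=
    calc _ ≤ (3 * (N * q ^ l)) ^ (64 * k) :=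
          pow_le_pow_of_le_one h0 (by linarith) hJ
      _ ≤ (6 / 11) ^ (64 * k) := pow_le_pow_left₀ h0 (by linarith) _
      _ = ((6 / 11) ^ 64) ^ k := pow_mul _ _ _
      _ ≤ _ := pow_le_pow_left₀ (by norm_num) (by norm_num) k
  rw [div_pow, one_pow] at h2
  have h3 : 0 ≤ (3 * (N * q ^ l)) ^ 2 ^ J := pow_nonneg h0 _
  rw [e]
  linarith

/-! ## The choice of the parameters -/

/-- The least `t ≤ n` with `p t`. -/
def firstTrue (p : ℕ → Bool) (n : ℕ) : ℕ := (fun t => if p t then t else t + 1)^[n] 0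

theorem firstTrue_le (p : ℕ → Bool) (n : ℕ) : firstTrue p n ≤ n := by
  induction n with
  | zero => exact le_rfl
  | succ n ih =>
    rw [firstTrue, Function.iterate_succ_apply', ← firstTrue]
    split <;> omega

theorem firstTrue_eq {p : ℕ → Bool} {t n : ℕ} (ht : p t = true) (hlt : ∀ i < t, p i = false)
    (hn : t ≤ n) : firstTrue p n = t := by
  suffices ∀ n, firstTrue p n = min n t by rw [this n, min_eq_right hn]
  intro n
  induction n with
  | zero => simp [firstTrue]
  | succ n ih =>
    rw [firstTrue, Function.iterate_succ_apply', ← firstTrue, ih]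
    rcases lt_or_ge n t with h | h
    · rw [min_eq_left h.le, hlt n h]; simp; omega
    · rw [min_eq_right h, ht]; simp; omega

theorem firstTrue_spec {p : ℕ → Bool} {n : ℕ} (h : ∃ t ≤ n, p t = true) :
    p (firstTrue p n) = true := by
  classical
  have h' : ∃ t, p t = true := h.imp fun t => And.right
  obtain ⟨t, htn, ht⟩ := h
  rw [firstTrue_eq (Nat.find_spec h') (fun i hi => by simpa using Nat.find_min h' hi)
    ((Nat.find_min' h' ht).trans htn)]
  exact Nat.find_spec h'

/-- `(m, 2 ^ m, 6 ^ m)` for the least `m` with `t < 2 ^ m`. -/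
def powers (t : ℕ) : ℕ × ℕ × ℕ :=
  (fun s : ℕ × ℕ × ℕ => if s.2.1 ≤ t then (s.1 + 1, 2 * s.2.1, 6 * s.2.2) else s)^[t] (0, 1, 1)

/-- The least `m` with `t < 2 ^ m`. -/
def width (t : ℕ) : ℕ := (powers t).1

theorem powers_iterate (t i : ℕ) : ∃ m,
    (fun s : ℕ × ℕ × ℕ => if s.2.1 ≤ t then (s.1 + 1, 2 * s.2.1, 6 * s.2.2) else s)^[i] (0, 1, 1) =
      (m, 2 ^ m, 6 ^ m) ∧ 2 ^ m ≤ 2 * t + 1 ∧ min i t < 2 ^ m := by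
  induction i with
  | zero => exact ⟨0, by simp⟩
  | succ i ih =>
    obtain ⟨m, h1, h2, h3⟩ := ih
    rw [Function.iterate_succ_apply', h1]
    rcases le_or_gt (2 ^ m) t with h | h
    · refine ⟨m + 1, ?_, ?_, ?_⟩
      · simp [h, pow_succ']
      · rw [pow_succ]; omega
      · rw [pow_succ]; omega
    · exact ⟨m, by simp [h.not_ge], h2, by omega⟩

theorem powers_eq (t : ℕ) : powers t = (width t, 2 ^ width t, 6 ^ width t) := by
  obtain ⟨m, h, -⟩ := powers_iterate t t
  have h' : powers t = (m, 2 ^ m, 6 ^ m) := h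
  rw [width, h']

theorem lt_two_pow_width (t : ℕ) : t < 2 ^ width t := by
  obtain ⟨m, h, -, h2⟩ := powers_iterate t t
  have h' : powers t = (m, 2 ^ m, 6 ^ m) := h
  rw [width, h']
  simpa using h2

theorem two_pow_width_le (t : ℕ) : 2 ^ width t ≤ 2 * t + 1 := by
  obtain ⟨m, h, h1, -⟩ := powers_iterate t t
  have h' : powers t = (m, 2 ^ m, 6 ^ m) := h
  rwa [width, h']

/-- The number with the given binary digits, if it is at most `cap`. -/
def cappedVal (cap : ℕ) (r : Raw) : ℕ :=
  r.bits.reverse.foldl (fun v b => min (2 * v + if b then 1 else 0) cap) 0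

theorem cappedVal_bits (cap a : ℕ) : cappedVal cap ⟨Nat.bits a⟩ = min a cap := by
  rw [cappedVal, List.foldl_reverse]
  induction a using Nat.binaryRec' with
  | zero => simp
  | bit b n h ih =>
    rw [Nat.bits_append_bit n b h, List.foldr_cons, ih, Nat.bit_val]
    cases b <;> simp <;> omega

/-- `M · (B / M) ^ l`, rounded up. -/
def powUpper (B M l : ℕ) : ℕ := (fun u => u * B / M + 1)^[l] M

/-- `M · (A / M) ^ l`, rounded down. -/
def powLower (A M l : ℕ) : ℕ := (fun v => v * A / M)^[l] M

theorem le_powUpper {B M : ℕ} (hM : 0 < M) (l : ℕ) :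
    (M : ℝ) * ((B : ℝ) / M) ^ l ≤ powUpper B M l := by
  have hM' : (0 : ℝ) < M := by exact_mod_cast hM
  induction l with
  | zero => simp [powUpper]
  | succ l ih =>
    rw [powUpper, Function.iterate_succ_apply', ← powUpper, pow_succ, ← mul_assoc]
    push_cast
    have h := Nat.lt_div_mul_add (a := powUpper B M l * B) hM
    have h' : ((powUpper B M l : ℝ) * B) < ((powUpper B M l * B / M : ℕ) : ℝ) * M + M := by
      exact_mod_cast h
    calc _ ≤ (powUpper B M l : ℝ) * (B / M) := by gcongr
      _ = powUpper B M l * B / M := by ring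
      _ ≤ _ := by rw [div_le_iff₀ hM']; linarith

/-- Each rounding adds at most 1, and later factors B / M ≤ 1 do not amplify it. -/
theorem powUpper_le {B M : ℕ} (hM : 0 < M) (hB : B ≤ M) (l : ℕ) :
    (powUpper B M l : ℝ) ≤ M * ((B : ℝ) / M) ^ l + l := by
  have hM' : (0 : ℝ) < M := by exact_mod_cast hM
  have hx : (B : ℝ) / M ≤ 1 := (div_le_one hM').2 (by exact_mod_cast hB)
  have hx0 : 0 ≤ (B : ℝ) / M := by positivity
  induction l with
  | zero => simp [powUpper]
  | succ l ih =>
    rw [powUpper, Function.iterate_succ_apply', ← powUpper, pow_succ]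
    push_cast
    have h : ((powUpper B M l * B / M : ℕ) : ℝ) ≤ powUpper B M l * B / M := by
      exact_mod_cast Nat.cast_div_le (α := ℝ) (m := powUpper B M l * B) (n := M)
    have h2 : (powUpper B M l : ℝ) * B / M ≤ (M * ((B : ℝ) / M) ^ l + l) * (B / M) := by
      rw [mul_div_assoc]; gcongr
    nlinarith [Nat.cast_nonneg (α := ℝ) l]

theorem powLower_le {A M : ℕ} (hM : 0 < M) (l : ℕ) :
    (powLower A M l : ℝ) ≤ M * ((A : ℝ) / M) ^ l := by
  induction l with
  | zero => simp [powLower]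
  | succ l ih =>
    rw [powLower, Function.iterate_succ_apply', ← powLower, pow_succ]
    have h : ((powLower A M l * A / M : ℕ) : ℝ) ≤ powLower A M l * A / M := by
      exact_mod_cast Nat.cast_div_le (α := ℝ) (m := powLower A M l * A) (n := M)
    calc _ ≤ (powLower A M l : ℝ) * (A / M) := by rwa [← mul_div_assoc]
      _ ≤ (M * ((A : ℝ) / M) ^ l) * (A / M) := by gcongr
      _ = _ := by ring

theorem le_powLower {A M : ℕ} (hM : 0 < M) (hA : A ≤ M) (l : ℕ) :
    (M : ℝ) * ((A : ℝ) / M) ^ l - l ≤ powLower A M l := by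
  have hM' : (0 : ℝ) < M := by exact_mod_cast hM
  have hx : (A : ℝ) / M ≤ 1 := (div_le_one hM').2 (by exact_mod_cast hA)
  have hx0 : 0 ≤ (A : ℝ) / M := by positivity
  induction l with
  | zero => simp [powLower]
  | succ l ih =>
    rw [powLower, Function.iterate_succ_apply', ← powLower, pow_succ]
    push_cast
    have h := Nat.lt_div_mul_add (a := powLower A M l * A) hM
    have h' : ((powLower A M l : ℝ) * A) < ((powLower A M l * A / M : ℕ) : ℝ) * M + M := by
      exact_mod_cast h
    have h1 : (powLower A M l : ℝ) * A / M ≤ ((powLower A M l * A / M : ℕ) : ℝ) + 1 := by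
      rw [div_le_iff₀ hM']; linarith
    have h2 : ((M : ℝ) * ((A : ℝ) / M) ^ l - l) * (A / M) ≤ powLower A M l * A / M := by
      rw [mul_div_assoc]; gcongr
    nlinarith [Nat.cast_nonneg (α := ℝ) l]

/-- On [0, 1] the l-th power has Lipschitz constant l. -/
theorem pow_le_pow_add {x y d : ℝ} (hx : 0 ≤ x) (hx1 : x ≤ 1) (hy : 0 ≤ y) (hy1 : y ≤ 1)
    (hd : 0 ≤ d) (h : x ≤ y + d) (l : ℕ) : x ^ l ≤ y ^ l + l * d := by
  induction l with
  | zero => simp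
  | succ l ih =>
    rw [pow_succ, pow_succ]
    push_cast
    have h1 : x ^ l * x ≤ (y ^ l + l * d) * x := by gcongr
    have h2 : y ^ l * x ≤ y ^ l * (y + d) := by gcongr
    have h3 : y ^ l * d ≤ d := mul_le_of_le_one_left hd (pow_le_one₀ hy hy1)
    have h4 : l * d * x ≤ l * d := mul_le_of_le_one_right (by positivity) hx1
    linarith

/-- The number `t = l N` of instances per amplified instance is good. -/
def goodPair (B A M t l : ℕ) : Bool :=
  decide (11 * (t / l) * powUpper B M l ≤ 2 * M ∧ 5 * M ≤ t / l * powLower A M (2 * l))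

/-- All roundings are on the safe side, so an accepted pair needs no estimate of the rounding
errors. -/
theorem goodPair_spec {B A M t l : ℕ} (hM : 0 < M) (h : goodPair B A M t l = true) :
    0 < l ∧ 0 < t / l ∧ ((t / l : ℕ) : ℝ) * ((B : ℝ) / M) ^ l ≤ 2 / 11 ∧
      5 ≤ ((t / l : ℕ) : ℝ) * ((A : ℝ) / M) ^ (2 * l) := by
  obtain ⟨h1, h2⟩ := of_decide_eq_true h
  have hM' : (0 : ℝ) < M := by exact_mod_cast hM
  -- The second test fails for t / l = 0; this also excludes l = 0.
  have hN : 0 < t / l := by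
    rcases Nat.eq_zero_or_pos (t / l) with h0 | h0
    · rw [h0] at h2; omega
    · exact h0
  refine ⟨Nat.pos_of_ne_zero fun h0 => by simp [h0] at hN, hN, ?_, ?_⟩
  · have h3 := le_powUpper (B := B) hM l
    have h1' : 11 * ((t / l : ℕ) : ℝ) * powUpper B M l ≤ 2 * M := by exact_mod_cast h1
    have h4 : 11 * ((t / l : ℕ) : ℝ) * (M * ((B : ℝ) / M) ^ l) ≤ 2 * M :=
      le_trans (by gcongr) h1'
    rw [le_div_iff₀ (by norm_num)]
    refine le_of_mul_le_mul_right ?_ hM'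
    linarith
  · have h3 := powLower_le (A := A) hM (2 * l)
    have h2' : 5 * (M : ℝ) ≤ ((t / l : ℕ) : ℝ) * powLower A M (2 * l) := by exact_mod_cast h2
    have h4 : 5 * (M : ℝ) ≤ ((t / l : ℕ) : ℝ) * (M * ((A : ℝ) / M) ^ (2 * l)) :=
      h2'.trans (by gcongr)
    refine le_of_mul_le_mul_right ?_ hM'
    linarith

/-- By the definition of λ, about 36λ/7 factors raise α² / β above 35, which separates N β ^ l from
N α ^ (2l). The targets 5.1 and 6.1 / 35 keep a margin to the required 5 and 2 / 11, to be consumed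
by rounding. -/
theorem exists_parameters {α β lam : ℝ} (hβ : 0 ≤ β) (hα : 0 < α) (hα1 : α ≤ 1)
    (h : Real.sqrt β < α) (hlam : lam = max 1 (1 / Real.logb 2 (α ^ 2 / β))) :
    ∃ l N : ℕ, 0 < l ∧ 0 < N ∧ N * β ^ l ≤ 6.1 / 35 ∧ 5.1 ≤ N * α ^ (2 * l) ∧
      (l * N : ℝ) ≤ 37 * lam / α ^ (12 * lam) := by
  have h1 : 1 ≤ lam := hlam ▸ le_max_left _ _
  have hl := Nat.floor_le (show 0 ≤ 6 * lam by linarith)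
  have hl' := Nat.lt_floor_add_one (6 * lam)
  have hl6 : 6 ≤ ⌊6 * lam⌋₊ := Nat.le_floor (by push_cast; linarith)
  generalize ⌊6 * lam⌋₊ = l at hl hl' hl6
  have hl6' : (6 : ℝ) ≤ l := by exact_mod_cast hl6
  -- For λ ≤ 7/6 this follows from l ≥ 6, and for λ ≥ 7/6 from l > 6λ - 1.
  have hratio : 36 / 7 * lam ≤ l := by
    rcases le_total lam (7 / 6) with h2 | h2 <;> linarith
  have key : β ^ l * 35 ≤ α ^ (2 * l) := by
    rcases hβ.eq_or_lt with rfl | hβ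
    · rw [zero_pow (by omega), zero_mul]; positivity
    have hx : 1 < α ^ 2 / β := by
      rw [one_lt_div hβ, ← Real.sq_sqrt hβ.le]
      exact pow_lt_pow_left₀ h (Real.sqrt_nonneg _) two_ne_zero
    have hL : 0 < Real.logb 2 (α ^ 2 / β) := Real.logb_pos (by norm_num) hx
    have hL1 : 1 ≤ lam * Real.logb 2 (α ^ 2 / β) := by
      rw [← div_le_iff₀ hL]; exact hlam ▸ le_max_right _ _
    -- Indeed 35 ^ 7 < 2 ^ 36.
    have h35 : (35 : ℝ) ≤ 2 ^ (36 / 7 : ℝ) := by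
      refine le_of_pow_le_pow_left₀ (n := 7) (by norm_num) (by positivity) ?_
      rw [← Real.rpow_natCast, ← Real.rpow_natCast, ← Real.rpow_mul (by norm_num)]
      norm_num
    have h3 : (35 : ℝ) ≤ (α ^ 2 / β) ^ l := by
      calc (35 : ℝ) ≤ 2 ^ (36 / 7 : ℝ) := h35
        _ ≤ 2 ^ (Real.logb 2 (α ^ 2 / β) * l) := by
            refine Real.rpow_le_rpow_of_exponent_le (by norm_num) ?_
            nlinarith
        _ = _ := by
            rw [Real.rpow_mul (by norm_num), Real.rpow_logb (by norm_num) (by norm_num)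
              (by linarith), Real.rpow_natCast]
    rw [div_pow, ← pow_mul, le_div_iff₀ (by positivity)] at h3
    linarith
  have hp : 0 < α ^ (2 * l) := by positivity
  -- Rounding up places N α ^ (2l) between 5.1 and 6.1.
  have hN := Nat.le_ceil (5.1 / α ^ (2 * l))
  have hN' := Nat.ceil_lt_add_one (show 0 ≤ 5.1 / α ^ (2 * l) by positivity)
  have hN0 : 0 < ⌈5.1 / α ^ (2 * l)⌉₊ := Nat.ceil_pos.2 (by positivity)
  generalize ⌈5.1 / α ^ (2 * l)⌉₊ = N at hN hN' hN0
  have hp1 : α ^ (2 * l) ≤ 1 := pow_le_one₀ hα.le hα1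
  have hN2 : N * α ^ (2 * l) ≤ 6.1 := by
    have : (N : ℝ) * α ^ (2 * l) ≤ (5.1 / α ^ (2 * l) + 1) * α ^ (2 * l) := by gcongr
    rw [add_mul, div_mul_cancel₀ _ hp.ne'] at this
    linarith
  refine ⟨l, N, by omega, hN0, ?_, (div_le_iff₀ hp).1 hN, ?_⟩
  · rw [le_div_iff₀ (by norm_num), mul_assoc]
    exact (mul_le_mul_of_nonneg_left key (Nat.cast_nonneg N)).trans hN2
  · have hq : 0 < α ^ (12 * lam) := Real.rpow_pos_of_pos hα _
    have h4 : α ^ (12 * lam) ≤ α ^ (2 * l) := by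
      rw [← Real.rpow_natCast]
      exact Real.rpow_le_rpow_of_exponent_ge hα hα1 (by push_cast; linarith)
    rw [le_div_iff₀ hq]
    calc (l * N : ℝ) * α ^ (12 * lam) ≤ l * (N * α ^ (2 * l)) := by rw [mul_assoc]; gcongr
      _ ≤ (6 * lam) * 6.1 := by gcongr
      _ ≤ _ := by linarith

/-- The total error is a small multiple of l N, at most that multiple of M / 1024, which the margins
absorb. -/
theorem goodPair_of_parameters {α β : ℝ} (hβ : 0 ≤ β) (hβ1 : β ≤ 1) (hα : 0 ≤ α) (hα1 : α ≤ 1)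
    {l N B A M : ℕ} (hl : 0 < l) (hN : 0 < N) (h1 : N * β ^ l ≤ 6.1 / 35)
    (h2 : 5.1 ≤ N * α ^ (2 * l)) (hM : 1024 * (l * N) ≤ M) (hB : B ≤ M) (hBβ : B ≤ M * β + 2)
    (hA : A ≤ M) (hAα : M * α - 4 ≤ A) : goodPair B A M (l * N) l = true := by
  have ht : l * N / l = N := Nat.mul_div_cancel_left N hl
  have hM0 : 0 < M := lt_of_lt_of_le (by positivity) hM
  have hM' : (0 : ℝ) < M := by exact_mod_cast hM0
  have hMr : 1024 * ((l : ℝ) * N) ≤ M := by exact_mod_cast hM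
  refine decide_eq_true ?_
  rw [ht]
  constructor
  · have h3 := powUpper_le hM0 hB l
    have h4 := pow_le_pow_add (x := (B : ℝ) / M) (y := β) (d := 2 / M) (by positivity)
      ((div_le_one hM').2 (by exact_mod_cast hB)) hβ hβ1 (by positivity)
      (by rw [div_le_iff₀ hM', add_mul, div_mul_cancel₀ _ hM'.ne']; linarith) l
    have h5 : (M : ℝ) * ((B : ℝ) / M) ^ l ≤ M * β ^ l + 2 * l := by
      calc _ ≤ (M : ℝ) * (β ^ l + l * (2 / M)) := by gcongr
        _ = _ := by field_simp
    -- Of the 3 l, 2 l come from the error of B and l from rounding; 11 · 6.1 / 35 + 33 / 1024 < 2.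
    have h6 : (11 : ℝ) * N * powUpper B M l ≤ 2 * M := by
      calc (11 : ℝ) * N * powUpper B M l ≤ 11 * N * (M * β ^ l + 3 * l) := by
            gcongr; linarith
        _ = 11 * (M * (N * β ^ l)) + 33 * (l * N) := by ring
        _ ≤ 11 * (M * (6.1 / 35)) + 33 * (l * N) := by gcongr
        _ ≤ _ := by linarith
    exact_mod_cast h6
  · have h3 := le_powLower hM0 hA (2 * l)
    have h4 := pow_le_pow_add (x := α) (y := (A : ℝ) / M) (d := 4 / M) hα hα1 (by positivity)
      ((div_le_one hM').2 (by exact_mod_cast hA)) (by positivity)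
      (by rw [← add_div, le_div_iff₀ hM']; linarith) (2 * l)
    have h5 : (M : ℝ) * α ^ (2 * l) ≤ M * ((A : ℝ) / M) ^ (2 * l) + 8 * l := by
      calc _ ≤ (M : ℝ) * (((A : ℝ) / M) ^ (2 * l) + (2 * l : ℕ) * (4 / M)) := by gcongr
        _ = _ := by push_cast; field_simp; ring
    push_cast at h3
    -- Of the 10 l, 8 l come from the error of A and 2 l from rounding.
    have h6 : (5 : ℝ) * M ≤ N * powLower A M (2 * l) := by
      calc (5 : ℝ) * M ≤ M * 5.1 - 10 * (l * N) := by linarith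
        _ ≤ M * (N * α ^ (2 * l)) - 10 * (l * N) := by gcongr
        _ = N * (M * α ^ (2 * l) - 10 * l) := by ring
        _ ≤ _ := by gcongr; linarith
    exact_mod_cast h6

/-! ### Computing with approximations of the parameters -/

/-- The precision in which the parameters are needed to check `t`. -/
def prec (t : ℕ) : ℕ := 10 + width t

def scale (t : ℕ) : ℕ := 1024 * (powers t).2.1

theorem scale_eq (t : ℕ) : scale t = 2 ^ prec t := by
  rw [scale, powers_eq, prec, pow_add]; norm_num

theorem lt_scale (t : ℕ) : 1024 * t < scale t := by
  rw [scale, powers_eq]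
  have := lt_two_pow_width t
  simp only
  omega

/-- The numerator of an upper bound for the function which `a` approximates. -/
def upperNum (a : ℕ → ℕ → ℕ) (k t : ℕ) : ℕ :=
  min (cappedVal (scale t) ⟨Nat.bits (a (k - 1 + 1) (prec t))⟩ + 1) (scale t)

/-- The numerator of a lower bound for `1 - 2 ε`, where `b` approximates `ε`. -/
def lowerNum (b : ℕ → ℕ → ℕ) (k t : ℕ) : ℕ :=
  scale t - 2 * (cappedVal (scale t) ⟨Nat.bits (b (k - 1 + 1) (prec t))⟩ + 1)

def Approximates (a : ℕ → ℕ → ℕ) (f : ℕ → ℝ) : Prop :=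
  ∀ k ≥ 1, ∀ m : ℕ, |f k - (a k m : ℝ) / 2 ^ m| ≤ 1 / 2 ^ m

theorem Approximates.scale {a : ℕ → ℕ → ℕ} {f : ℕ → ℝ} (h : Approximates a f) {k : ℕ}
    (hk : 1 ≤ k) (t : ℕ) :
    scale t * f k ≤ a k (prec t) + 1 ∧ (a k (prec t) : ℝ) ≤ scale t * f k + 1 := by
  have h1 := h k hk (prec t)
  have hM : (0 : ℝ) < 2 ^ prec t := by positivity
  rw [scale_eq]
  push_cast
  have e : f k - (a k (prec t) : ℝ) / 2 ^ prec t =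
      (2 ^ prec t * f k - a k (prec t)) / 2 ^ prec t := by field_simp
  rw [e, abs_div, abs_of_pos hM, div_le_div_iff_of_pos_right hM, abs_le] at h1
  constructor <;> linarith [h1.1, h1.2]

/-- Capping at the scale keeps an upper bound because f k ≤ 1. It also keeps the number polynomial
in t, as arithmetic is done in unary. -/
theorem upperNum_spec {a : ℕ → ℕ → ℕ} {f : ℕ → ℝ} (h : Approximates a f) {k : ℕ} (hk : 1 ≤ k)
    (hf : f k ≤ 1) (t : ℕ) :
    f k ≤ (upperNum a k t : ℝ) / scale t ∧ upperNum a k t ≤ scale t ∧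
      (upperNum a k t : ℝ) ≤ scale t * f k + 2 := by
  obtain ⟨h1, h2⟩ := h.scale hk t
  have hM : (0 : ℝ) < scale t := by exact_mod_cast (Nat.zero_le _).trans_lt (lt_scale t)
  have e : upperNum a k t = min (a k (prec t) + 1) (scale t) := by
    rw [upperNum, cappedVal_bits, Nat.sub_add_cancel hk]; omega
  refine ⟨?_, by rw [e]; exact min_le_right _ _, ?_⟩
  · rw [le_div_iff₀ hM, e, Nat.cast_min]
    refine le_min ?_ ?_
    · push_cast; linarith
    · nlinarith
  · have : upperNum a k t ≤ a k (prec t) + 1 := by rw [e]; exact min_le_left _ _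
    have : (upperNum a k t : ℝ) ≤ a k (prec t) + 1 := by exact_mod_cast this
    linarith

/-- Truncated subtraction is harmless: 0 is a valid lower bound for 1 - 2 f k. -/
theorem lowerNum_spec {b : ℕ → ℕ → ℕ} {f : ℕ → ℝ} (h : Approximates b f) {k : ℕ} (hk : 1 ≤ k)
    (hf : 0 ≤ 1 - 2 * f k) (t : ℕ) :
    (lowerNum b k t : ℝ) / scale t ≤ 1 - 2 * f k ∧ lowerNum b k t < scale t ∧
      scale t * (1 - 2 * f k) - 4 ≤ lowerNum b k t := by
  obtain ⟨h1, h2⟩ := h.scale hk t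
  have hM0 : 0 < scale t := (Nat.zero_le _).trans_lt (lt_scale t)
  have hM : (0 : ℝ) < scale t := by exact_mod_cast hM0
  have e : lowerNum b k t = scale t - 2 * (b k (prec t) + 1) := by
    rw [lowerNum, cappedVal_bits, Nat.sub_add_cancel hk]; omega
  refine ⟨?_, by rw [e]; omega, ?_⟩
  · rw [div_le_iff₀ hM, e]
    rcases le_total (2 * (b k (prec t) + 1)) (scale t) with h3 | h3
    · rw [Nat.cast_sub h3]; push_cast; linarith
    · rw [Nat.sub_eq_zero_of_le h3, Nat.cast_zero]; positivity
  · have : scale t ≤ lowerNum b k t + 2 * (b k (prec t) + 1) := by rw [e]; omega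
    have : (scale t : ℝ) ≤ lowerNum b k t + 2 * (b k (prec t) + 1) := by exact_mod_cast this
    linarith

section Choice

variable (a b : ℕ → ℕ → ℕ)

/-- The number of instances of the first exclusive or, for `t` instances per amplified one. -/
def xorSize (k t : ℕ) : ℕ :=
  firstTrue (goodPair (upperNum a k t) (lowerNum b k t) (scale t) t) t

def isGood (k t : ℕ) : Bool :=
  goodPair (upperNum a k t) (lowerNum b k t) (scale t) t (xorSize a b k t)

/-- The levels of the protocol, if `t` is the number of instances per amplified instance. -/
def levelsOf (k t : ℕ) : List (ℕ × ℕ) :=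
  levels (xorSize a b k t) (t / xorSize a b k t) (6 + width k)

/-- The total number of instances, if `t` is the number of instances per amplified instance. -/
def totalSize (k t : ℕ) : ℕ :=
  xorSize a b k t * (t / xorSize a b k t) * (46656 * (powers k).2.2)

variable {a b}

theorem lvSize_levelsOf (k t : ℕ) : lvSize (levelsOf a b k t) = totalSize a b k t := by
  rw [levelsOf, lvSize_levels, totalSize, powers_eq, pow_add]; norm_num

theorem le_two_pow_width (k : ℕ) : 64 * k ≤ 2 ^ (6 + width k) := by
  have := lt_two_pow_width k
  rw [pow_add]
  omega

theorem isGood_spec {q ε : ℕ → ℝ} (ha : Approximates a q) (hb : Approximates b ε) {k : ℕ}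
    (hk : 1 ≤ k) (hq : 0 ≤ q k) (hq1 : q k ≤ 1) (hε : 0 ≤ 1 - 2 * ε k) {t : ℕ}
    (h : isGood a b k t = true) :
    LvPos (levelsOf a b k t) ∧ t ≤ totalSize a b k t ∧
      advBound (levelsOf a b k t) (q k) ≤ 1 / 2 ^ k ∧
      ∀ μs : List (PMF Bool), μs.length = lvSize (levelsOf a b k t) →
        (∀ μ ∈ μs, 1 - 2 * ε k ≤ ev μ sgn) →
        ((seqL μs).map (errRoot (levelsOf a b k t)) true).toReal ≤ 1 / 2 ^ k := by
  have hM0 : 0 < scale t := (Nat.zero_le _).trans_lt (lt_scale t)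
  obtain ⟨h1, h2, h3, h4⟩ := goodPair_spec hM0 h
  obtain ⟨u1, u2, u3⟩ := upperNum_spec ha hk hq1 t
  obtain ⟨l1, l2, l3⟩ := lowerNum_spec hb hk hε t
  have hM : (0 : ℝ) < scale t := by exact_mod_cast hM0
  refine ⟨lvPos_levels h1 h2 _, ?_, ?_, fun μs hlen hμ => ?_⟩
  -- With N = t / l one has t < l N + l ≤ 2 l N, and the amplification factor is at least 2. This is
  -- what allows t to be recovered from the number of instances.
  · rw [totalSize, powers_eq]
    have e := Nat.lt_div_mul_add (a := t) h1
    have h5 : xorSize a b k t ≤ t / xorSize a b k t * xorSize a b k t :=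
      Nat.le_mul_of_pos_left _ h2
    have h6 : 1 ≤ 6 ^ width k := Nat.one_le_pow _ _ (by norm_num)
    calc t ≤ (xorSize a b k t * (t / xorSize a b k t)) * 2 := by
          rw [mul_comm (xorSize a b k t)]; omega
      _ ≤ _ := Nat.mul_le_mul_left _ (by simp only; omega)
  · exact advBound_levels_le hq (le_trans (by gcongr) h3) (le_two_pow_width k)
  -- The Chernoff bound needs a bias strictly below 1. The rounded lower bound has this property
  -- even if ε vanishes.
  · refine errRoot_le h1 h2 (by positivity) ?_ h4 (le_two_pow_width k) hlen
      fun μ hμ' => l1.trans (hμ μ hμ')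
    rw [div_lt_one hM]
    exact_mod_cast l2

/-- Since 6 ^ 5 < 2 ^ 13, the power of 6 is at most (2 ^ width) ^ 2.6, where 2 ^ width ≤ 3 k. -/
theorem six_pow_width_le {k : ℕ} (hk : 1 ≤ k) :
    (6 : ℝ) ^ width k ≤ 27 * (k : ℝ) ^ (2.6 : ℝ) := by
  have h6 : (6 : ℝ) ≤ 2 ^ (2.6 : ℝ) := by
    refine le_of_pow_le_pow_left₀ (n := 5) (by norm_num) (by positivity) ?_
    rw [← Real.rpow_natCast, ← Real.rpow_natCast, ← Real.rpow_mul (by norm_num)]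
    norm_num
  have h2 : (2 : ℝ) ^ width k ≤ 3 * k := by
    have := two_pow_width_le k
    have : 2 ^ width k ≤ 3 * k := by omega
    exact_mod_cast this
  have h3 : (3 : ℝ) ^ (2.6 : ℝ) ≤ 27 := by
    calc (3 : ℝ) ^ (2.6 : ℝ) ≤ 3 ^ (3 : ℝ) :=
          Real.rpow_le_rpow_of_exponent_le (by norm_num) (by norm_num)
      _ = 27 := by norm_num
  calc (6 : ℝ) ^ width k ≤ (2 ^ (2.6 : ℝ)) ^ width k := pow_le_pow_left₀ (by norm_num) h6 _
    _ = (2 ^ width k) ^ (2.6 : ℝ) := by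
        rw [← Real.rpow_natCast, ← Real.rpow_mul (by norm_num), mul_comm,
          Real.rpow_mul (by norm_num), Real.rpow_natCast]
    _ ≤ (3 * k) ^ (2.6 : ℝ) := Real.rpow_le_rpow (by positivity) h2 (by norm_num)
    _ = 3 ^ (2.6 : ℝ) * (k : ℝ) ^ (2.6 : ℝ) := Real.mul_rpow (by norm_num) (by positivity)
    _ ≤ _ := by gcongr

theorem exists_isGood {q ε : ℕ → ℝ} (ha : Approximates a q) (hb : Approximates b ε) {k : ℕ}
    (hk : 1 ≤ k) (hq : 0 ≤ q k) (hε : 0 ≤ ε k) (h : Real.sqrt (q k) + 2 * ε k < 1) :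
    ∃ t, isGood a b k t = true ∧ ∀ s ≤ t, (totalSize a b k s : ℝ) ≤
      37 * 46656 * 27 * ((k : ℝ) ^ (2.6 : ℝ) * lam (q k) (ε k) /
        (1 - 2 * ε k) ^ (12 * lam (q k) (ε k))) := by
  have hs := Real.sqrt_nonneg (q k)
  have hq1 : q k ≤ 1 := Real.sqrt_le_one.1 (by linarith)
  obtain ⟨l, N, hl, hN, h1, h2, h3⟩ := exists_parameters (lam := lam (q k) (ε k)) hq
    (show 0 < 1 - 2 * ε k by linarith) (by linarith) (by linarith) rfl
  refine ⟨l * N, ?_, fun s hst => ?_⟩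
  · obtain ⟨u1, u2, u3⟩ := upperNum_spec ha hk hq1 (l * N)
    obtain ⟨l1, l2, l3⟩ := lowerNum_spec hb hk (by linarith) (l * N)
    exact firstTrue_spec (p := goodPair (upperNum a k (l * N)) (lowerNum b k (l * N))
      (scale (l * N)) (l * N)) ⟨l, Nat.le_mul_of_pos_right l hN,
      goodPair_of_parameters hq hq1 (by linarith) (by linarith) hl hN h1 h2 (lt_scale _).le u2 u3
        l2.le l3⟩
  -- The size is bounded by s ≤ l N whatever l and N the search returns for s, so no monotonicity of
  -- the search is needed.
  · have h4 : xorSize a b k s * (s / xorSize a b k s) ≤ l * N := (Nat.mul_div_le _ _).trans hst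
    have h4' : ((xorSize a b k s * (s / xorSize a b k s) : ℕ) : ℝ) ≤ l * N := by exact_mod_cast h4
    have h5 := six_pow_width_le hk
    rw [totalSize, powers_eq]
    have hlam : 0 ≤ lam (q k) (ε k) := zero_le_one.trans (le_max_left _ _)
    have hp : 0 ≤ (1 - 2 * ε k) ^ (12 * lam (q k) (ε k)) := Real.rpow_nonneg (by linarith) _
    rw [Nat.cast_mul, Nat.cast_mul]
    push_cast at h4' ⊢
    calc _ ≤ (37 * lam (q k) (ε k) / (1 - 2 * ε k) ^ (12 * lam (q k) (ε k))) *
          (46656 * (27 * (k : ℝ) ^ (2.6 : ℝ))) := by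
          refine mul_le_mul (h4'.trans h3) (by gcongr) (by positivity) (by positivity)
      _ = _ := by ring

end Choice

/-! ## Programs for the parameters -/

namespace PT

variable {α β γ : Type} [Enc α] [Enc β] [Enc γ]

@[fun_prop]
theorem decideEqTrue {f : γ → Bool} (hf : PT f) : PT fun x => decide (f x = true) := by
  simpa using hf

theorem firstTrue {p : γ → ℕ → Bool} {n : γ → ℕ} (hp : PT fun x : γ × ℕ => p x.1 x.2)
    (hn : PT n) : PT fun x => _root_.firstTrue (p x) (n x) := by
  refine natIterate (step := fun x t => if p x t then t else t + 1) (init := fun _ => 0)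
    ?_ hn (const 0) hn.size fun x i hi => ?_
  · fun_prop
  · rw [sz_nat, sz_nat]
    exact (firstTrue_le (p x) i).trans hi

-- The iterates stay polynomial in t even in unary: 2 ^ m ≤ 2 t + 1 and 6 ^ m ≤ (2 ^ m) ³.
@[fun_prop]
theorem powers {t : γ → ℕ} (ht : PT t) : PT fun x => _root_.powers (t x) := by
  refine natIterate (step := fun x s => if s.2.1 ≤ t x then (s.1 + 1, 2 * s.2.1, 6 * s.2.2) else s)
    (init := fun _ => (0, 1, 1)) (b := fun x => 4 * (2 * sz (t x) + 1) + (2 * sz (t x) + 1) ^ 3 + 10)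
    (by fun_prop) ht (const _) ?_ fun x i _ => ?_
  · have h : PolyB fun x => 2 * sz (t x) + 1 := ((PolyB.const 2).mul ht.size).add (.const 1)
    exact (((PolyB.const 4).mul h).add (h.pow 3)).add (.const 10)
  · obtain ⟨m, h1, h2, -⟩ := powers_iterate (t x) i
    rw [h1]
    simp only [sz_pair, sz_nat]
    have h3 : m < 2 ^ m := Nat.lt_two_pow_self
    have h4 : 6 ^ m ≤ (2 ^ m) ^ 3 := by
      rw [← pow_mul, mul_comm, pow_mul]; exact Nat.pow_le_pow_left (by norm_num) m
    have h5 : (2 ^ m) ^ 3 ≤ (2 * t x + 1) ^ 3 := Nat.pow_le_pow_left h2 3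
    omega

@[fun_prop]
theorem width {t : γ → ℕ} (ht : PT t) : PT fun x => _root_.width (t x) := by
  unfold _root_.width; fun_prop

-- The cap, applied at every digit, keeps the unary intermediate values short although the binary
-- input may denote a huge number.
@[fun_prop]
theorem cappedVal {c : γ → ℕ} {r : γ → Raw} (hc : PT c) (hr : PT r) :
    PT fun x => _root_.cappedVal (c x) (r x) := by
  unfold _root_.cappedVal
  refine foldl (step := fun x v b => Min.min (2 * v + if b = true then 1 else 0) (c x))
    (init := fun _ => 0) (by fun_prop) (by fun_prop) (const 0) hc.size fun x l' _ => ?_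
  rcases List.eq_nil_or_concat' l' with rfl | ⟨l, b, rfl⟩
  · simp
  · rw [List.foldl_append, sz_nat, sz_nat]
    exact min_le_right _ _

/-- Because B ≤ M, the iterate grows by at most 1 per round, which bounds its unary length. -/
theorem powUpper {B M l : γ → ℕ} (hB : PT B) (hM : PT M) (hl : PT l) (h : ∀ x, B x ≤ M x) :
    PT fun x => _root_.powUpper (B x) (M x) (l x) := by
  refine natIterate (step := fun x u => u * B x / M x + 1) (by fun_prop) hl hM
    (hM.size.add hl.size) fun x i hi => ?_
  suffices ∀ i, (fun u => u * B x / M x + 1)^[i] (M x) ≤ M x + i by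
    simp only [sz_nat]; exact (this i).trans (by omega)
  intro i
  induction i with
  | zero => exact le_rfl
  | succ i ih =>
    rw [Function.iterate_succ_apply']
    have := Nat.div_le_of_le_mul (m := (fun u => u * B x / M x + 1)^[i] (M x) * B x) (k := M x)
      (n := (fun u => u * B x / M x + 1)^[i] (M x)) (by
        rw [mul_comm]; exact Nat.mul_le_mul_right _ (h x))
    omega

theorem powLower {A M l : γ → ℕ} (hA : PT A) (hM : PT M) (hl : PT l) (h : ∀ x, A x ≤ M x) :
    PT fun x => _root_.powLower (A x) (M x) (l x) := by
  refine natIterate (step := fun x u => u * A x / M x) (by fun_prop) hl hM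
    hM.size fun x i hi => ?_
  simp only [sz_nat]
  clear hi
  induction i with
  | zero => exact le_rfl
  | succ i ih =>
    rw [Function.iterate_succ_apply']
    exact (Nat.div_le_of_le_mul (by rw [mul_comm]; exact Nat.mul_le_mul_right _ (h x))).trans ih

theorem goodPair {B A M t l : γ → ℕ} (hB : PT B) (hA : PT A) (hM : PT M) (ht : PT t) (hl : PT l)
    (h : ∀ x, B x ≤ M x) (h' : ∀ x, A x ≤ M x) :
    PT fun x => _root_.goodPair (B x) (A x) (M x) (t x) (l x) := by
  unfold _root_.goodPair
  have h1 := powUpper hB hM hl h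
  have h2 := powLower hA hM (show PT fun x => 2 * l x by fun_prop) h'
  fun_prop

@[fun_prop]
theorem prec {t : γ → ℕ} (ht : PT t) : PT fun x => _root_.prec (t x) := by
  unfold _root_.prec; fun_prop

@[fun_prop]
theorem scale {t : γ → ℕ} (ht : PT t) : PT fun x => _root_.scale (t x) := by
  unfold _root_.scale; fun_prop

section Choice

variable {a b : ℕ → ℕ → ℕ} {k t : γ → ℕ}

theorem upperNum (ha : PT fun p : ℕ × ℕ => Raw.mk (Nat.bits (a (p.1 + 1) p.2)))
    (hk : PT k) (ht : PT t) : PT fun x => _root_.upperNum a (k x) (t x) := by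
  have h := ha.comp (show PT fun x => (k x - 1, _root_.prec (t x)) by fun_prop)
  unfold _root_.upperNum
  simp only at h
  fun_prop

theorem lowerNum (hb : PT fun p : ℕ × ℕ => Raw.mk (Nat.bits (b (p.1 + 1) p.2)))
    (hk : PT k) (ht : PT t) : PT fun x => _root_.lowerNum b (k x) (t x) := by
  have h := hb.comp (show PT fun x => (k x - 1, _root_.prec (t x)) by fun_prop)
  unfold _root_.lowerNum
  simp only at h
  fun_prop

variable (ha : PT fun p : ℕ × ℕ => Raw.mk (Nat.bits (a (p.1 + 1) p.2)))
  (hb : PT fun p : ℕ × ℕ => Raw.mk (Nat.bits (b (p.1 + 1) p.2)))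
include ha hb

theorem goodPair_upperNum_lowerNum {l : γ → ℕ} (hk : PT k) (ht : PT t) (hl : PT l) :
    PT fun x => _root_.goodPair (_root_.upperNum a (k x) (t x)) (_root_.lowerNum b (k x) (t x))
      (_root_.scale (t x)) (t x) (l x) :=
  goodPair (upperNum ha hk ht) (lowerNum hb hk ht) (scale ht) ht hl
    (fun _ => min_le_right _ _) fun _ => Nat.sub_le _ _

theorem xorSize (hk : PT k) (ht : PT t) : PT fun x => _root_.xorSize a b (k x) (t x) := by
  unfold _root_.xorSize
  refine firstTrue (p := fun x => _root_.goodPair (_root_.upperNum a (k x) (t x))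
    (_root_.lowerNum b (k x) (t x)) (_root_.scale (t x)) (t x)) ?_ ht
  exact goodPair_upperNum_lowerNum ha hb (by fun_prop) (by fun_prop) (by fun_prop)

theorem isGood (hk : PT k) (ht : PT t) : PT fun x => _root_.isGood a b (k x) (t x) :=
  goodPair_upperNum_lowerNum ha hb hk ht (xorSize ha hb hk ht)

theorem levelsOf (hk : PT k) (ht : PT t) : PT fun x => _root_.levelsOf a b (k x) (t x) := by
  have h := xorSize ha hb hk ht
  unfold _root_.levelsOf levels
  fun_prop

theorem totalSize (hk : PT k) (ht : PT t) : PT fun x => _root_.totalSize a b (k x) (t x) := by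
  have h := xorSize ha hb hk ht
  unfold _root_.totalSize
  fun_prop

end Choice

end PT

/-! ## Programs for the players -/

/-- The pairs as a bit string. -/
def flat (l : List (Bool × Bool)) : Bits := l.flatMap fun a => [a.1, a.2]

def unflat (l : Bits) : List (Bool × Bool) :=
  (chunks 2 l).map fun c => (c.headD false, c.tail.headD false)

theorem unflat_flat (l : List (Bool × Bool)) : unflat (flat l) = l := by
  rw [unflat, flat, List.flatMap_def, chunks_flatten (by norm_num) _ fun G hG => by
    obtain ⟨a, _, rfl⟩ := List.mem_map.1 hG; rfl, List.map_map]
  exact List.map_id _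

theorem sz_le_of_forall {α : Type} [Enc α] {c : ℕ} {l : List α} (h : ∀ a ∈ l, sz a ≤ c) :
    sz l ≤ l.length * (2 * c + 1) := by
  induction l with
  | nil => simp
  | cons a l ih =>
    have h1 := ih fun x hx => h x (List.mem_cons_of_mem _ hx)
    have h2 := h a List.mem_cons_self
    rw [sz_cons, List.length_cons, add_mul]
    omega

theorem sz_bools_le (l : List Bool) : sz l ≤ 3 * l.length :=
  (sz_le_of_forall (c := 1) fun _ _ => le_rfl).trans (by omega)

theorem sz_pairs_le (l : List (Bool × Bool)) : sz l ≤ 9 * l.length :=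
  (sz_le_of_forall (c := 4) fun _ _ => by simp [sz_pair']).trans (by omega)

theorem length_levelMsg_le (rs : ℕ × ℕ) (l : List (Bool × Bool)) :
    (levelMsg rs l).length ≤ l.length := by
  rw [levelMsg, List.length_flatten, List.map_map]
  have h : ∀ G ∈ chunks rs.2 ((chunks rs.1 l).map xorPairs),
      (List.length ∘ headDiffs) G = rs.2 := fun G hG => by
    simp [headDiffs, (mem_chunks hG).1]
  rw [List.map_congr_left h]
  simp only [List.map_const', length_chunks, List.length_map, List.sum_replicate, smul_eq_mul]
  exact (Nat.div_mul_le_self _ _).trans (Nat.div_le_self _ _)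

theorem length_recvLevel_le (c : Bool) (st : List Bool × List (Bool × Bool)) (rs : ℕ × ℕ) :
    (recvLevel c st rs).1.length ≤ st.1.length ∧ (recvLevel c st rs).2.length ≤ st.2.length := by
  simp only [recvLevel, List.length_map, length_chunks, List.length_zip, List.length_drop]
  refine ⟨?_, Nat.sub_le _ _⟩
  exact (Nat.div_le_self _ _).trans ((min_le_left _ _).trans (Nat.div_le_self _ _))

namespace PT

variable {α β γ : Type} [Enc α] [Enc β] [Enc γ]

@[fun_prop]
theorem xorAll {l : γ → List Bool} (hl : PT l) : PT fun x => _root_.xorAll (l x) := by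
  have h := foldl_of_growth (step := fun (_ : γ) s b => xor b s) (init := fun _ => false)
    (g := fun _ => 0) (by fun_prop) hl.reverse (const _) (.const 0) (fun _ _ _ _ => by simp)
  simpa only [List.foldl_reverse, _root_.xorAll] using h

@[fun_prop]
theorem count {l : γ → List Bool} {c : γ → Bool} (hl : PT l) (hc : PT c) :
    PT fun x => (l x).count (c x) := by
  have h := foldl_of_growth (step := fun (x : γ) (s : ℕ) b => s + if xor b (c x) = true then 0 else 1)
    (init := fun _ => 0) (g := fun _ => 1) (by fun_prop) hl.reverse (const _) (.const 1)
    (fun x s b _ => by simp only [sz_nat]; split <;> omega)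
  refine (congrArg PT (funext fun x => ?_)).mp h
  rw [List.foldl_reverse]
  generalize l x = l
  induction l with
  | nil => rfl
  | cons b l ih =>
    rw [List.foldr_cons, ih, List.count_cons]
    cases b <;> cases c x <;> rfl

@[fun_prop]
theorem maj {l : γ → List Bool} (hl : PT l) : PT fun x => _root_.maj (l x) := by
  unfold _root_.maj; fun_prop

theorem blocks_eq {X : Type} (r m : ℕ) (l : List X) :
    (fun s : List X × List (List X) => (s.1.drop r, s.1.take r :: s.2))^[m] (l, []) =
      (l.drop (m * r), (blocks r m l).reverse) := by
  suffices ∀ acc, (fun s : List X × List (List X) => (s.1.drop r, s.1.take r :: s.2))^[m] (l, acc) =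
      (l.drop (m * r), (blocks r m l).reverse ++ acc) by simpa using this []
  induction m generalizing l with
  | zero => simp [blocks]
  | succ m ih =>
    intro acc
    rw [Function.iterate_succ_apply, ih]
    simp [blocks, Nat.succ_mul, Nat.add_comm]

@[fun_prop]
theorem chunks [Inhabited α] {r : γ → ℕ} {l : γ → List α} (hr : PT r) (hl : PT l) :
    PT fun x => _root_.chunks (r x) (l x) := by
  have h := natIterate
    (step := fun (x : γ) (s : List α × List (List α)) => (s.1.drop (r x), s.1.take (r x) :: s.2))
    (n := fun x => (l x).length / r x) (init := fun x => (l x, []))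
    (b := fun x => 2 * sz (l x) + 1 + sz (l x) * (2 * sz (l x) + 1))
    (by fun_prop) (by fun_prop) (by fun_prop) ?_ fun x i hi => ?_
  · simp only [blocks_eq] at h
    simpa [_root_.chunks] using h.snd'.reverse
  · have h : PolyB fun x => 2 * sz (l x) + 1 := ((PolyB.const 2).mul hl.size).add (.const 1)
    exact h.add (hl.size.mul h)
  · rw [blocks_eq, sz_pair, sz_reverse]
    have h1 : sz ((l x).drop (i * r x)) ≤ sz (l x) := sz_le_of_sublist (List.drop_sublist _ _)
    have h2 : sz (blocks (r x) i (l x)) ≤ i * (2 * sz (l x) + 1) := by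
      have h3 : ∀ G ∈ blocks (r x) i (l x), sz G ≤ sz (l x) := by
        generalize l x = l
        clear hi h1
        induction i generalizing l with
        | zero => simp [blocks]
        | succ i ih =>
          intro G hG
          rcases List.mem_cons.1 hG with rfl | hG
          · exact sz_le_of_sublist (List.take_sublist _ _)
          · exact (ih _ G hG).trans (sz_le_of_sublist (List.drop_sublist _ _))
      simpa [length_blocks] using sz_le_of_forall h3
    have h4 : i ≤ sz (l x) := hi.trans ((Nat.div_le_self _ _).trans (length_le_sz _))
    have h5 : i * (2 * sz (l x) + 1) ≤ sz (l x) * (2 * sz (l x) + 1) := Nat.mul_le_mul_right _ h4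
    omega

@[fun_prop]
theorem xorPairs {l : γ → List (Bool × Bool)} (hl : PT l) : PT fun x => _root_.xorPairs (l x) := by
  unfold _root_.xorPairs
  have h1 : PT fun x => (l x).map Prod.fst := map (f := fun _ => Prod.fst) (by fun_prop) hl
  have h2 : PT fun x => (l x).map Prod.snd := map (f := fun _ => Prod.snd) (by fun_prop) hl
  fun_prop

@[fun_prop]
theorem headPair {l : γ → List (Bool × Bool)} (hl : PT l) : PT fun x => _root_.headPair (l x) := by
  unfold _root_.headPair; fun_prop

@[fun_prop]
theorem headDiffs {l : γ → List (Bool × Bool)} (hl : PT l) :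
    PT fun x => _root_.headDiffs (l x) := by
  unfold _root_.headDiffs
  exact map (f := fun x y => (xor y.1 (_root_.headPair (l x)).1, xor y.2 (_root_.headPair (l x)).2))
    (by fun_prop) hl

@[fun_prop]
theorem levelMsg {rs : γ → ℕ × ℕ} {l : γ → List (Bool × Bool)} (hrs : PT rs) (hl : PT l) :
    PT fun x => _root_.levelMsg (rs x) (l x) := by
  unfold _root_.levelMsg
  have h1 : PT fun x => (_root_.chunks (rs x).1 (l x)).map _root_.xorPairs :=
    map (f := fun _ => _root_.xorPairs) (by fun_prop) (by fun_prop)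
  have h2 : PT fun x => (_root_.chunks (rs x).2 ((_root_.chunks (rs x).1 (l x)).map
      _root_.xorPairs)).map _root_.headDiffs :=
    map (f := fun _ => _root_.headDiffs) (by fun_prop) (by fun_prop)
  fun_prop

@[fun_prop]
theorem combinePairs {rs : γ → ℕ × ℕ} {l : γ → List (Bool × Bool)} (hrs : PT rs) (hl : PT l) :
    PT fun x => combine _root_.xorPairs _root_.headPair (rs x) (l x) := by
  unfold combine
  have h1 : PT fun x => (_root_.chunks (rs x).1 (l x)).map _root_.xorPairs :=
    map (f := fun _ => _root_.xorPairs) (by fun_prop) (by fun_prop)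
  exact map (f := fun _ => _root_.headPair) (by fun_prop) (by fun_prop)

theorem length_combine_le {X : Type} (f g : List X → X) (rs : ℕ × ℕ) (l : List X) :
    (combine f g rs l).length ≤ l.length := by
  rw [length_combine]
  exact (Nat.div_le_self _ _).trans (Nat.div_le_self _ _)

theorem foldl_sendMsg (lv : List (ℕ × ℕ)) (l acc : List (Bool × Bool)) :
    lv.foldl (fun (s : List (Bool × Bool) × List (Bool × Bool)) rs =>
      (combine _root_.xorPairs _root_.headPair rs s.1, s.2 ++ _root_.levelMsg rs s.1)) (l, acc) =
      (combines _root_.xorPairs _root_.headPair lv l, acc ++ sendMsg lv l) := by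
  induction lv generalizing l acc with
  | nil => simp [sendMsg]
  | cons rs lv ih => rw [List.foldl_cons, ih]; simp [sendMsg]

theorem length_combines_le {X : Type} (f g : List X → X) (lv : List (ℕ × ℕ)) (l : List X) :
    (combines f g lv l).length ≤ l.length := by
  induction lv generalizing l with
  | nil => exact le_rfl
  | cons rs lv ih => rw [combines_cons]; exact (ih _).trans (length_combine_le f g rs l)

theorem length_sendMsg_le (lv : List (ℕ × ℕ)) (l : List (Bool × Bool)) :
    (sendMsg lv l).length ≤ lv.length * l.length := by
  induction lv generalizing l with
  | nil => simp [sendMsg]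
  | cons rs lv ih =>
    rw [sendMsg, List.length_append, List.length_cons, add_mul, one_mul]
    have h1 := (ih (combine _root_.xorPairs _root_.headPair rs l)).trans
      (Nat.mul_le_mul_left _ (length_combine_le _ _ rs l))
    have h2 := length_levelMsg_le rs l
    omega

/-- One fold produces both the remaining pairs and the message. The pairs never become more numerous
and each level adds at most as many differences, which bounds all intermediate states. -/
theorem sender {lv : γ → List (ℕ × ℕ)} {l : γ → List (Bool × Bool)} (hlv : PT lv) (hl : PT l) :
    PT fun x => (combines _root_.xorPairs _root_.headPair (lv x) (l x), sendMsg (lv x) (l x)) := by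
  have h := foldl (step := fun (_ : γ) (s : List (Bool × Bool) × List (Bool × Bool)) rs =>
      (combine _root_.xorPairs _root_.headPair rs s.1, s.2 ++ _root_.levelMsg rs s.1))
    (init := fun x => (l x, [])) (b := fun x => 2 * (9 * sz (l x)) + 1 + 9 * (sz (lv x) * sz (l x)))
    (by fun_prop) hlv (by fun_prop) ?_ fun x l' hl' => ?_
  · simpa [foldl_sendMsg] using h
  · exact (((PolyB.const 2).mul ((PolyB.const 9).mul hl.size)).add (.const 1)).add
      ((PolyB.const 9).mul (hlv.size.mul hl.size))
  · rw [foldl_sendMsg, sz_pair, List.nil_append]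
    have h1 := length_combines_le _root_.xorPairs _root_.headPair l' (l x)
    have h2 := length_sendMsg_le l' (l x)
    have h3 := sz_pairs_le (combines _root_.xorPairs _root_.headPair l' (l x))
    have h4 := sz_pairs_le (sendMsg l' (l x))
    have h5 := length_le_sz (l x)
    have h6 : l'.length * (l x).length ≤ sz (lv x) * sz (l x) :=
      Nat.mul_le_mul (hl'.length_le.trans (length_le_sz _)) h5
    omega

@[fun_prop]
theorem choiceDiffs {l : γ → List (Bool × Bool)} (hl : PT l) :
    PT fun x => _root_.choiceDiffs (l x) := by
  unfold _root_.choiceDiffs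
  exact map (f := fun x y => xor y.1 (_root_.headPair (l x)).1) (by fun_prop) hl

@[fun_prop]
theorem align {l : γ → List (Bool × Bool)} {d : γ → List Bool} (hl : PT l) (hd : PT d) :
    PT fun x => _root_.align (l x) (d x) := by
  unfold _root_.align
  exact map (f := fun _ (p : (Bool × Bool) × Bool) => (p.1.1, xor p.1.2 (p.1.1 && p.2))) (by fun_prop) (by fun_prop)

variable {lv : γ → List (ℕ × ℕ)} {l : γ → List (Bool × Bool)}

@[fun_prop]
theorem senderMsg {d : γ → List Bool} (hlv : PT lv) (hl : PT l) (hd : PT d) :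
    PT fun x => _root_.senderMsg (lv x) (l x) (d x) :=
  (sender hlv (hl.align hd)).snd'

@[fun_prop]
theorem senderOut {d : γ → List Bool} (hlv : PT lv) (hl : PT l) (hd : PT d) :
    PT fun x => _root_.senderOut (lv x) (l x) (d x) :=
  (sender hlv (hl.align hd)).fst'.headPair

theorem recvLevel {c : γ → Bool} {s : γ → List Bool × List (Bool × Bool)} {rs : γ → ℕ × ℕ}
    (hc : PT c) (hs : PT s) (hrs : PT rs) :
    PT fun x => _root_.recvLevel (c x) (s x) (rs x) := by
  unfold _root_.recvLevel
  have h1 : PT fun x => (_root_.chunks (rs x).1 (s x).1).map _root_.xorAll :=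
    map (f := fun _ => _root_.xorAll) (by fun_prop) (by fun_prop)
  have h2 : PT fun x => (((_root_.chunks (rs x).1 (s x).1).map _root_.xorAll).zip (s x).2).map
      fun p => xor p.1 (xor p.2.2 (c x && p.2.1)) :=
    map (f := fun x (p : Bool × (Bool × Bool)) => xor p.1 (xor p.2.2 (c x && p.2.1))) (by fun_prop) (by fun_prop)
  have h3 : PT fun x => (_root_.chunks (rs x).2
      ((((_root_.chunks (rs x).1 (s x).1).map _root_.xorAll).zip (s x).2).map
        fun p => xor p.1 (xor p.2.2 (c x && p.2.1)))).map _root_.maj :=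
    map (f := fun _ => _root_.maj) (by fun_prop) (by fun_prop)
  fun_prop

@[fun_prop]
theorem recvRoot {c : γ → Bool} {ys : γ → List Bool} (hc : PT c) (hlv : PT lv) (hys : PT ys)
    (hl : PT l) : PT fun x => _root_.recvRoot (c x) (lv x) (ys x) (l x) := by
  unfold _root_.recvRoot
  have h : PT fun x => (lv x).foldl (_root_.recvLevel (c x)) (ys x, l x) := by
    refine foldl (b := fun x => 2 * (3 * sz (ys x)) + 1 + 9 * sz (l x)) ?_ hlv (by fun_prop) ?_
      fun x l' _ => ?_
    · exact recvLevel (by fun_prop) (by fun_prop) (by fun_prop)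
    · exact (((PolyB.const 2).mul ((PolyB.const 3).mul hys.size)).add (.const 1)).add
        ((PolyB.const 9).mul hl.size)
    · have key : ∀ (l' : List (ℕ × ℕ)) (s : List Bool × List (Bool × Bool)),
          (l'.foldl (_root_.recvLevel (c x)) s).1.length ≤ s.1.length ∧
          (l'.foldl (_root_.recvLevel (c x)) s).2.length ≤ s.2.length := by
        intro l'
        induction l' with
        | nil => exact fun s => ⟨le_rfl, le_rfl⟩
        | cons rs l' ih =>
          intro s
          have h1 := ih (_root_.recvLevel (c x) s rs)
          have h2 := length_recvLevel_le (c x) s rs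
          exact ⟨h1.1.trans h2.1, h1.2.trans h2.2⟩
      obtain ⟨h1, h2⟩ := key l' (ys x, l x)
      rw [sz_pair']
      have h3 := sz_bools_le (l'.foldl (_root_.recvLevel (c x)) (ys x, l x)).1
      have h4 := sz_pairs_le (l'.foldl (_root_.recvLevel (c x)) (ys x, l x)).2
      have h5 := length_le_sz (ys x)
      have h6 := length_le_sz (l x)
      simp only at h1 h2
      omega
  exact h.fst'.headD' false

@[fun_prop]
theorem receiverOut {m : γ → List (Bool × Bool)} (hlv : PT lv) (hl : PT l) (hm : PT m) :
    PT fun x => _root_.receiverOut (lv x) (l x) (m x) := by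
  unfold _root_.receiverOut
  have h : PT fun x => (l x).map Prod.snd := map (f := fun _ => Prod.snd) (by fun_prop) hl
  fun_prop

@[fun_prop]
theorem flat (hl : PT l) : PT fun x => _root_.flat (l x) := by
  have h : PT fun x => ((l x).map fun a => [a.1, a.2]).flatten :=
    (map (f := fun _ a => [a.1, a.2]) (by fun_prop) hl).flatten
  simpa only [_root_.flat, List.flatMap_def] using h

@[fun_prop]
theorem unflat {b : γ → List Bool} (hb : PT b) : PT fun x => _root_.unflat (b x) := by
  unfold _root_.unflat
  exact map (f := fun _ (c : List Bool) => (c.headD false, c.tail.headD false)) (by fun_prop) (by fun_prop)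

end PT

instance : Inhabited Raw := ⟨⟨[]⟩⟩

theorem length_flat (l : List (Bool × Bool)) : (flat l).length = 2 * l.length := by
  simp [flat, List.length_flatMap, mul_comm]

/-! ## Protocols without random bits, given by functions on lists -/

/-- The players' functions get the parameter, the list of their outputs from the instances and the
list of the messages. -/
structure ListProtocol where
  rounds : ℕ
  msgA : ℕ → List (Bool × Bool) → List (List Bool) → List Bool
  msgB : ℕ → List (Bool × Bool) → List (List Bool) → List Bool
  outA : ℕ → List (Bool × Bool) → List (List Bool) → Bool × Bool
  outB : ℕ → List (Bool × Bool) → List (List Bool) → Bool × Bool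

namespace ListProtocol

variable (L : ListProtocol)

def toProtocol (k n : ℕ) : Protocol n 0 where
  rounds := L.rounds
  msgA xs _ l := L.msgA k (List.ofFn xs) l
  msgB ys _ l := L.msgB k (List.ofFn ys) l
  outA xs _ l := L.outA k (List.ofFn xs) l
  outB ys _ l := L.outB k (List.ofFn ys) l

/-- The first `t` messages. -/
def messages (k : ℕ) (xs ys : List (Bool × Bool)) : ℕ → List (List Bool)
  | 0 => []
  | t + 1 => messages k xs ys t ++
      [if Even t then L.msgB k ys (messages k xs ys t) else L.msgA k xs (messages k xs ys t)]

def outcome (k : ℕ) (xs ys : List (Bool × Bool)) : Outcome :=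
  (L.outA k xs (L.messages k xs ys L.rounds), L.outB k ys (L.messages k xs ys L.rounds))

variable {L}

theorem transcript_eq {k n : ℕ} (xs ys : Fin n → Bool × Bool) (ra rb : Fin 0 → Bool) (t : ℕ) :
    (L.toProtocol k n).transcript xs ys ra rb t =
      L.messages k (List.ofFn xs) (List.ofFn ys) t := by
  induction t with
  | zero => rfl
  | succ t ih => rw [Protocol.transcript, ih]; rfl

theorem fullTranscript_eq {k n : ℕ} (xs ys : Fin n → Bool × Bool) (ra rb : Fin 0 → Bool) :
    (L.toProtocol k n).fullTranscript xs ys ra rb =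
      L.messages k (List.ofFn xs) (List.ofFn ys) L.rounds :=
  transcript_eq xs ys ra rb _

theorem outcome_eq {k n : ℕ} (xs ys : Fin n → Bool × Bool) (ra rb : Fin 0 → Bool) :
    (L.toProtocol k n).outcome xs ys ra rb = L.outcome k (List.ofFn xs) (List.ofFn ys) := by
  rw [Protocol.outcome, fullTranscript_eq]; rfl

/-! ### Efficiency -/

/-- Polynomial time computable functions of a player. -/
def PolyTime {α : Type} [Enc α] (m : ℕ → List (Bool × Bool) → List (List Bool) → α) : Prop :=
  PT fun p : ℕ × List (Bool × Bool) × List (List Bool) => m p.1 p.2.1 p.2.2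

/-- The prescribed input format agrees with the encodings of a number, of two raw strings and of a
list of raw strings, so a `PT` program on these four arguments can be used directly. -/
theorem PolyTime.exists_cmd {m : ℕ → List (Bool × Bool) → List (List Bool) → List Bool}
    (h : PolyTime m) {n : ℕ → ℕ} (Q : Polynomial ℕ) :
    ∃ (c : Cmd) (P : Polynomial ℕ), ∀ k (w : Fin (n k) → Bool × Bool) (r : Fin 0 → Bool) l,
      (encodeMessages l).length ≤ Q.eval (k + n k) →
      c.OutputsWithin (playerInput k w r l) (P.eval (k + n k)) (m k (List.ofFn w) l) := by
  have h1 : PT fun p : ℕ × Raw × Raw × List Raw =>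
      Raw.mk (m p.1 (unflat p.2.1.bits) (p.2.2.2.map Raw.bits)) := by
    have h2 : PT fun p : ℕ × Raw × Raw × List Raw => p.2.2.2.map Raw.bits :=
      PT.map (f := fun _ => Raw.bits) (by fun_prop) (by fun_prop)
    have h3 := h.comp (show PT fun p : ℕ × Raw × Raw × List Raw =>
      (p.1, unflat p.2.1.bits, p.2.2.2.map Raw.bits) by fun_prop)
    exact h3.rawMk
  obtain ⟨c, P, hc⟩ := h1.outputsWithin₄
  refine ⟨c, P.comp (3 * Polynomial.X + Q), fun k w r l hl => ?_⟩
  have h2 := hc k ⟨encodePairs w⟩ ⟨List.ofFn r⟩ (l.map Raw.mk)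
  have e1 : Enc.enc (l.map Raw.mk) = encodeMessages l := by
    simp only [Enc.enc, encodeMessages, List.flatMap_map]; rfl
  have e2 : encodePairs w = flat (List.ofFn w) := rfl
  have e3 : (l.map Raw.mk).map Raw.bits = l := by
    rw [List.map_map]; exact List.map_id l
  simp only [e1, e2, e3, unflat_flat] at h2
  obtain ⟨t, ht, h3⟩ := h2
  refine ⟨t, ht.trans ?_, h3⟩
  rw [Polynomial.eval_comp]
  refine Polynomial.eval_mono_nat P ?_
  have e4 : sz (List.map Raw.mk l) = (encodeMessages l).length := by rw [sz, e1]
  rw [e4, sz_nat, sz_raw, sz_raw, length_flat]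
  simp only [List.length_ofFn, Polynomial.eval_add, Polynomial.eval_mul, Polynomial.eval_X,
    Polynomial.eval_ofNat]
  omega

theorem isEfficient {n : ℕ → ℕ} (hA : PolyTime L.msgA) (hB : PolyTime L.msgB)
    (hoA : PolyTime L.outA) (hoB : PolyTime L.outB)
    (hn : ∃ (c : Cmd) (P : Polynomial ℕ), ∀ k ≥ 1,
      c.OutputsWithin [unary k] (P.eval (k + n k)) (unary (n k)))
    (hlen : ∃ Q : Polynomial ℕ, ∀ k ≥ 1, ∀ xs ys : List (Bool × Bool), xs.length = n k →
      ys.length = n k → ∀ t ≤ L.rounds,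
        (encodeMessages (L.messages k xs ys t)).length ≤ Q.eval (k + n k)) :
    IsEfficient n (fun _ => 0) fun k => L.toProtocol k (n k) := by
  obtain ⟨Q, hQ⟩ := hlen
  have hbits : ∀ {m : ℕ → List (Bool × Bool) → List (List Bool) → Bool × Bool}, PolyTime m →
      PolyTime fun k w l => [(m k w l).1, (m k w l).2] := fun hm => by
    unfold PolyTime at *
    fun_prop
  obtain ⟨cn, P₁, h1⟩ := hn
  obtain ⟨cr, P₂, h2⟩ := (PT.const (α := ℕ) (0 : ℕ)).outputsWithin
  obtain ⟨ct, P₃, h3⟩ := (PT.const (α := ℕ) L.rounds).outputsWithin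
  obtain ⟨mA, P₄, h4⟩ := hA.exists_cmd (n := n) Q
  obtain ⟨mB, P₅, h5⟩ := hB.exists_cmd (n := n) Q
  obtain ⟨oA, P₆, h6⟩ := (hbits hoA).exists_cmd (n := n) Q
  obtain ⟨oB, P₇, h7⟩ := (hbits hoB).exists_cmd (n := n) Q
  have mono : ∀ {c : Cmd} {ins : List Bits} {s t : ℕ} {out : Bits}, c.OutputsWithin ins s out →
      s ≤ t → c.OutputsWithin ins t out := fun ⟨s, hs, h⟩ hst => ⟨s, hs.trans hst, h⟩
  refine ⟨P₁ + P₂ + P₃ + P₄ + P₅ + P₆ + P₇, cn, cr, ct, mA, mB, oA, oB, fun k hk => ?_⟩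
  have hk' : sz k ≤ k + n k := by rw [sz_nat]; omega
  have h2' := P₂.eval_mono_nat hk'
  have h3' := P₃.eval_mono_nat hk'
  simp only [Polynomial.eval_add]
  refine ⟨mono (h1 k hk) (by omega), mono (h2 k) (by omega), mono (h3 k) (by omega),
    fun xs ys ra rb => ⟨fun t ht => ⟨fun _ => ?_, fun _ => ?_⟩, ?_, ?_⟩⟩
  · rw [transcript_eq]
    exact mono (h5 k ys rb _ (hQ k hk _ _ (by simp) (by simp) t (le_of_lt ht))) (by omega)
  · rw [transcript_eq]
    exact mono (h4 k xs ra _ (hQ k hk _ _ (by simp) (by simp) t (le_of_lt ht))) (by omega)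
  · rw [outcome_eq, fullTranscript_eq]
    exact mono (h6 k xs ra _ (hQ k hk _ _ (by simp) (by simp) _ le_rfl)) (by omega)
  · rw [outcome_eq, fullTranscript_eq]
    exact mono (h7 k ys rb _ (hQ k hk _ _ (by simp) (by simp) _ le_rfl)) (by omega)

end ListProtocol

end

noncomputable section

/-! ## The two protocols -/

/-- The pair `(x₀ ⊕ x₁, x₀)` which the sender derives from `(x₀, x₁)`. -/
def toPair (x : Bool × Bool) : Bool × Bool := (xor x.1 x.2, x.1)

def ofPair (p : Bool × Bool) : Bool × Bool := (p.2, xor p.2 p.1)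

@[simp] theorem ofPair_toPair (x : Bool × Bool) : ofPair (toPair x) = x := by
  obtain ⟨a, b⟩ := x; cases a <;> cases b <;> rfl

@[simp] theorem toPair_ofPair (x : Bool × Bool) : toPair (ofPair x) = x := by
  obtain ⟨a, b⟩ := x; cases a <;> cases b <;> rfl

theorem errorBit_eq (o : Outcome) : errorBit o = errPair (toPair o.1) o.2 := by
  obtain ⟨⟨a, b⟩, c, d⟩ := o
  cases a <;> cases b <;> cases c <;> cases d <;> rfl

theorem errPair_comm (x y : Bool × Bool) : errPair x y = errPair y x := by
  rw [errPair, errPair, Bool.xor_comm x.2, Bool.and_comm]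

variable (lv : ℕ → ℕ → List (ℕ × ℕ))

/-- Player A is the sender. -/
def senderA : ListProtocol where
  rounds := 2
  msgA k xs l := flat (senderMsg (lv k xs.length) (xs.map toPair) (l.headD []))
  msgB _ ys _ := choiceDiffs ys
  outA k xs l := ofPair (senderOut (lv k xs.length) (xs.map toPair) (l.headD []))
  outB k ys l := receiverOut (lv k ys.length) ys (unflat (l.tail.headD []))

/-- Player B is the sender. The first message is empty. -/
def senderB : ListProtocol where
  rounds := 3
  msgA _ xs _ := choiceDiffs (xs.map toPair)
  msgB k ys l := if l = [] then [] else flat (senderMsg (lv k ys.length) ys (l.tail.headD []))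
  outA k xs l := ofPair (receiverOut (lv k xs.length) (xs.map toPair) (unflat (l.tail.tail.headD [])))
  outB k ys l := senderOut (lv k ys.length) ys (l.tail.headD [])

variable {lv}

theorem messages_senderA (k : ℕ) (xs ys : List (Bool × Bool)) :
    (senderA lv).messages k xs ys 2 = [choiceDiffs ys,
      flat (senderMsg (lv k xs.length) (xs.map toPair) (choiceDiffs ys))] := by
  simp [ListProtocol.messages, senderA]

theorem messages_senderB (k : ℕ) (xs ys : List (Bool × Bool)) :
    (senderB lv).messages k xs ys 3 = [[], choiceDiffs (xs.map toPair),
      flat (senderMsg (lv k ys.length) ys (choiceDiffs (xs.map toPair)))] := by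
  have h : ¬ Even 1 := by decide
  have h2 : Even 2 := by decide
  simp [ListProtocol.messages, senderB, h, h2]

theorem outcome_senderA (k : ℕ) (xs ys : List (Bool × Bool)) :
    (senderA lv).outcome k xs ys =
      (ofPair (senderOut (lv k xs.length) (xs.map toPair) (choiceDiffs ys)),
        receiverOut (lv k ys.length) ys
          (senderMsg (lv k xs.length) (xs.map toPair) (choiceDiffs ys))) := by
  have h : (senderA lv).rounds = 2 := rfl
  rw [ListProtocol.outcome, h, messages_senderA]
  simp [senderA, unflat_flat]

theorem outcome_senderB (k : ℕ) (xs ys : List (Bool × Bool)) :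
    (senderB lv).outcome k xs ys =
      (ofPair (receiverOut (lv k xs.length) (xs.map toPair)
          (senderMsg (lv k ys.length) ys (choiceDiffs (xs.map toPair)))),
        senderOut (lv k ys.length) ys (choiceDiffs (xs.map toPair))) := by
  have h : (senderB lv).rounds = 3 := rfl
  rw [ListProtocol.outcome, h, messages_senderB]
  simp [senderB, unflat_flat]

theorem errorBit_senderA {k n : ℕ} (hlv : LvPos (lv k n)) (hn : n = lvSize (lv k n))
    (xs ys : Fin n → Bool × Bool) :
    errorBit ((senderA lv).outcome k (List.ofFn xs) (List.ofFn ys)) =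
      errRoot (lv k n) (List.ofFn fun i => errPair (toPair (xs i)) (ys i)) := by
  have h := protocol_correct hlv (List.ofFn fun i => (toPair (xs i), ys i))
    (by simpa using hn)
  simp only [List.map_ofFn, Function.comp_def] at h
  rw [errorBit_eq, outcome_senderA]
  simpa [List.map_ofFn, Function.comp_def] using h

theorem errorBit_senderB {k n : ℕ} (hlv : LvPos (lv k n)) (hn : n = lvSize (lv k n))
    (xs ys : Fin n → Bool × Bool) :
    errorBit ((senderB lv).outcome k (List.ofFn xs) (List.ofFn ys)) =
      errRoot (lv k n) (List.ofFn fun i => errPair (ys i) (toPair (xs i))) := by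
  have h := protocol_correct hlv (List.ofFn fun i => (ys i, toPair (xs i)))
    (by simpa using hn)
  simp only [List.map_ofFn, Function.comp_def] at h
  rw [errorBit_eq, outcome_senderB, errPair_comm]
  simpa [List.map_ofFn, Function.comp_def] using h

/-! ### The systems which result -/

section Run

variable {L : ListProtocol} {k n : ℕ} {U V : Type} (F : Fin n → SemiHonestSystem U V)

theorem honest_run : ((L.toProtocol k n).run F).honest =
    (indep n fun i => (F i).honest).map fun w =>
      L.outcome k (List.ofFn fun i => (w i).1) (List.ofFn fun i => (w i).2) := by
  simp only [Protocol.run, ListProtocol.outcome_eq, PMF.bind_const]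
  rfl

theorem corruptA_run : ((L.toProtocol k n).run F).corruptA =
    (indep n fun i => (F i).corruptA).map fun w =>
      (L.outcome k (List.ofFn fun i => (w i).1.1) (List.ofFn fun i => (w i).1.2),
        (fun i => ((w i).1.1, (w i).2)), Fin.elim0,
        L.messages k (List.ofFn fun i => (w i).1.1) (List.ofFn fun i => (w i).1.2) L.rounds) := by
  have h : ∀ ra : Fin 0 → Bool, ra = Fin.elim0 := fun ra => Subsingleton.elim _ _
  simp only [Protocol.run, ListProtocol.outcome_eq, ListProtocol.fullTranscript_eq, h,
    PMF.bind_const]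
  rfl

theorem corruptB_run : ((L.toProtocol k n).run F).corruptB =
    (indep n fun i => (F i).corruptB).map fun w =>
      (L.outcome k (List.ofFn fun i => (w i).1.1) (List.ofFn fun i => (w i).1.2),
        (fun i => ((w i).1.2, (w i).2)), Fin.elim0,
        L.messages k (List.ofFn fun i => (w i).1.1) (List.ofFn fun i => (w i).1.2) L.rounds) := by
  have h : ∀ ra : Fin 0 → Bool, ra = Fin.elim0 := fun ra => Subsingleton.elim _ _
  simp only [Protocol.run, ListProtocol.outcome_eq, ListProtocol.fullTranscript_eq, h,
    PMF.bind_const]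
  rfl

end Run

/-! ### Reformulation of the security conditions -/

/-- This is X_{1-C} = (X₀ ⊕ X₁) ⊕ Y ⊕ E in terms of signs. -/
theorem sgn_select (o : Outcome) : sgn (select o.1 (!o.2.1)) =
    sgn (toPair o.1).1 * (sgn o.2.2 * sgn (errorBit o)) := by
  obtain ⟨⟨a, b⟩, c, d⟩ := o
  cases a <;> cases b <;> cases c <;> cases d <;> simp [sgn, select, errorBit, toPair]

theorem abs_sgn_mul_sgn_mul (a b : Bool) (r : ℝ) : |sgn a * sgn b * r| = |r| := by
  rw [mul_assoc, abs_sgn_mul, abs_sgn_mul]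

/-- `X_{1-C}` can be replaced by `X₀ ⊕ X₁ = X_{1-C} ⊕ Y ⊕ E`. -/
theorem predAdv_other_le_iff {W : Type} (μ : PMF (Outcome × W)) (q : ℝ) :
    predAdv (μ.map fun w => (select w.1.1 (!w.1.2.1), ((w.1.2, w.2), errorBit w.1))) ≤ q ↔
      AdvLe (μ.map fun w => ((toPair w.1.1).1, ((w.1.2, w.2), errorBit w.1))) q := by
  rw [predAdv_le_iff, AdvLe.map_iff, AdvLe.map_iff]
  have hsq : ∀ b : Bool, sgn b * sgn b = 1 := fun b => by cases b <;> simp [sgn]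
  constructor
  · intro h g hg
    have := h (fun y => sgn y.1.1.2 * sgn y.2 * g y) fun y => by
      rw [abs_sgn_mul_sgn_mul]; exact hg y
    refine le_of_eq_of_le (ev_congr _ fun w _ => ?_) this
    simp only [sgn_select]
    linear_combination (-(sgn (toPair w.1.1).1 * g ((w.1.2, w.2), errorBit w.1))) *
      (hsq w.1.2.2 * (sgn (errorBit w.1) * sgn (errorBit w.1)) + hsq (errorBit w.1))
  · intro h g hg
    have := h (fun y => sgn y.1.1.2 * sgn y.2 * g y) fun y => by
      rw [abs_sgn_mul_sgn_mul]; exact hg y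
    refine le_of_eq_of_le (ev_congr _ fun w _ => ?_) this
    simp only [sgn_select]
    ring

theorem AdvLe.comp_snd {X Y Z : Type} {ν : PMF X} {f : X → Bool × Y} {q : ℝ}
    (h : AdvLe (ν.map f) q) (φ : Y → Z) :
    AdvLe (ν.map fun x => ((f x).1, φ (f x).2)) q := by
  rw [AdvLe.map_iff] at h ⊢
  exact fun g hg => h (fun y => g (φ y)) fun y => hg _

/-! ### Independent instances as functions and as lists -/

theorem ev_indep {n : ℕ} {X Y : Type} (ν : Fin n → PMF X) (f : X → Y) {H : List Y → ℝ} {K : ℝ}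
    (hH : ∀ l, |H l| ≤ K) :
    ev (indep n ν) (fun w => H (List.ofFn fun i => f (w i))) =
      ev (seqL (List.ofFn fun i => (ν i).map f)) H := by
  have e : (List.ofFn fun i => (ν i).map f) = (List.ofFn ν).map fun μ => μ.map f := by
    rw [List.map_ofFn]; rfl
  rw [e, ← seqL_map, ← indep_map_ofFn, PMF.map_comp, ev_map _ _ hH]
  refine ev_congr _ fun w _ => ?_
  simp only [Function.comp_apply, List.map_ofFn]
  rfl

/-- Views are functions on `Fin n`, while the security bounds speak of lists. Lists of another
length never occur, and 0 is an admissible value for them. -/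
theorem exists_extend {n : ℕ} {X S : Type} (φ : (Fin n → X) → S → ℝ) (hφ : ∀ r s, |φ r s| ≤ 1) :
    ∃ ψ : List X → S → ℝ, (∀ l s, |ψ l s| ≤ 1) ∧ ∀ r s, ψ (List.ofFn r) s = φ r s := by
  classical
  refine ⟨fun l s => if h : ∃ r, List.ofFn r = l then φ h.choose s else 0, fun l s => ?_,
    fun r s => ?_⟩
  · dsimp only
    split
    · exact hφ _ _
    · simp
  · have h : ∃ r', List.ofFn r' = List.ofFn r := ⟨r, rfl⟩
    dsimp only
    rw [dif_pos h, List.ofFn_injective h.choose_spec]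

section Indep

variable {n : ℕ} {W X : Type} {lv : List (ℕ × ℕ)} (ν : Fin n → PMF X) (f : X → Record W)

theorem receiver_secure_indep (hlv : LvPos lv) (hn : n = lvSize lv) {q : ℝ} (hq : 0 ≤ q)
    (hν : ∀ i, AdvLe ((ν i).map fun x => forReceiver (f x)) q)
    (φ : (Fin n → (Bool × Bool) × W) → List (Bool × Bool) → Bool → ℝ)
    (hφ : ∀ r m e, |φ r m e| ≤ 1) :
    (ev (indep n ν) fun w =>
      sgn (senderOut lv (List.ofFn fun i => (f (w i)).1)
        (choiceDiffs (List.ofFn fun i => (f (w i)).2.1))).1 *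
      φ (fun i => (f (w i)).2)
        (senderMsg lv (List.ofFn fun i => (f (w i)).1)
          (choiceDiffs (List.ofFn fun i => (f (w i)).2.1)))
        (errRoot lv (List.ofFn fun i => errPair (f (w i)).1 (f (w i)).2.1))) ≤ advBound lv q := by
  obtain ⟨ψ, hψ, e⟩ := exists_extend (fun r (s : List (Bool × Bool) × Bool) => φ r s.1 s.2)
    fun r s => hφ r s.1 s.2
  have h := receiver_secure hlv hq (μs := List.ofFn fun i => (ν i).map f) (by simpa using hn)
    (fun μ hμ => by
      obtain ⟨i, rfl⟩ := (List.mem_ofFn' _ _).1 hμ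
      rw [PMF.map_comp]
      exact hν i) (fun r m e => ψ r (m, e)) fun _ _ _ => hψ _ _
  rw [← ev_indep (K := 1) ν f fun l => by rw [abs_sgn_mul]; exact hψ _ _] at h
  simp only [List.map_ofFn, Function.comp_def, e] at h
  exact h

theorem sender_secure_indep (hn : 0 < n)
    (hν : ∀ i, AdvLe ((ν i).map fun x => forSender (f x)) 0)
    (φ : (Fin n → (Bool × Bool) × W) → List Bool → Bool → ℝ) (hφ : ∀ r m e, |φ r m e| ≤ 1) :
    (ev (indep n ν) fun w =>
      sgn (headPair (List.ofFn fun i => (f (w i)).2.1)).1 *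
      φ (fun i => ((f (w i)).1, (f (w i)).2.2))
        (choiceDiffs (List.ofFn fun i => (f (w i)).2.1))
        (errRoot lv (List.ofFn fun i => errPair (f (w i)).1 (f (w i)).2.1))) ≤ 0 := by
  obtain ⟨ψ, hψ, e⟩ := exists_extend (fun r (s : List Bool × Bool) => φ r s.1 s.2)
    fun r s => hφ r s.1 s.2
  have h := sender_secure lv (μs := List.ofFn fun i => (ν i).map f)
    (fun h => by rw [List.ofFn_eq_nil_iff] at h; omega)
    (fun μ hμ => by
      obtain ⟨i, rfl⟩ := (List.mem_ofFn' _ _).1 hμ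
      rw [PMF.map_comp]
      exact hν i) (fun r m e => ψ r (m, e)) fun _ _ _ => hψ _ _
  rw [← ev_indep (K := 1) ν f fun l => by rw [abs_sgn_mul]; exact hψ _ _] at h
  simp only [List.map_ofFn, Function.comp_def, e] at h
  exact h

end Indep

end

/-! ### Correctness, security and efficiency of the two protocols -/

noncomputable section

/-- The errors of the instances are independent, and the error of the protocol depends on them
alone. -/
theorem prob_error_le {L : ListProtocol} {k n : ℕ} {lv : List (ℕ × ℕ)} {U V : Type}
    (F : Fin n → SemiHonestSystem U V) {ε δ : ℝ} (hn : n = lvSize lv)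
    (hL : ∀ xs ys : Fin n → Bool × Bool, errorBit (L.outcome k (List.ofFn xs) (List.ofFn ys)) =
      errRoot lv (List.ofFn fun i => errorBit (xs i, ys i)))
    (hF : ∀ i, prob (F i).honest {o | errorBit o = true} ≤ ε)
    (herr : ∀ μs : List (PMF Bool), μs.length = lvSize lv → (∀ μ ∈ μs, 1 - 2 * ε ≤ ev μ sgn) →
      ((seqL μs).map (errRoot lv) true).toReal ≤ δ) :
    prob ((L.toProtocol k n).run F).honest {o | errorBit o = true} ≤ δ := by
  have hbd : ∀ b : Bool, |(if b = true then (1 : ℝ) else 0)| ≤ 1 := fun b => by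
    cases b <;> simp
  have hprob : ∀ μ : PMF Outcome, prob μ {o | errorBit o = true} =
      ev μ fun o => if errorBit o = true then 1 else 0 := fun μ => prob_eq_ev μ _
  have htrue : ∀ μ : PMF Bool, (μ true).toReal = ev μ fun b => if b = true then 1 else 0 :=
    fun μ => by rw [ev_bool]; simp
  rw [hprob, honest_run, ev_map _ _ fun o => hbd _]
  simp only [hL]
  rw [ev_indep (K := 1) (fun i => (F i).honest) errorBit
    (H := fun l => if errRoot lv l = true then 1 else 0) fun l => hbd _]
  have h := herr (List.ofFn fun i => (F i).honest.map errorBit) (by simpa using hn) fun μ hμ => by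
    obtain ⟨i, rfl⟩ := (List.mem_ofFn' _ _).1 hμ
    have h1 := hF i
    rw [hprob] at h1
    rw [ev_sgn, htrue, ev_map _ _ hbd]
    linarith
  rwa [htrue, ev_map _ _ hbd] at h

section Security

variable {k n : ℕ} {lv : ℕ → ℕ → List (ℕ × ℕ)} {U V : Type} {F : Fin n → SemiHonestSystem U V}
  {q ε δ : ℝ}

theorem isWOT_senderA (hlv : LvPos (lv k n)) (hn : n = lvSize (lv k n)) (hn0 : 0 < n)
    (hF : ∀ i, (F i).IsWOT 0 q ε) (hq : 0 ≤ q) (hadv : advBound (lv k n) q ≤ δ)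
    (herr : ∀ μs : List (PMF Bool), μs.length = lvSize (lv k n) →
      (∀ μ ∈ μs, 1 - 2 * ε ≤ ev μ sgn) → ((seqL μs).map (errRoot (lv k n)) true).toReal ≤ δ) :
    (((senderA lv).toProtocol k n).run F).IsWOT 0 δ δ := by
  have hr : (senderA lv).rounds = 2 := rfl
  refine ⟨prob_error_le F hn (fun xs ys => ?_) (fun i => (hF i).1) herr, ?_, ?_⟩
  · rw [errorBit_senderA hlv hn]
    simp only [errorBit_eq]
  · rw [predAdv_other_le_iff, corruptB_run, PMF.map_comp, AdvLe.map_iff]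
    intro g hg
    have h := receiver_secure_indep (fun i => (F i).corruptB)
      (fun w => (toPair w.1.1, w.1.2, w.2)) hlv hn hq (fun i => ?_)
      -- Everything B sees, his own message and output included, is a function of his data, the
      -- sender's message and the error bit.
      (fun r m e => g ((receiverOut (lv k n) (List.ofFn fun i => (r i).1) m,
        (r, Fin.elim0, [choiceDiffs (List.ofFn fun i => (r i).1), flat m])), e))
      fun _ _ _ => hg _
    · refine le_trans (le_of_eq (ev_congr _ fun w _ => ?_)) (h.trans hadv)
      simp only [Function.comp_apply, errorBit_senderA hlv hn]
      simp only [outcome_senderA, hr, messages_senderA, toPair_ofPair, List.length_ofFn,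
        List.map_ofFn]
      rfl
    · have h := ((predAdv_other_le_iff _ _).1 (hF i).2.1)
      simp only [errorBit_eq] at h
      exact h
  · rw [predAdv_le_iff, corruptA_run, PMF.map_comp, AdvLe.map_iff]
    intro g hg
    have h := sender_secure_indep (lv := lv k n) (fun i => (F i).corruptA)
      (fun w => (toPair w.1.1, w.1.2, w.2)) hn0 (fun i => ?_)
      -- Likewise A's message and output are recomputed from the choice differences; `ofPair`
      -- restores the form in which A sees his bits.
      (fun r d e => g ((ofPair (senderOut (lv k n) (List.ofFn fun i => (r i).1) d),
        (fun i => (ofPair (r i).1, (r i).2), Fin.elim0,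
          [d, flat (senderMsg (lv k n) (List.ofFn fun i => (r i).1) d)])), e))
      fun _ _ _ => hg _
    · refine le_trans (le_of_eq (ev_congr _ fun w _ => ?_)) h
      simp only [Function.comp_apply, errorBit_senderA hlv hn]
      simp only [outcome_senderA, hr, messages_senderA, ofPair_toPair, List.length_ofFn,
        List.map_ofFn]
      rfl
    · have h := ((predAdv_le_iff _ _).1 (hF i).2.2).comp_snd
        fun y => ((toPair y.1.1, y.1.2), y.2)
      simp only [errorBit_eq] at h
      exact h

theorem isWOT_senderB (hlv : LvPos (lv k n)) (hn : n = lvSize (lv k n)) (hn0 : 0 < n)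
    (hF : ∀ i, (F i).IsWOT q 0 ε) (hq : 0 ≤ q) (hadv : advBound (lv k n) q ≤ δ)
    (herr : ∀ μs : List (PMF Bool), μs.length = lvSize (lv k n) →
      (∀ μ ∈ μs, 1 - 2 * ε ≤ ev μ sgn) → ((seqL μs).map (errRoot (lv k n)) true).toReal ≤ δ) :
    (((senderB lv).toProtocol k n).run F).IsWOT δ 0 δ := by
  have hr : (senderB lv).rounds = 3 := rfl
  refine ⟨prob_error_le F hn (fun xs ys => ?_) (fun i => (hF i).1) herr, ?_, ?_⟩
  · rw [errorBit_senderB hlv hn]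
    simp only [errorBit_eq, errPair_comm]
  · rw [predAdv_other_le_iff, corruptB_run, PMF.map_comp, AdvLe.map_iff]
    intro g hg
    have h := sender_secure_indep (lv := lv k n) (fun i => (F i).corruptB)
      (fun w => (w.1.2, toPair w.1.1, w.2)) hn0 (fun i => ?_)
      (fun r d e => g ((senderOut (lv k n) (List.ofFn fun i => (r i).1) d,
        (r, Fin.elim0,
          [[], d, flat (senderMsg (lv k n) (List.ofFn fun i => (r i).1) d)])), e))
      fun _ _ _ => hg _
    · refine le_trans (le_of_eq (ev_congr _ fun w _ => ?_)) h
      simp only [Function.comp_apply, errorBit_senderB hlv hn]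
      simp only [outcome_senderB, hr, messages_senderB, toPair_ofPair, List.length_ofFn,
        List.map_ofFn]
      rfl
    · have h := ((predAdv_other_le_iff _ _).1 (hF i).2.1)
      simp only [errorBit_eq, errPair_comm (toPair _)] at h
      exact h
  · rw [predAdv_le_iff, corruptA_run, PMF.map_comp, AdvLe.map_iff]
    intro g hg
    -- With the roles exchanged, B's secret first component is his choice bit C, so the receiver
    -- bound is exactly the bound on predicting C.
    have h := receiver_secure_indep (fun i => (F i).corruptA)
      (fun w => (w.1.2, toPair w.1.1, w.2)) hlv hn hq (fun i => ?_)
      (fun r m e => g ((ofPair (receiverOut (lv k n) (List.ofFn fun i => (r i).1) m),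
        (fun i => (ofPair (r i).1, (r i).2), Fin.elim0,
          [[], choiceDiffs (List.ofFn fun i => (r i).1), flat m])), e))
      fun _ _ _ => hg _
    · refine le_trans (le_of_eq (ev_congr _ fun w _ => ?_)) (h.trans hadv)
      simp only [Function.comp_apply, errorBit_senderB hlv hn]
      simp only [outcome_senderB, hr, messages_senderB, ofPair_toPair, List.length_ofFn,
        List.map_ofFn]
      rfl
    · have h := ((predAdv_le_iff _ _).1 (hF i).2.2).comp_snd
        fun y => ((toPair y.1.1, y.1.2), y.2)
      simp only [errorBit_eq, errPair_comm (toPair _)] at h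
      exact h

end Security

/-! ### Efficiency -/

section Efficiency

variable {lv : ℕ → ℕ → List (ℕ × ℕ)} {n : ℕ → ℕ}

theorem PT.toPairs {γ : Type} [Enc γ] {l : γ → List (Bool × Bool)} (hl : PT l) :
    PT fun x => (l x).map toPair := by
  unfold toPair
  exact PT.map (f := fun _ (x : Bool × Bool) => (xor x.1 x.2, x.1)) (by fun_prop) hl

theorem PT.ofPair {γ : Type} [Enc γ] {p : γ → Bool × Bool} (hp : PT p) :
    PT fun x => _root_.ofPair (p x) := by
  unfold _root_.ofPair
  fun_prop

theorem length_encodeMessages_cons (m : List Bool) (l : List Bits) :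
    (encodeMessages (m :: l)).length = 2 * m.length + 1 + (encodeMessages l).length := by
  simp [encodeMessages, List.length_flatMap, mul_comm]; ring

theorem length_encodeMessages_le {l l' : List Bits} (h : l <+: l') :
    (encodeMessages l).length ≤ (encodeMessages l').length := by
  obtain ⟨r, rfl⟩ := h
  rw [encodeMessages, encodeMessages, List.flatMap_append, List.length_append]
  exact Nat.le_add_right _ _

theorem ListProtocol.messages_prefix (L : ListProtocol) (k : ℕ) (xs ys : List (Bool × Bool))
    {t t' : ℕ} (h : t ≤ t') : L.messages k xs ys t <+: L.messages k xs ys t' := by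
  induction t', h using Nat.le_induction with
  | base => exact List.prefix_rfl
  | succ t' _ ih => exact ih.trans (List.prefix_append _ _)

theorem length_senderMsg_le (l : List (ℕ × ℕ)) (xs : List (Bool × Bool)) (d : List Bool) :
    (senderMsg l xs d).length ≤ l.length * xs.length := by
  refine (PT.length_sendMsg_le l (align xs d)).trans (Nat.mul_le_mul_left _ ?_)
  simp [align]

/-- Three messages at most: an empty one, n choice differences, and m pairs of bits. Each message
bit takes two bits of the encoding and each end of a message one. -/
theorem length_messages_le {k n m s : ℕ} (h : m ≤ (2 * k + 10) * n) (hs : s = k + n) :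
    1 + (2 * n + 1 + (2 * (2 * m) + 1)) ≤ (8 * s + 40) * s + 2 * s + 3 := by
  have h1 : m ≤ (2 * s + 10) * s := h.trans (Nat.mul_le_mul (by omega) (by omega))
  have h2 : (8 * s + 40) * s = 4 * ((2 * s + 10) * s) := by ring
  omega

theorem isEfficient_senderA (hlv : PT fun p : ℕ × ℕ => lv p.1 p.2)
    (hn : ∃ (c : Cmd) (P : Polynomial ℕ), ∀ k ≥ 1,
      c.OutputsWithin [unary k] (P.eval (k + n k)) (unary (n k)))
    (hlen : ∀ k ≥ 1, (lv k (n k)).length ≤ 2 * k + 10) :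
    IsEfficient n (fun _ => 0) fun k => (senderA lv).toProtocol k (n k) := by
  have h1 : PT fun p : ℕ × List (Bool × Bool) × List (List Bool) => lv p.1 p.2.1.length :=
    hlv.comp (show PT fun p : ℕ × List (Bool × Bool) × List (List Bool) =>
      (p.1, p.2.1.length) by fun_prop)
  have h2 : PT fun p : ℕ × List (Bool × Bool) × List (List Bool) => p.2.1.map toPair :=
    PT.toPairs (by fun_prop)
  refine ListProtocol.isEfficient ?_ ?_ ?_ ?_ hn
    ⟨(8 * Polynomial.X + 40) * Polynomial.X + 2 * Polynomial.X + 3, fun k hk xs ys hx hy t ht => ?_⟩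
  · unfold ListProtocol.PolyTime senderA; fun_prop
  · unfold ListProtocol.PolyTime senderA; fun_prop
  · exact PT.ofPair (by fun_prop)
  · unfold ListProtocol.PolyTime senderA; fun_prop
  · refine (length_encodeMessages_le ((senderA lv).messages_prefix k xs ys ht)).trans ?_
    have hr : (senderA lv).rounds = 2 := rfl
    rw [hr, messages_senderA, length_encodeMessages_cons, length_encodeMessages_cons, length_flat]
    have h3 := length_senderMsg_le (lv k xs.length) (xs.map toPair) (choiceDiffs ys)
    rw [List.length_map, hx] at h3
    have h4 := length_messages_le (h3.trans (Nat.mul_le_mul_right _ (hlen k hk))) rfl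
    have h5 : (encodeMessages []).length = 0 := rfl
    have h6 : (choiceDiffs ys).length = n k := by rw [choiceDiffs, List.length_map, hy]
    simp only [Polynomial.eval_add, Polynomial.eval_mul, Polynomial.eval_X, Polynomial.eval_ofNat]
    rw [hx, h5, h6]
    omega

theorem isEfficient_senderB (hlv : PT fun p : ℕ × ℕ => lv p.1 p.2)
    (hn : ∃ (c : Cmd) (P : Polynomial ℕ), ∀ k ≥ 1,
      c.OutputsWithin [unary k] (P.eval (k + n k)) (unary (n k)))
    (hlen : ∀ k ≥ 1, (lv k (n k)).length ≤ 2 * k + 10) :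
    IsEfficient n (fun _ => 0) fun k => (senderB lv).toProtocol k (n k) := by
  have h1 : PT fun p : ℕ × List (Bool × Bool) × List (List Bool) => lv p.1 p.2.1.length :=
    hlv.comp (show PT fun p : ℕ × List (Bool × Bool) × List (List Bool) =>
      (p.1, p.2.1.length) by fun_prop)
  have h2 : PT fun p : ℕ × List (Bool × Bool) × List (List Bool) => p.2.1.map toPair :=
    PT.toPairs (by fun_prop)
  refine ListProtocol.isEfficient ?_ ?_ ?_ ?_ hn
    ⟨(8 * Polynomial.X + 40) * Polynomial.X + 2 * Polynomial.X + 3, fun k hk xs ys hx hy t ht => ?_⟩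
  · unfold ListProtocol.PolyTime senderB; fun_prop
  · unfold ListProtocol.PolyTime senderB; fun_prop
  · exact PT.ofPair (by fun_prop)
  · unfold ListProtocol.PolyTime senderB; fun_prop
  · refine (length_encodeMessages_le ((senderB lv).messages_prefix k xs ys ht)).trans ?_
    have hr : (senderB lv).rounds = 3 := rfl
    rw [hr, messages_senderB, length_encodeMessages_cons, length_encodeMessages_cons,
      length_encodeMessages_cons, length_flat]
    have h3 := length_senderMsg_le (lv k ys.length) ys (choiceDiffs (xs.map toPair))
    rw [hy] at h3
    have h4 := length_messages_le (h3.trans (Nat.mul_le_mul_right _ (hlen k hk))) rfl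
    have h5 : (encodeMessages []).length = 0 := rfl
    have h6 : (choiceDiffs (xs.map toPair)).length = n k := by
      rw [choiceDiffs, List.length_map, List.length_map, hx]
    simp only [Polynomial.eval_add, Polynomial.eval_mul, Polynomial.eval_X, Polynomial.eval_ofNat]
    rw [hy, h5, h6, List.length_nil]
    omega

end Efficiency

/-- The parameters of the protocols. -/
theorem exists_levels {q ε : ℕ → ℝ} (hqc : PolyTimeComputable q) (hεc : PolyTimeComputable ε)
    (h : ∀ k ≥ 1, 0 ≤ q k ∧ 0 ≤ ε k ∧ Real.sqrt (q k) + 2 * ε k < 1) :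
    ∃ (lv : ℕ → ℕ → List (ℕ × ℕ)) (n : ℕ → ℕ), (PT fun p : ℕ × ℕ => lv p.1 p.2) ∧
      (∃ (c : Cmd) (P : Polynomial ℕ), ∀ k ≥ 1,
        c.OutputsWithin [unary k] (P.eval (k + n k)) (unary (n k))) ∧
      ∀ k ≥ 1, (lv k (n k)).length ≤ 2 * k + 10 ∧ LvPos (lv k (n k)) ∧ n k = lvSize (lv k (n k)) ∧
        (n k : ℝ) ≤ 37 * 46656 * 27 * ((k : ℝ) ^ (2.6 : ℝ) * lam (q k) (ε k) /
          (1 - 2 * ε k) ^ (12 * lam (q k) (ε k))) ∧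
        advBound (lv k (n k)) (q k) ≤ 1 / 2 ^ k ∧
        ∀ μs : List (PMF Bool), μs.length = lvSize (lv k (n k)) →
          (∀ μ ∈ μs, 1 - 2 * ε k ≤ ev μ sgn) →
          ((seqL μs).map (errRoot (lv k (n k))) true).toReal ≤ 1 / 2 ^ k := by
  classical
  obtain ⟨cq, Pq, a, ha⟩ := hqc
  obtain ⟨cε, Pε, b, hb⟩ := hεc
  have ha' : Approximates a q := fun k hk m => (ha k hk m).2
  have hb' : Approximates b ε := fun k hk m => (hb k hk m).2
  have hra := PT.of_outputsWithin fun k hk m => (ha k hk m).1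
  have hrb := PT.of_outputsWithin fun k hk m => (hb k hk m).1
  have hex : ∀ k, ∃ τ, k ≥ 1 → isGood a b k τ = true ∧ ∀ t < τ, isGood a b k t = false := by
    intro k
    rcases Nat.lt_or_ge k 1 with hk | hk
    · exact ⟨0, fun hk' => absurd hk' (by omega)⟩
    · obtain ⟨h1, h2, h3⟩ := h k hk
      have hg : ∃ t, isGood a b k t = true :=
        (exists_isGood ha' hb' hk h1 h2 h3).imp fun t => And.left
      exact ⟨Nat.find hg, fun _ => ⟨Nat.find_spec hg, fun i hi => by
        simpa using Nat.find_min hg hi⟩⟩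
  choose τ hτ using hex
  have hspec : ∀ k ≥ 1, _ := fun k hk =>
    let ⟨h1, h2, h3⟩ := h k hk
    have hs := Real.sqrt_nonneg (q k)
    isGood_spec ha' hb' hk h1 (Real.sqrt_le_one.1 (by linarith)) (by linarith) (hτ k hk).1
  -- The players' programs see only k and the number n of instances. Since τ k ≤ n, the search for
  -- the least good t up to n returns τ k.
  have hlvn : ∀ k ≥ 1, levelsOf a b k (firstTrue (isGood a b k) (totalSize a b k (τ k))) =
      levelsOf a b k (τ k) := fun k hk =>
    congrArg (levelsOf a b k) (firstTrue_eq (hτ k hk).1 (hτ k hk).2 (hspec k hk).2.1)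
  refine ⟨fun k n => levelsOf a b k (firstTrue (isGood a b k) n),
    fun k => totalSize a b k (τ k), ?_, ?_, fun k hk => ?_⟩
  · refine PT.levelsOf hra hrb (by fun_prop) 
      (PT.firstTrue (p := fun x : ℕ × ℕ => isGood a b x.1) ?_ PT.snd)
    exact PT.isGood (k := fun p : (ℕ × ℕ) × ℕ => p.1.1) (t := fun p => p.2) hra hrb (by fun_prop)
      (by fun_prop)
  · obtain ⟨c, P, hc⟩ := PT.search (test := isGood a b) (τ := τ) (f := totalSize a b)
      (PT.isGood hra hrb PT.fst PT.snd) hτ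
      (PT.totalSize hra hrb PT.fst PT.snd)
    refine ⟨c, P, fun k hk => ?_⟩
    obtain ⟨t, ht, h1⟩ := hc k hk
    exact ⟨t, ht.trans (P.eval_mono_nat (Nat.add_le_add_left (hspec k hk).2.1 k)), h1⟩
  · simp only [hlvn k hk]
    obtain ⟨h1, h2, h3⟩ := h k hk
    obtain ⟨s1, s2, s3, s4⟩ := hspec k hk
    refine ⟨?_, s1, (lvSize_levelsOf k (τ k)).symm, ?_, s3, s4⟩
    · have h4 := two_pow_width_le k
      have h5 : width k < 2 ^ width k := Nat.lt_two_pow_self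
      simp only [levelsOf, levels, List.length_cons, List.length_replicate]
      omega
    -- The size bound holds up to some good t, and τ k, being the least good one, is not larger.
    · obtain ⟨t, ht, h4⟩ := exists_isGood ha' hb' hk h1 h2 h3
      refine h4 _ (not_lt.1 fun hlt => ?_)
      rw [(hτ k hk).2 t hlt] at ht
      exact Bool.false_ne_true ht

end

theorem mainTheorem7 :
    ∃ C : ℝ, 0 < C ∧ ∀ q ε : ℕ → ℝ, PolyTimeComputable q → PolyTimeComputable ε →
      (∀ k ≥ 1, 0 ≤ q k ∧ 0 ≤ ε k ∧ Real.sqrt (q k) + 2 * ε k < 1) →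
      EfficientlyImplementable
        (fun _ => 0) q ε
        (fun _ => 0) (fun k => 1 / 2 ^ k) (fun k => 1 / 2 ^ k)
        (fun k => C * ((k : ℝ) ^ (2.6 : ℝ) * lam (q k) (ε k) /
          (1 - 2 * ε k) ^ (12 * lam (q k) (ε k)))) ∧
      EfficientlyImplementable
        q (fun _ => 0) ε
        (fun k => 1 / 2 ^ k) (fun _ => 0) (fun k => 1 / 2 ^ k)
        (fun k => C * ((k : ℝ) ^ (2.6 : ℝ) * lam (q k) (ε k) /
          (1 - 2 * ε k) ^ (12 * lam (q k) (ε k)))) := by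
  -- The factor 37 comes from the first level, 46656 = 6 ^ 6 from six extra levels that gain the
  -- factor 64 in the exponent, and 27 from bounding 3 ^ 2.6.
  refine ⟨37 * 46656 * 27, by norm_num, fun q ε hqc hεc h => ?_⟩
  obtain ⟨lv, n, hlv, hn, hspec⟩ := exists_levels hqc hεc h
  -- Without an instance there would be no first choice bit, and the output would be a known default
  -- value.
  have hpos : ∀ k ≥ 1, 0 < n k := fun k hk => by
    rw [(hspec k hk).2.2.1]
    refine Nat.pos_of_ne_zero fun h0 => ?_
    obtain ⟨rs, hrs, h1⟩ := List.mem_map.1 (List.prod_eq_zero_iff.1 h0)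
    have h2 := (hspec k hk).2.1 rs hrs
    exact (Nat.mul_pos h2.1 h2.2).ne' h1
  refine ⟨⟨n, fun _ => 0, _, isEfficient_senderA hlv hn fun k hk => (hspec k hk).1,
    fun k hk => ?_⟩, ⟨n, fun _ => 0, _, isEfficient_senderB hlv hn fun k hk => (hspec k hk).1,
    fun k hk => ?_⟩⟩
  · obtain ⟨-, h2, h3, h4, h5, h6⟩ := hspec k hk
    exact ⟨h4, fun U V F hF => isWOT_senderA h2 h3 (hpos k hk) hF (h k hk).1 h5 h6⟩
  · obtain ⟨-, h2, h3, h4, h5, h6⟩ := hspec k hk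
    exact ⟨h4, fun U V F hF => isWOT_senderB h2 h3 (hpos k hk) hF (h k hk).1 h5 h6⟩
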